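/- **Theorem 4.8.** Let $p$ be a prime and $F$ a finite extension of $\mathbb{Q}_p$, with ring of integers $\mathcal{O}_F$, residue field of cardinality $q$, and norm $\|\cdot\|$ normalized by $\|p\|=p^{-[F:\mathbb{Q}_p]}$; extend the norm to all finite extensions of $F$. Let $E$ be a finite étale $F$-algebra of degree $r=[E:F]$, written $E=K_1\times\cdots\times K_m$ with $K_i/F$ finite field extensions. Put $\|(x_1,\dots,x_m)\|=\max_i\|x_i\|$ and $\mathcal{O}_E=\{x\in E:\|x\|\le 1\}$; let $N_{E/F}$ be the norm map, $D_E=D_{K_1}\cdots D_{K_m}$ the discriminant of $E/F$ (well defined up to the square of a unit of $\mathcal{O}_F$), $\lambda_E$ the Haar measure on $E$ with $\lambda_E(\mathcal{O}_E)=1$, and $$H(x_1,\dots,x_m)=\prod_{i=1}^m\max\bigl(1,\|x_i\|^{[K_i:F]}\bigr).$$ For $n\ge 0$ let $\Omega_n$ be the space of polynomials of degree at most $n$ with coefficients in $\mathcal{O}_F$, with the probability measure $\lambda_F^{\otimes(n+1)}$ on the coefficients; for $n<0$ let $\Omega_n=\{0\}$. For $x\in E$ let $\Lambda_x=\mathcal{O}_F+\mathcal{O}_F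 x+\cdots+\mathcal{O}_F x^{r-1}$ (which equals $\mathcal{O}_F[x]$ when $x\in\mathcal{O}_E$) and $$\rho_{E,n}(x)=\frac{\|D_E\|\cdot\lambda_E(\Lambda_x)}{H(x)^{n+1}}\int_{\Omega_{n-r}}\|N_{E/F}(Q(x))\|\,dQ .$$ An element $x\in E$ is *new* in $E$ if $F[x]=E$. For $U\subset E$ open and $P\in\Omega_n$ let $Z_{U,n}(P)$ (resp. $Z^{\mathrm{new}}_{U,n}(P)$) be the number of roots (resp. of roots new in $E$) of $P$ in $U$. Let $n\ge 1$. For every open subset $U$ of $E$, $$\mathbb{E}[Z^{\mathrm{new}}_{U,n}]=\int_U\rho_{E,n}\,d\lambda_E,\qquad \mathbb{E}[Z_{U,n}]=\sum_{E'\subset E}\int_{U\cap E'}\rho_{E',n}\,d\lambda_{E'},$$ where the sum runs over the (finitely many) $F$-subalgebras $E'$ of $E$, the random variables are measurable up to a null set, and all the densities involved are integrable on the sets indicated. Moreover: 1. (Vanishing) If $x \in E$ and $F[x]\ne E$ or $n<r$, then $\rho_{E,n}(x)=0$. 2. (Continuity) $\rho_{E,n}$ is continuous on $E$. 3. (Transformation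 under homography) For $\begin{pmatrix}a&b\\c&d\end{pmatrix}\in\mathrm{GL}_2(\mathcal{O}_F)$ and $x\in E$ such that $cx+d$ is invertible in $E$, $$\rho_{E,n}\Bigl(\frac{ax+b}{cx+d}\Bigr)=\|N_{E/F}(cx+d)\|^2\cdot\rho_{E,n}(x).$$ 4. (Ultimate constancy) If $n\ge 2r-1$, then $\rho_{E,n}=\rho_{E,2r-1}$ (if $E=0$, so that $r=0$, read $0$ for $2r-1$). 5. (Formulas for extremal degrees) If $F[x]=E$ and $x\in\mathcal{O}_E$, then $$\rho_{E,r}(x)=\|D_E\|\cdot\frac{1}{\#(\mathcal{O}_E/\mathcal{O}_F[x])}\cdot\frac{q^{r+1}-q^r}{q^{r+1}-1},$$ and, for $n\ge 2r-1$, $$\rho_{E,n}(x)=\|D_E\|\int_{\mathcal{O}_F[x]}\|N_{E/F}(t)\|\,d\lambda_E(t).$$ -/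

import Mathlib

open MeasureTheory Polynomial
open scoped ENNReal

namespace PadicRoots

noncomputable section

/-- The additive Haar measure on `G` normalized by giving mass `1` to the set `S`. It exists and is
unique when `G` is a Hausdorff second countable locally compact group and `S` is compact and open,
the only case in which it is used; see `normalizedHaar_spec` for the existence. -/
def normalizedHaar {G : Type*} [AddGroup G] [TopologicalSpace G] [MeasurableSpace G]
    (S : Set G) : Measure G :=
  Classical.epsilon fun μ : Measure G => μ.IsAddHaarMeasure ∧ μ S = 1

theorem normalizedHaar_spec {G : Type*} [AddGroup G] [TopologicalSpace G]
    [IsTopologicalAddGroup G] [MeasurableSpace G] [BorelSpace G] {S : Set G}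
    (hS : IsCompact S) (hS' : (interior S).Nonempty) :
    (normalizedHaar S).IsAddHaarMeasure ∧ normalizedHaar S S = 1 :=
  Classical.epsilon_spec (p := fun μ : Measure G => μ.IsAddHaarMeasure ∧ μ S = 1)
    ⟨Measure.addHaarMeasure ⟨⟨S, hS⟩, hS'⟩, inferInstance,
      Measure.addHaarMeasure_self (K₀ := ⟨⟨S, hS⟩, hS'⟩)⟩

section BaseField

variable (F : Type*) [NontriviallyNormedField F] [IsUltrametricDist F]

/-- The ring of integers `𝒪_F = {a ∈ F : ‖a‖ ≤ 1}`. -/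
abbrev OF : ValuationSubring F := (NormedField.valuation (K := F)).valuationSubring

/-- The cardinality `q` of the residue field of `F`. -/
def resCard : ℕ := Nat.card (IsLocalRing.ResidueField (OF F))

/-- The Haar measure `λ_F` on `F`, normalized by `λ_F(𝒪_F) = 1`. -/
def haarF [MeasurableSpace F] : Measure F := normalizedHaar (OF F : Set F)

/-- The product measure `λ_F^{⊗ m}` on `𝒪_F ^ m`, i.e. on the polynomials of degree `< m` with
coefficients in `𝒪_F`. Thus `μ_n` is `coeffMeasure F (n + 1)`. -/
def coeffMeasure [MeasurableSpace F] (m : ℕ) : Measure (Fin m → OF F) :=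
  Measure.pi fun _ => (haarF F).comap Subtype.val

variable {F}

/-- The polynomial `a₀ + a₁ X + ⋯ + a_{m-1} X^{m-1}`, seen in `F[X]`. -/
def toPoly {m : ℕ} (a : Fin m → OF F) : F[X] :=
  ∑ i : Fin m, monomial (i : ℕ) (a i : F)

end BaseField

section FieldExtension

variable (F : Type*) [NontriviallyNormedField F] [IsUltrametricDist F]
  (K : Type*) [Field K] [Algebra F K] [Algebra.IsAlgebraic F K]

/-- The ring of integers `𝒪_K` of an algebraic extension `K` of `F`: the elements of norm at most
`1`, for the norm on `K` extending that of `F`. -/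
def fieldIntegers : Subalgebra (OF F) K where
  carrier := {x | spectralNorm F K x ≤ 1}
  mul_mem' {x y} hx hy :=
    (spectralNorm_mul (Algebra.IsAlgebraic.isAlgebraic x) (Algebra.IsAlgebraic.isAlgebraic y)).trans
      (mul_le_one₀ hx (spectralNorm_nonneg _) hy)
  add_mem' {x y} hx hy :=
    (isNonarchimedean_spectralNorm x y).trans (max_le hx hy)
  algebraMap_mem' a := by
    change spectralNorm F K (algebraMap F K (a : F)) ≤ 1
    rw [spectralNorm_extends]
    exact a.2

open Classical in
/-- The discriminant `D_K` of a finite extension `K` of `F`: the determinant of the matrix of the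
trace form `(x, y) ↦ Tr_{K/F}(x y)` in a basis of `𝒪_K` over `𝒪_F`. It is defined up to the square
of a unit of `𝒪_F`; one basis is chosen. (Such a basis exists because `𝒪_F` is a complete discrete
valuation ring and `K/F` is finite separable; the value `0` is a placeholder never used then.) -/
def fieldDiscr : F :=
  if h : Nonempty (Module.Basis (Fin (Module.finrank F K)) (OF F) (fieldIntegers F K)) then
    Algebra.discr F (fun i => ((h.some i : fieldIntegers F K) : K))
  else 0

end FieldExtension

section EtaleAlgebra

variable (F : Type*) [NontriviallyNormedField F] [IsUltrametricDist F]

section Factors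

variable (E : Type*) [CommRing E] [Algebra F E]

/-- The factors of a finite étale algebra: `E` is canonically the product of the fields
`E ⧸ 𝔪`, for `𝔪` in the (finite) set of maximal ideals of `E`. The `𝔪`-component of `x : E` is its
class modulo `𝔪`. -/
abbrev Factor {E : Type*} [CommRing E] (𝔪 : MaximalSpectrum E) : Type _ := E ⧸ 𝔪.asIdeal

instance instFieldFactor {E : Type*} [CommRing E] (𝔪 : MaximalSpectrum E) : Field (Factor 𝔪) :=
  @Ideal.Quotient.field E _ 𝔪.asIdeal 𝔪.isMaximal

variable {E}

/-- The projection `E → E ⧸ 𝔪` of `E` onto one of its factors. -/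
def toFactor (𝔪 : MaximalSpectrum E) : E →ₐ[F] Factor 𝔪 := Ideal.Quotient.mkₐ F 𝔪.asIdeal

/-- The norm on a finite étale `F`-algebra `E = K₁ × ⋯ × K_m`:
`‖(x₁, …, x_m)‖ = max (‖x₁‖, …, ‖x_m‖)`, where the norm on `K_i` is the one extending that
of `F`. -/
def etaleNorm (x : E) : ℝ :=
  ⨆ 𝔪 : MaximalSpectrum E, spectralNorm F (Factor 𝔪) (toFactor F 𝔪 x)

/-- The height `H(x₁, …, x_m) = ∏ max (1, ‖x_i‖ ^ [K_i : F])`. -/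
def height (x : E) : ℝ :=
  ∏ᶠ 𝔪 : MaximalSpectrum E,
    max 1 (spectralNorm F (Factor 𝔪) (toFactor F 𝔪 x) ^ Module.finrank F (Factor 𝔪))

/-- `x` is new in `E` if `F[x] = E`. -/
def IsNew (x : E) : Prop := Algebra.adjoin F {x} = ⊤

/-- `Z_{U,n}(P)`: the number of roots in `U` of the polynomial `P` of degree at most `n`
with coefficient vector `a`. -/
def numRoots (U : Set E) (n : ℕ) (a : Fin (n + 1) → OF F) : ℝ≥0∞ :=
  ({x : E | x ∈ U ∧ aeval x (toPoly a) = 0}.encard : ℕ∞)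

/-- `Z^new_{U,n}(P)`: the number of roots in `U` of the polynomial `P` of degree at most `n`
with coefficient vector `a` that are new in `E`. -/
def numNewRoots (U : Set E) (n : ℕ) (a : Fin (n + 1) → OF F) : ℝ≥0∞ :=
  ({x : E | x ∈ U ∧ aeval x (toPoly a) = 0 ∧ IsNew F x}.encard : ℕ∞)

end Factors

theorem finite_maximalSpectrum (F E : Type*) [Field F] [CommRing E] [Algebra F E]
    [Module.Finite F E] : Finite (MaximalSpectrum E) :=
  have : IsArtinianRing E := IsArtinianRing.of_finite F E
  inferInstance

variable (E : Type*) [CommRing E] [Algebra F E] [Module.Finite F E]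

variable {E} in
theorem etaleNorm_le_one_iff (x : E) :
    etaleNorm F x ≤ 1 ↔
      ∀ 𝔪 : MaximalSpectrum E, toFactor F 𝔪 x ∈ fieldIntegers F (Factor 𝔪) := by
  have := finite_maximalSpectrum F E
  refine ⟨fun h 𝔪 => (le_ciSup (Set.finite_range _).bddAbove 𝔪).trans h, fun h => ?_⟩
  exact Real.iSup_le h zero_le_one

/-- The ring `𝒪_E` of the elements of `E` of norm at most `1`. -/
def etaleIntegers : Subalgebra (OF F) E where
  carrier := {x | etaleNorm F x ≤ 1}
  mul_mem' {x y} hx hy := (etaleNorm_le_one_iff F _).2 fun 𝔪 => by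
    rw [map_mul]
    exact mul_mem ((etaleNorm_le_one_iff F x).1 hx 𝔪) ((etaleNorm_le_one_iff F y).1 hy 𝔪)
  add_mem' {x y} hx hy := (etaleNorm_le_one_iff F _).2 fun 𝔪 => by
    rw [map_add]
    exact add_mem ((etaleNorm_le_one_iff F x).1 hx 𝔪) ((etaleNorm_le_one_iff F y).1 hy 𝔪)
  algebraMap_mem' a := (etaleNorm_le_one_iff F _).2 fun 𝔪 => by
    change toFactor F 𝔪 (algebraMap F E (a : F)) ∈ _
    rw [AlgHom.commutes]
    exact (fieldIntegers F (Factor 𝔪)).algebraMap_mem a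

/-- The discriminant `D_E = D_{K₁} ⋯ D_{K_m}` of `E = K₁ × ⋯ × K_m` (well defined up to the square
of a unit of `𝒪_F`, so that `‖D_E‖` is well defined). -/
def etaleDiscr : F := ∏ᶠ 𝔪 : MaximalSpectrum E, fieldDiscr F (Factor 𝔪)

/-- The Haar measure `λ_E` on `E`, normalized by `λ_E(𝒪_E) = 1`. -/
def etaleHaar [TopologicalSpace E] [MeasurableSpace E] : Measure E :=
  normalizedHaar (etaleIntegers F E : Set E)

variable {E}

/-- The `𝒪_F`-lattice spanned by `1, x, …, x^{r-1}`, where `r = [E : F]`. When `x` lies in `𝒪_E`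
it is the `𝒪_F`-algebra `𝒪_F[x]`. -/
def powerLattice (x : E) : Set E :=
  Set.range fun a : Fin (Module.finrank F E) → OF F => aeval x (toPoly a)

/-- The density function
`ρ_{E,n}(x) = ‖D_E‖ ⬝ λ_E(𝒪_F[x]) / H(x)^{n+1} ⬝ ∫_{Ω_{n-r}} ‖N_{E/F}(Q(x))‖ dQ`, where `𝒪_F[x]`
stands for the lattice spanned by `1, x, …, x^{r-1}`. An element of `Ω_{n-r}` is given by its
`n + 1 - r` coefficients; the subtraction is truncated in accordance with `Ω_m = {0}`
for `m < 0`. -/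
def density (E : Type*) [CommRing E] [Algebra F E] [Module.Finite F E] [TopologicalSpace E]
    [MeasurableSpace E] [MeasurableSpace F] (n : ℕ) (x : E) : ℝ :=
  ‖etaleDiscr F E‖ * (etaleHaar F E (powerLattice F x)).toReal / height F x ^ (n + 1) *
    ∫ a : Fin (n + 1 - Module.finrank F E) → OF F,
      ‖Algebra.norm F (aeval x (toPoly a))‖ ∂(coeffMeasure F (n + 1 - Module.finrank F E))

/-- The `𝒪_F`-algebra `𝒪_F[x]` generated by `x`. -/
abbrev intAdjoin (x : E) : Subalgebra (OF F) E := Algebra.adjoin (OF F) {x}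

/-- The index `#(𝒪_E / 𝒪_F[x])` (meaningful when `x ∈ 𝒪_E`). -/
def intIndex (x : E) : ℕ :=
  Nat.card ((Subalgebra.toSubmodule (etaleIntegers F E)) ⧸
    (Subalgebra.toSubmodule (intAdjoin F x)).submoduleOf
      (Subalgebra.toSubmodule (etaleIntegers F E)))

end EtaleAlgebra

end

end PadicRoots

open PadicRoots

set_option linter.unusedSectionVars false

open MeasureTheory Polynomial
open scoped ENNReal

/-! If `x` is a root of `P` and `F[x] = E`, the characteristic polynomial `χ_x` of multiplication by
`x` divides `P`. New roots of `P` thus correspond to factorizations `P = χ_x Q` with `deg Q ≤ n -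
r`, and counting them means counting the points in the fibres of `(x, Q) ↦ χ_x Q` (`rootMap`). By a
non-archimedean area formula (`area_formula`), the expected count is the integral of the Jacobian
over the pairs for which `χ_x Q` is integral. The points where the derivative degenerates only
matter for polynomials `P` having a root at which `P'` is not invertible, and these form a null set
(`piHaar_criticalValues`).

The Jacobian (`IsIntegralBasis.exists_jacobian_rootMap`) is found as follows. The map `(R, G) ↦ R +
χ_x G` preserves volume (`measurePreserving_mulAdd`), so only the derivative in `x`, taken modulo
`χ_x`, matters. Reduction modulo `χ_x` is evaluation at `x`, and differentiating `χ_{x+ty}(x + ty) =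
0` shows that the derivative becomes `y ↦ -χ_x'(x) Q(x) y`. Evaluation `R ↦ R(x)` scales volumes by
`v = λ_E(Λ_x)`, while `‖N(χ_x'(x))‖ = ‖D_E‖ v²` (`norm_derivative_charPoly_eq`). The Jacobian is
therefore `‖D_E‖ v ‖N(Q(x))‖`. By Gauss's lemma the largest coefficient of `χ_x` has norm `H(x)`
(`supNorm_charPoly`), so integrality of `χ_x Q` bounds `Q` by `1 / H(x)`; rescaling `Q` produces the
factor `H(x)^{-(n+1)}`. The count of all roots follows because each root `x` is new in exactly one
subalgebra, `F[x]`.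

For homographies, `GL₂(𝒪_F)` acts on polynomials preserving the measure, and each ingredient of the
density is multiplied by a power of `‖N(cx + d)‖`. For ultimate constancy, the random value `Q(x)`
is uniform on the lattice spanned by powers of `x` (`IsNew.lintegral_coeffMeasure`). Multiplication
by `h(x)`, with `h` integral and `‖N(h(x))‖ = H(x)^{deg h}`, carries one such lattice onto a longer
one up to a null set. Two trinomials `h` of consecutive degrees then give the recursion
(`IsNew.latticeIntegral_succ`). When `x ∈ 𝒪_E` the height is `1` and the lattice is the ring
`𝒪_F[x]`.

Throughout, the norm of `F` is its Haar modulus (`IsNormalized`), which is what the normalization at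
`p` means, and étale is used in the form of reduced in characteristic zero. -/

namespace PadicRoots

section

open scoped Pointwise

/-! ### The ring of integers of `F` -/

section Integers

theorem mem_OF {F : Type*} [NontriviallyNormedField F] [IsUltrametricDist F] {a : F} :
    a ∈ OF F ↔ ‖a‖ ≤ 1 := Iff.rfl

theorem coe_OF (F : Type*) [NontriviallyNormedField F] [IsUltrametricDist F] :
    (OF F : Set F) = Metric.closedBall 0 1 := by
  ext a
  rw [mem_closedBall_zero_iff]
  exact mem_OF

variable {F : Type*} [NontriviallyNormedField F] [IsUltrametricDist F]

theorem isOpen_OF : IsOpen (OF F : Set F) := by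
  rw [coe_OF]; exact IsUltrametricDist.isOpen_closedBall _ one_ne_zero

theorem isOpenEmbedding_coe_OF : Topology.IsOpenEmbedding (Subtype.val : OF F → F) :=
  isOpen_OF.isOpenEmbedding_subtypeVal

theorem isUnit_OF_iff {a : OF F} : IsUnit a ↔ ‖(a : F)‖ = 1 := by
  rw [ValuationSubring.valuation_eq_one_iff, Valuation.isEquiv_iff_val_eq_one.1
    (Valuation.isEquiv_valuation_valuationSubring (NormedField.valuation (K := F))).symm,
    ← NNReal.coe_inj]
  rfl

theorem mem_maximalIdeal_OF_iff {a : OF F} :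
    a ∈ IsLocalRing.maximalIdeal (OF F) ↔ ‖(a : F)‖ < 1 := by
  rw [IsLocalRing.mem_maximalIdeal, mem_nonunits_iff, isUnit_OF_iff]
  exact ⟨fun h => lt_of_le_of_ne a.2 h, fun h => h.ne⟩

variable [ProperSpace F]

theorem isCompact_OF : IsCompact (OF F : Set F) := by
  rw [coe_OF]; exact isCompact_closedBall _ _

instance : CompactSpace (OF F) := isCompact_iff_compactSpace.1 isCompact_OF

instance : IsDiscreteValuationRing (OF F) := by
  let := NormedField.toValued (K := F)
  have : CompactSpace (Valued.integer F) := inferInstanceAs (CompactSpace (OF F))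
  have : (Valued.v (R := F)).IsNontrivial := by
    obtain ⟨x, hx⟩ := NormedField.exists_one_lt_norm F
    refine ⟨x, ?_, ?_⟩
    · have : x ≠ 0 := by rintro rfl; simp at hx; linarith
      simpa using this
    · intro h
      have : ‖x‖ = 1 := by simpa [← NNReal.coe_inj] using h
      linarith
  exact Valued.integer.isDiscreteValuationRing_of_compactSpace (K := F)

end Integers

/-! ### Topology of `F` and the Haar modulus of `p` -/

section PadicField

variable (p : ℕ) [Fact p.Prime] {F : Type*} [NontriviallyNormedField F]
  [Algebra ℚ_[p] F] [FiniteDimensional ℚ_[p] F]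
  (hF : ∀ a : ℚ_[p], ‖algebraMap ℚ_[p] F a‖ = ‖a‖ ^ Module.finrank ℚ_[p] F)

include hF

/-- The norm of `F` restricts to a power of the `p`-adic norm, so `F` is not a normed space over
`ℚ_[p]` in general. It is still a topological vector space, and this suffices. -/
theorem continuousSMul_of_norm_algebraMap : ContinuousSMul ℚ_[p] F := by
  have h : Continuous (algebraMap ℚ_[p] F) := by
    refine continuous_of_continuousAt_zero (algebraMap ℚ_[p] F) ?_
    rw [ContinuousAt, map_zero, tendsto_zero_iff_norm_tendsto_zero]
    simp_rw [hF]
    have : Continuous fun a : ℚ_[p] => ‖a‖ ^ Module.finrank ℚ_[p] F := by fun_prop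
    have h2 := this.tendsto 0
    rwa [norm_zero, zero_pow Module.finrank_pos.ne'] at h2
  exact continuousSMul_of_algebraMap _ _ h

theorem properSpace_of_norm_algebraMap : ProperSpace F := by
  have := continuousSMul_of_norm_algebraMap p hF
  let e : F ≃L[ℚ_[p]] (Fin (Module.finrank ℚ_[p] F) → ℚ_[p]) :=
    ContinuousLinearEquiv.ofFinrankEq (by simp)
  have : LocallyCompactSpace F := e.toHomeomorph.isClosedEmbedding.locallyCompactSpace
  exact .of_nontriviallyNormedField_of_weaklyLocallyCompactSpace F

/-- In a basis over `ℚ_[p]`, multiplication by `p` maps the compact open lattice `ℤ_[p]^d` onto a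
sublattice of index `p^d`. Hence it divides volumes by `p^d`, the inverse of the prescribed norm of
`p`. -/
theorem distribHaarChar_natCast [LocallyCompactSpace F] (u : Fˣ) (hu : (u : F) = p) :
    (distribHaarChar F u : ℝ) = ‖(u : F)‖ := by
  have := continuousSMul_of_norm_algebraMap p hF
  set d := Module.finrank ℚ_[p] F
  let e : F ≃L[ℚ_[p]] (Fin d → ℚ_[p]) := ContinuousLinearEquiv.ofFinrankEq (by simp [d])
  let : MeasurableSpace F := borel F
  have : BorelSpace F := ⟨rfl⟩
  let : MeasurableSpace (Fin d → ℤ_[p]) := borel _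
  have : BorelSpace (Fin d → ℤ_[p]) := ⟨rfl⟩
  have : MeasurableAdd F := ContinuousAdd.measurableAdd
  let i : (Fin d → ℤ_[p]) →+ (Fin d → ℚ_[p]) :=
    { toFun := fun x j => (x j : ℚ_[p])
      map_zero' := by ext; simp
      map_add' := fun x y => by ext; simp }
  let g : (Fin d → ℤ_[p]) →+ F := (e.symm.toLinearEquiv.toAddEquiv.toAddMonoidHom).comp i
  have hi : Topology.IsOpenEmbedding i := by
    refine ⟨Topology.IsEmbedding.piMap (fun _ => PadicInt.isOpenEmbedding_coe.isEmbedding), ?_⟩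
    have : Set.range i = Set.univ.pi fun _ => Set.range ((↑) : ℤ_[p] → ℚ_[p]) := by
      rw [← Set.range_piMap]; rfl
    rw [this]
    exact isOpen_set_pi Set.finite_univ fun _ _ => PadicInt.isOpenEmbedding_coe.isOpen_range
  have hg : Topology.IsOpenEmbedding g := e.symm.toHomeomorph.isOpenEmbedding.comp hi
  let μ : Measure F := Measure.addHaar
  let ν := μ.comap g
  have : ν.IsAddHaarMeasure := Measure.IsAddHaarMeasure.comap (mH := inferInstance) μ hg
  -- Reduction modulo `p`: its kernel is `p ℤ_[p]^d` and its image has `p^d` elements.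
  let f : (Fin d → ℤ_[p]) →+ (Fin d → ZMod p) :=
    { toFun := fun x j => PadicInt.toZMod (x j)
      map_zero' := by ext; simp
      map_add' := fun x y => by ext; simp }
  have hfs : Function.Surjective f := by
    intro y
    choose x hx using fun j => ZMod.ringHom_surjective (PadicInt.toZMod (p := p)) (y j)
    exact ⟨x, funext hx⟩
  have hind : f.ker.index = p ^ d := by
    rw [AddSubgroup.index_ker, AddMonoidHom.range_eq_top.2 hfs]
    simp
  have hgp : ∀ x, u • g x = g ((p : ℤ_[p]) • x) := by
    intro x
    have : i ((p : ℤ_[p]) • x) = (p : ℚ_[p]) • i x := by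
      ext j; simp [i]
    change (u : F) * e.symm (i x) = e.symm (i _)
    rw [this, map_smul, hu, Algebra.smul_def, map_natCast]
  have hfk : (f.ker : Set (Fin d → ℤ_[p])) = Set.range fun x => (p : ℤ_[p]) • x := by
    ext x
    have : x ∈ f.ker ↔ ∀ j, x j ∈ Ideal.span {(p : ℤ_[p])} := by
      rw [← PadicInt.maximalIdeal_eq_span_p, ← PadicInt.ker_toZMod]
      simp only [AddMonoidHom.mem_ker, RingHom.mem_ker]
      exact funext_iff
    rw [SetLike.mem_coe, this]
    simp only [Ideal.mem_span_singleton', Set.mem_range]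
    constructor
    · intro h
      choose y hy using h
      exact ⟨y, funext fun j => by simp [← hy, mul_comm]⟩
    · rintro ⟨y, rfl⟩ j
      exact ⟨y j, by simp [mul_comm]⟩
  have hker : g '' (f.ker : Set (Fin d → ℤ_[p])) = u • Set.range g := by
    rw [hfk, ← Set.range_comp, ← Set.image_smul, ← Set.range_comp]
    congr 1
    ext x
    exact (hgp x).symm
  have hpp : 0 < p := (Fact.out : p.Prime).pos
  have : f.ker.FiniteIndex := ⟨by rw [hind]; positivity⟩
  have hm : MeasurableSet (f.ker : Set (Fin d → ℤ_[p])) := by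
    rw [hfk]
    refine (isCompact_range ?_).isClosed.measurableSet
    exact continuous_const_smul _
  have h1 := f.ker.index_mul_measure hm ν
  rw [hg.measurableEmbedding.comap_apply, hg.measurableEmbedding.comap_apply, hker, Set.image_univ,
    ← distribHaarChar_mul, hind] at h1
  have h2 : μ (Set.range g) ≠ 0 := (hg.isOpen_range.measure_pos _ ⟨_, ⟨0, rfl⟩⟩).ne'
  have h3 : μ (Set.range g) ≠ ⊤ := (isCompact_range hg.continuous).measure_lt_top.ne
  rw [← mul_assoc] at h1
  have h4 : ((p ^ d : ℕ) : ℝ≥0∞) * (distribHaarChar F u : ℝ≥0∞) = 1 :=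
    (ENNReal.mul_left_inj h2 h3).1 (by rw [h1, one_mul])
  have h5 : ((p : ℝ) ^ d) * (distribHaarChar F u : ℝ) = 1 := by
    have := congrArg ENNReal.toReal h4
    simpa using this
  have h6 : ‖(u : F)‖ = ((p : ℝ) ^ d)⁻¹ := by
    have := hF p
    rw [map_natCast] at this
    rw [hu, this, Padic.norm_p, inv_pow]
  rw [h6]
  exact eq_inv_of_mul_eq_one_right h5

end PadicField

/-! ### The norm of `F` is its Haar modulus -/

section Normalized

theorem exists_norm_eq_zpow {F : Type*} [NontriviallyNormedField F] [IsUltrametricDist F]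
    [ProperSpace F] {ϖ : OF F} (hϖ : Irreducible ϖ) (u : Fˣ) :
    ∃ k : ℤ, ‖(u : F)‖ = ‖(ϖ : F)‖ ^ k := by
  have key : ∀ a : F, a ≠ 0 → ‖a‖ ≤ 1 → ∃ k : ℕ, ‖a‖ = ‖(ϖ : F)‖ ^ k := by
    intro a ha h
    obtain ⟨k, v, hv⟩ := IsDiscreteValuationRing.associated_pow_irreducible
      (x := (⟨a, h⟩ : OF F)) (by simpa [Subtype.ext_iff] using ha) hϖ
    refine ⟨k, ?_⟩
    have h1 := isUnit_OF_iff.1 v.isUnit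
    have := congrArg (fun x : OF F => ‖(x : F)‖) hv
    simpa [h1] using this
  rcases le_total ‖(u : F)‖ 1 with h | h
  · obtain ⟨k, hk⟩ := key u u.ne_zero h
    exact ⟨k, by simpa using hk⟩
  · obtain ⟨k, hk⟩ := key (u⁻¹ : Fˣ) (Units.ne_zero _) (by simpa using inv_le_one_of_one_le₀ h)
    refine ⟨-k, ?_⟩
    rw [zpow_neg, zpow_natCast, ← hk]; simp

/-- The norm of `F` is the normalized one: it is the modulus of the locally compact
group `(F, +)`. -/
class IsNormalized (F : Type*) [NontriviallyNormedField F] [ProperSpace F] : Prop where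
  distribHaarChar_eq : ∀ u : Fˣ, (distribHaarChar F u : ℝ) = ‖(u : F)‖

theorem distribHaarChar_eq_one_of_norm_eq_one {F : Type*} [NontriviallyNormedField F]
    [ProperSpace F] (u : Fˣ) (hu : ‖(u : F)‖ = 1) :
    distribHaarChar F u = 1 := by
  let : MeasurableSpace F := borel F
  have : BorelSpace F := ⟨rfl⟩
  let μ : Measure F := Measure.addHaar
  have hs : u • Metric.closedBall (0 : F) 1 = Metric.closedBall 0 1 := by
    ext x
    rw [Set.mem_smul_set_iff_inv_smul_mem, mem_closedBall_zero_iff, mem_closedBall_zero_iff,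
      Units.smul_def, smul_eq_mul, norm_mul, Units.val_inv_eq_inv_val, norm_inv, hu, inv_one, one_mul]
  refine distribHaarChar_eq_of_measure_smul_eq_mul (μ := μ) (s := Metric.closedBall (0 : F) 1)
    (Metric.measure_closedBall_pos _ _ one_pos).ne'
    (isCompact_closedBall _ _).measure_lt_top.ne ?_
  rw [hs, ENNReal.coe_one, one_mul]

/-- Norm and modulus are both multiplicative and trivial on elements of norm `1`, hence determined
by their values at a uniformizer. They agree at `p`, whose norm is a nonzero power of that of the
uniformizer, and a nonnegative real number is determined by such a power. -/
theorem isNormalized_of_norm_algebraMap (p : ℕ) [Fact p.Prime] {F : Type*}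
    [NontriviallyNormedField F] [IsUltrametricDist F] [ProperSpace F]
    [Algebra ℚ_[p] F] [FiniteDimensional ℚ_[p] F]
    (hF : ∀ a : ℚ_[p], ‖algebraMap ℚ_[p] F a‖ = ‖a‖ ^ Module.finrank ℚ_[p] F) :
    IsNormalized F := by
  obtain ⟨ϖ, hϖ⟩ := IsDiscreteValuationRing.exists_irreducible (OF F)
  have hϖ0 : (ϖ : F) ≠ 0 := fun h => hϖ.ne_zero (Subtype.ext h)
  have key : ∀ (u : Fˣ) (k : ℤ), ‖(u : F)‖ = ‖(ϖ : F)‖ ^ k →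
      distribHaarChar F u = distribHaarChar F (Units.mk0 _ hϖ0) ^ k := by
    intro u k hk
    have : distribHaarChar F (u * (Units.mk0 (ϖ : F) hϖ0 ^ k)⁻¹) = 1 := by
      refine distribHaarChar_eq_one_of_norm_eq_one _ ?_
      rw [Units.val_mul, Units.val_inv_eq_inv_val, Units.val_zpow_eq_zpow_val, Units.val_mk0,
        norm_mul, norm_inv, norm_zpow, ← hk]
      exact mul_inv_cancel₀ (norm_ne_zero_iff.2 u.ne_zero)
    rw [map_mul, map_inv, map_zpow] at this
    have hne : distribHaarChar F (Units.mk0 (ϖ : F) hϖ0) ^ k ≠ 0 :=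
      zpow_ne_zero _ (distribHaarChar_pos).ne'
    field_simp at this
    exact this
  have hp : (p : F) ≠ 0 := by
    have := (algebraMap ℚ_[p] F).injective.ne
      (Nat.cast_ne_zero.2 (Fact.out : p.Prime).ne_zero : (p : ℚ_[p]) ≠ 0)
    simpa using this
  obtain ⟨e, he⟩ := exists_norm_eq_zpow hϖ (Units.mk0 (p : F) hp)
  have h1 := distribHaarChar_natCast p hF (Units.mk0 (p : F) hp) rfl
  have hlt : ‖(p : F)‖ < 1 := by
    have := hF p
    rw [map_natCast] at this
    rw [this]
    exact pow_lt_one₀ (norm_nonneg _) Padic.norm_p_lt_one Module.finrank_pos.ne'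
  have he0 : e ≠ 0 := by
    rintro rfl
    rw [zpow_zero, Units.val_mk0] at he
    exact hlt.ne he
  have hϖn : (distribHaarChar F (Units.mk0 _ hϖ0) : ℝ) = ‖(ϖ : F)‖ := by
    rw [key _ e he, he, NNReal.coe_zpow] at h1
    exact (zpow_left_inj₀ (NNReal.coe_nonneg _) (norm_nonneg _) he0).1 h1
  refine ⟨fun u => ?_⟩
  obtain ⟨k, hk⟩ := exists_norm_eq_zpow hϖ u
  rw [key u k hk, NNReal.coe_zpow, hϖn, hk]

end Normalized

end

section

open scoped Pointwise

/-! ### Haar measure on `F ^ ι` and linear change of variables -/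

section HaarF

variable {F : Type*} [NontriviallyNormedField F] [IsUltrametricDist F] [ProperSpace F]
  [MeasurableSpace F] [BorelSpace F]

theorem haarF_spec : (haarF F).IsAddHaarMeasure ∧ haarF F (OF F) = 1 :=
  normalizedHaar_spec isCompact_OF ⟨0, by
    rw [isOpen_OF.interior_eq]; exact (OF F).zero_mem⟩

instance : (haarF F).IsAddHaarMeasure := haarF_spec.1

theorem haarF_OF : haarF F (OF F) = 1 := haarF_spec.2

theorem haarF_units_smul [IsNormalized F] (u : Fˣ) (s : Set F) :
    haarF F (u • s) = ENNReal.ofReal ‖(u : F)‖ * haarF F s := by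
  rw [← distribHaarChar_mul, ← IsNormalized.distribHaarChar_eq, ENNReal.ofReal_coe_nnreal]

theorem haarF_preimage_mul_left [IsNormalized F] {a : F} (ha : a ≠ 0) (s : Set F) :
    haarF F ((a * ·) ⁻¹' s) = ENNReal.ofReal ‖a‖⁻¹ * haarF F s := by
  have h : (a * ·) ⁻¹' s = (Units.mk0 a ha)⁻¹ • s := by
    ext x
    rw [Set.mem_smul_set_iff_inv_smul_mem, inv_inv]
    rfl
  rw [h, haarF_units_smul, Units.val_inv_eq_inv_val, norm_inv, Units.val_mk0]

/-- The product Haar measure on `F ^ ι`, giving mass `1` to `𝒪_F ^ ι`. -/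
noncomputable abbrev piHaar (F : Type*) [NontriviallyNormedField F] [IsUltrametricDist F]
    [MeasurableSpace F] (ι : Type*) [Fintype ι] : Measure (ι → F) :=
  Measure.pi fun _ => haarF F

/-- The cube `𝒪_F ^ ι`. -/
def cube (F : Type*) [NontriviallyNormedField F] [IsUltrametricDist F] (ι : Type*) :
    Set (ι → F) :=
  Set.univ.pi fun _ => (OF F : Set F)

variable {ι : Type*} [Fintype ι]

omit [ProperSpace F] [MeasurableSpace F] [BorelSpace F] [Fintype ι] in
theorem mem_cube {x : ι → F} : x ∈ cube F ι ↔ ∀ i, x i ∈ OF F := by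
  simp [cube]

omit [ProperSpace F] [MeasurableSpace F] [BorelSpace F] in
theorem isOpen_cube : IsOpen (cube F ι) :=
  isOpen_set_pi Set.finite_univ fun _ _ => isOpen_OF

omit [MeasurableSpace F] [BorelSpace F] [Fintype ι] in
theorem isCompact_cube : IsCompact (cube F ι) := isCompact_univ_pi fun _ => isCompact_OF

theorem piHaar_cube : piHaar F ι (cube F ι) = 1 := by
  rw [cube, Measure.pi_pi]; simp [haarF_OF]

variable [IsNormalized F]

open Matrix in
theorem smul_map_diagonal_piHaar [DecidableEq ι] {D : ι → F} (h : det (diagonal D) ≠ 0) :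
    ENNReal.ofReal ‖det (diagonal D)‖ • Measure.map (toLin' (diagonal D)) (piHaar F ι) =
      piHaar F ι := by
  refine (Measure.pi_eq fun s hs => ?_).symm
  simp only [det_diagonal, Measure.coe_smul, smul_eq_mul, Pi.smul_apply]
  rw [Measure.map_apply _ (MeasurableSet.univ_pi hs)]
  swap; · exact Continuous.measurable (LinearMap.continuous_on_pi _)
  have :
    (Matrix.toLin' (diagonal D) ⁻¹' Set.pi Set.univ fun i : ι => s i) =
      Set.pi Set.univ fun i : ι => (D i * ·) ⁻¹' s i := by
    ext f
    simp only [LinearMap.coe_proj, smul_eq_mul, LinearMap.smul_apply, Set.mem_univ_pi,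
      Set.mem_preimage, LinearMap.pi_apply, diagonal_toLin']
  have B : ∀ i, ENNReal.ofReal ‖D i‖ * haarF F ((D i * ·) ⁻¹' s i) = haarF F (s i) := by
    intro i
    have A : D i ≠ 0 := by
      simp only [det_diagonal, Ne] at h
      exact Finset.prod_ne_zero_iff.1 h i (Finset.mem_univ i)
    rw [haarF_preimage_mul_left A, ← mul_assoc, ← ENNReal.ofReal_mul (norm_nonneg _),
      mul_inv_cancel₀ (norm_ne_zero_iff.2 A), ENNReal.ofReal_one, one_mul]
  rw [this, Measure.pi_pi, norm_prod,
    ENNReal.ofReal_prod_of_nonneg fun i _ => norm_nonneg (D i), ← Finset.prod_mul_distrib]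
  simp only [B]

omit [IsNormalized F] in
open Matrix in
theorem measurePreserving_transvectionStruct [DecidableEq ι] (t : TransvectionStruct ι F) :
    MeasurePreserving (toLin' t.toMatrix) (piHaar F ι) (piHaar F ι) := by
  have ht : Measurable (toLin' t.toMatrix) :=
    (LinearMap.continuous_on_pi _).measurable
  refine ⟨ht, ?_⟩
  refine (Measure.pi_eq fun s hs ↦ ?_).symm
  have h2s : MeasurableSet (Set.univ.pi s) := .pi Set.countable_univ fun i _ ↦ hs i
  simp_rw [← Measure.pi_pi, ← lintegral_indicator_one h2s]
  rw [lintegral_map (measurable_one.indicator h2s) ht]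
  refine lintegral_eq_of_lmarginal_eq {t.i} ((measurable_one.indicator h2s).comp ht)
    (measurable_one.indicator h2s) ?_
  simp_rw [lmarginal_singleton]
  ext x
  cases t with | mk t_i t_j t_hij t_c =>
  simp [transvection, single_mulVec, t_hij.symm, ← Function.update_add,
    lintegral_add_right_eq_self fun xᵢ ↦ Set.indicator (Set.univ.pi s) 1 (Function.update x t_i xᵢ)]

open Matrix in
-- As for Lebesgue measure: an invertible matrix is a product of diagonal matrices, which scale each
-- coordinate by a Haar modulus, and of transvections, which preserve volume by Fubini and
-- translation invariance.
theorem map_matrix_piHaar [DecidableEq ι] {M : Matrix ι ι F} (hM : det M ≠ 0) :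
    Measure.map (toLin' M) (piHaar F ι) = ENNReal.ofReal ‖(det M)⁻¹‖ • piHaar F ι := by
  apply diagonal_transvection_induction_of_det_ne_zero _ M hM
  · intro D hD
    conv_rhs => rw [← smul_map_diagonal_piHaar hD]
    rw [smul_smul, ← ENNReal.ofReal_mul (norm_nonneg _), ← norm_mul, inv_mul_cancel₀ hD, norm_one,
      ENNReal.ofReal_one, one_smul]
  · intro t
    simp_rw [Matrix.TransvectionStruct.det, _root_.inv_one, norm_one, ENNReal.ofReal_one, one_smul,
      (measurePreserving_transvectionStruct _).map_eq]
  · intro A B _ _ IHA IHB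
    rw [toLin'_mul, det_mul, LinearMap.coe_comp, ← Measure.map_map, IHB, Measure.map_smul, IHA,
      smul_smul, ← ENNReal.ofReal_mul (norm_nonneg _), ← norm_mul, mul_comm, mul_inv]
    · exact (LinearMap.continuous_on_pi _).measurable
    · exact (LinearMap.continuous_on_pi _).measurable

theorem map_linearMap_piHaar {f : (ι → F) →ₗ[F] ι → F} (hf : LinearMap.det f ≠ 0) :
    Measure.map f (piHaar F ι) = ENNReal.ofReal ‖(LinearMap.det f)⁻¹‖ • piHaar F ι := by
  classical
  have h := map_matrix_piHaar (M := LinearMap.toMatrix' f) (by rwa [LinearMap.det_toMatrix'])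
  rwa [Matrix.toLin'_toMatrix', LinearMap.det_toMatrix'] at h

theorem piHaar_image_linearMap_of_det_ne_zero {f : (ι → F) →ₗ[F] ι → F}
    (hf : LinearMap.det f ≠ 0) (s : Set (ι → F)) :
    piHaar F ι (f '' s) = ENNReal.ofReal ‖LinearMap.det f‖ * piHaar F ι s := by
  classical
  let e := LinearEquiv.ofIsUnitDet (f := f) (v := Pi.basisFun F ι) (v' := Pi.basisFun F ι)
    (by rw [LinearMap.det_toMatrix]; exact isUnit_iff_ne_zero.2 hf)
  have he : ∀ x, e x = f x := fun x => rfl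
  have hc : Continuous e := (LinearMap.continuous_on_pi (e : (ι → F) →ₗ[F] (ι → F)))
  have hc' : Continuous e.symm := (LinearMap.continuous_on_pi (e.symm : (ι → F) →ₗ[F] (ι → F)))
  let E : (ι → F) ≃ₜ (ι → F) := ⟨e.toEquiv, hc, hc'⟩
  have hE : ⇑E.toMeasurableEquiv = f := rfl
  have h := congrArg (fun μ => μ (f '' s)) (map_linearMap_piHaar hf)
  simp only [Measure.smul_apply, smul_eq_mul] at h
  rw [← hE, MeasurableEquiv.map_apply, Set.preimage_image_eq _ E.toMeasurableEquiv.injective] at h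
  rw [hE] at h
  rw [h, ← mul_assoc, ← ENNReal.ofReal_mul (norm_nonneg _), ← norm_mul, mul_inv_cancel₀ hf,
    norm_one, ENNReal.ofReal_one, one_mul]

/-- Steinhaus: if `W` had positive measure, `W - W = W` would be a neighbourhood of `0`, hence would
contain a nonzero multiple of every vector. -/
theorem addHaar_submodule_eq_zero {F : Type*} [NontriviallyNormedField F] [CompleteSpace F]
    {V : Type*} [AddCommGroup V] [Module F V] [FiniteDimensional F V] [TopologicalSpace V]
    [SecondCountableTopology V]
    [IsTopologicalAddGroup V] [ContinuousSMul F V] [T2Space V] [LocallyCompactSpace V]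
    [MeasurableSpace V] [BorelSpace V] (μ : Measure V) [μ.IsAddHaarMeasure]
    {W : Submodule F V} (hW : W ≠ ⊤) : μ W = 0 := by
  have hμ := Measure.isAddLeftInvariant_eq_smul μ (Measure.addHaar (G := V))
  suffices h : Measure.addHaar (W : Set V) = 0 by rw [hμ]; simp [h]
  by_contra h
  have hc : IsClosed (W : Set V) := W.closed_of_finiteDimensional
  have h1 := Measure.sub_mem_nhds_zero_of_addHaar_pos Measure.addHaar (W : Set V) hc.measurableSet
    (pos_iff_ne_zero.2 h)
  refine hW (eq_top_iff.2 fun x _ => ?_)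
  have h2 : Filter.Tendsto (fun c : F => c • x) (nhds 0) (nhds 0) := by
    have : Continuous fun c : F => c • x := by fun_prop
    simpa using this.tendsto 0
  have h3 : ∀ᶠ c : F in nhdsWithin 0 {0}ᶜ, c • x ∈ (W : Set V) - (W : Set V) :=
    (h2.eventually h1).filter_mono nhdsWithin_le_nhds
  obtain ⟨c, hc, hc0⟩ := (h3.and self_mem_nhdsWithin).exists
  obtain ⟨y, hy, z, hz, hyz⟩ := Set.mem_sub.1 hc
  have : c • x ∈ W := hyz ▸ W.sub_mem hy hz
  exact (W.smul_mem_iff hc0).1 this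

end HaarF

/-! ### The measure on coefficient vectors -/

section CoeffMeasure

variable {F : Type*} [NontriviallyNormedField F] [IsUltrametricDist F] [ProperSpace F]
  [MeasurableSpace F] [BorelSpace F]

instance : ((haarF F).comap (Subtype.val : OF F → F)).IsAddHaarMeasure :=
  Measure.IsAddHaarMeasure.comap (mH := inferInstance) (haarF F) (f := (OF F).subtype.toAddMonoidHom)
    isOpenEmbedding_coe_OF

instance : IsProbabilityMeasure ((haarF F).comap (Subtype.val : OF F → F)) :=
  ⟨by rw [isOpenEmbedding_coe_OF.measurableEmbedding.comap_apply, Set.image_univ,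
      Subtype.range_coe_subtype]; exact haarF_OF⟩

instance (m : ℕ) : IsProbabilityMeasure (coeffMeasure F m) := by
  unfold coeffMeasure; infer_instance

instance (m : ℕ) : (coeffMeasure F m).IsAddHaarMeasure := by
  unfold coeffMeasure; infer_instance

/-- Moves integrals over random polynomials to the cube inside `F ^ m`, where linear maps over `F`
can be used as changes of variables. -/
theorem map_coe_coeffMeasure (m : ℕ) :
    Measure.map (fun (a : Fin m → OF F) i => (a i : F)) (coeffMeasure F m) =
      (piHaar F (Fin m)).restrict (cube F (Fin m)) := by
  rw [coeffMeasure, cube, Measure.restrict_pi_pi]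
  refine (Measure.pi_map_pi (f := fun _ : Fin m => (Subtype.val : OF F → F))
    fun _ => measurable_subtype_coe.aemeasurable).trans ?_
  congr 1
  ext1 i
  exact map_comap_subtype_coe isOpen_OF.measurableSet _

omit [ProperSpace F] [MeasurableSpace F] [BorelSpace F] in
theorem isOpenEmbedding_coe_pi (m : ℕ) :
    Topology.IsOpenEmbedding (fun (a : Fin m → OF F) i => (a i : F)) := by
  refine ⟨Topology.IsEmbedding.piMap (fun _ => isOpenEmbedding_coe_OF.isEmbedding), ?_⟩
  have : Set.range (fun (a : Fin m → OF F) i => (a i : F)) =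
      Set.univ.pi fun _ => Set.range ((↑) : OF F → F) := by
    rw [← Set.range_piMap]; rfl
  rw [this]
  exact isOpen_set_pi Set.finite_univ fun _ _ => isOpenEmbedding_coe_OF.isOpen_range

end CoeffMeasure

end

section

open scoped Pointwise

/-! ### Gauss's lemma -/

section GaussNorm

/-- The Gauss norm of an absolute value, as a monoid homomorphism. -/
noncomputable def gaussHom {R : Type*} [Ring R] [Nontrivial R] (v : AbsoluteValue R ℝ)
    (hv : IsNonarchimedean v) : R[X] →* ℝ where
  toFun P := P.gaussNorm v 1
  map_one' := by
    rw [← C_1, gaussNorm_C]; simp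
  map_mul' := gaussNorm_mul hv one_pos

theorem gaussNorm_X_sub_C {R : Type*} [Ring R] [Nontrivial R] (v : AbsoluteValue R ℝ) (a : R) :
    (X - C a).gaussNorm v 1 = max 1 (v a) := by
  have hl := fun i => (X - C a).le_gaussNorm v zero_le_one i
  apply le_antisymm
  · obtain ⟨i, hi⟩ := (X - C a).exists_eq_gaussNorm v 1
    rw [hi, one_pow, mul_one]
    rcases i with _ | _ | i
    · simp
    · simp
    · have : (X - C a).coeff (i + 2) = 0 := by
        rw [coeff_sub, coeff_X, coeff_C]; simp
      rw [this, map_zero]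
      exact le_max_of_le_left zero_le_one
  · refine max_le ?_ ?_
    · simpa using hl 1
    · simpa using hl 0

/-- Allows the largest coefficient to be computed in an extension where the polynomial splits. -/
theorem supNorm_eq_gaussNorm_map {F Ω : Type*} [NormedField F] [Field Ω] [Algebra F Ω]
    (v : AbsoluteValue Ω ℝ) (hv : ∀ a : F, v (algebraMap F Ω a) = ‖a‖) (P : F[X]) :
    P.supNorm = (P.map (algebraMap F Ω)).gaussNorm v 1 := by
  apply le_antisymm
  · obtain ⟨i, hi⟩ := P.exists_eq_supNorm
    have := (P.map (algebraMap F Ω)).le_gaussNorm v zero_le_one i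
    rw [coeff_map, hv, one_pow, mul_one] at this
    rwa [hi]
  · obtain ⟨i, hi⟩ := (P.map (algebraMap F Ω)).exists_eq_gaussNorm v 1
    rw [hi, coeff_map, hv, one_pow, mul_one]
    exact P.le_supNorm i

theorem supNorm_mul {F : Type*} [NormedField F] [IsUltrametricDist F] (P Q : F[X]) :
    (P * Q).supNorm = P.supNorm * Q.supNorm := by
  have h := supNorm_eq_gaussNorm_map (F := F) (Ω := F) (NormedField.toAbsoluteValue F) (fun _ => rfl)
  simp only [Algebra.algebraMap_self, Polynomial.map_id] at h
  rw [h, h, h]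
  exact gaussNorm_mul (v := NormedField.toAbsoluteValue F) (IsUltrametricDist.isNonarchimedean_norm)
    one_pos P Q

theorem supNorm_prod {F : Type*} [NormedField F] [IsUltrametricDist F] {ι : Type*}
    (s : Finset ι) (P : ι → F[X]) : (∏ i ∈ s, P i).supNorm = ∏ i ∈ s, (P i).supNorm := by
  classical
  induction s using Finset.induction_on with
  | empty => simpa using supNorm_C (A := F) (a := 1)
  | insert i s hi ih => rw [Finset.prod_insert hi, Finset.prod_insert hi, supNorm_mul, ih]

theorem supNorm_le_iff {A : Type*} [SeminormedRing A] {P : A[X]} {c : ℝ} :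
    P.supNorm ≤ c ↔ ∀ i, ‖P.coeff i‖ ≤ c := by
  refine ⟨fun h i => (P.le_supNorm i).trans h, fun h => ?_⟩
  obtain ⟨i, hi⟩ := P.exists_eq_supNorm
  exact hi ▸ h i

end GaussNorm

/-! ### Characteristic polynomials -/

section CharPoly

/-- The characteristic polynomial of multiplication by `x` on a finite `F`-algebra. -/
noncomputable def charPoly (F : Type*) [Field F] {E : Type*} [CommRing E] [Algebra F E]
    [Module.Finite F E] (x : E) : F[X] :=
  (Algebra.lmul F E x).charpoly

variable {F : Type*} [Field F] {E : Type*} [CommRing E] [Algebra F E] [Module.Finite F E]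

theorem charPoly_monic (x : E) : (charPoly F x).Monic := LinearMap.charpoly_monic _

theorem natDegree_charPoly (x : E) : (charPoly F x).natDegree = Module.finrank F E :=
  LinearMap.charpoly_natDegree _

theorem aeval_charPoly (x : E) : aeval x (charPoly F x) = 0 := by
  have h := (Algebra.lmul F E x).aeval_self_charpoly
  have h2 := congrArg (fun f : E →ₗ[F] E => f 1) h
  rw [aeval_algHom_apply] at h2
  simpa [charPoly] using h2

theorem eval_charPoly (x : E) (t : F) :
    (charPoly F x).eval t = Algebra.norm F (algebraMap F E t - x) := by
  rw [Algebra.norm_apply, charPoly, LinearMap.eval_charpoly, map_sub (Algebra.lmul F E)]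
  congr 2
  ext y
  simp [Algebra.smul_def]

/-- The values of a characteristic polynomial are norms, so over an infinite field product formulas
for norms become product formulas for characteristic polynomials. -/
theorem charPoly_eq_of_eval [Infinite F] {x : E} {P : F[X]}
    (h : ∀ t, P.eval t = Algebra.norm F (algebraMap F E t - x)) : charPoly F x = P :=
  Polynomial.funext fun t => by rw [eval_charPoly, h]

end CharPoly

/-! ### Norms and characteristic polynomials in a field extension -/

section SpectralNorm

variable {F : Type*} [NontriviallyNormedField F] [IsUltrametricDist F] [CompleteSpace F]
  [CharZero F] {K : Type*} [Field K] [Algebra F K] [FiniteDimensional F K]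

/-- The norm is the product of the conjugates over the `[K : F]` embeddings. Conjugates share a
minimal polynomial, hence a spectral norm. -/
theorem norm_algebraNorm_eq_spectralNorm_pow (y : K) :
    ‖Algebra.norm F y‖ = spectralNorm F K y ^ Module.finrank F K := by
  rw [← spectralNorm_extends (L := AlgebraicClosure F),
    Algebra.norm_eq_prod_embeddings F (AlgebraicClosure F) y, ← spectralMulAlgNorm_def, map_prod]
  simp only [spectralMulAlgNorm_def]
  have : ∀ σ : K →ₐ[F] AlgebraicClosure F, spectralNorm F (AlgebraicClosure F) (σ y) =
      spectralNorm F K y := fun σ => by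
    rw [spectralNorm, spectralNorm, minpoly.algHom_eq σ σ.injective]
  simp only [this, Finset.prod_const, Finset.card_univ, AlgHom.card]

/-- Over the algebraic closure the characteristic polynomial is `∏ (X - σ y)`, and the Gauss norm is
multiplicative with value `max 1 |a|` at `X - a`. -/
theorem supNorm_charPoly_field (y : K) :
    (charPoly F y).supNorm = max 1 (spectralNorm F K y ^ Module.finrank F K) := by
  let v : AbsoluteValue (AlgebraicClosure F) ℝ :=
    { toFun := spectralNorm F (AlgebraicClosure F)
      map_mul' := (spectralMulAlgNorm (K := F) (L := AlgebraicClosure F)).map_mul'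
      nonneg' := spectralNorm_nonneg
      eq_zero' := fun x => map_eq_zero_iff_eq_zero
        (spectralMulAlgNorm (K := F) (L := AlgebraicClosure F))
      add_le' := fun x y => map_add_le_add (spectralMulAlgNorm (K := F) (L := AlgebraicClosure F)) x y }
  have hv : IsNonarchimedean v := isNonarchimedean_spectralNorm
  have hmap : (charPoly F y).map (algebraMap F (AlgebraicClosure F)) =
      ∏ σ : K →ₐ[F] AlgebraicClosure F, (X - C (σ y)) := by
    -- Both sides take the value `N(t - y)` at each of the infinitely many `t` in `F`.
    refine Polynomial.eq_of_infinite_eval_eq _ _ ?_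
    refine (Set.infinite_range_of_injective (algebraMap F (AlgebraicClosure F)).injective).mono ?_
    rintro _ ⟨t, rfl⟩
    rw [Set.mem_ofPred_eq, eval_map_algebraMap, aeval_algebraMap_apply_eq_algebraMap_eval, eval_charPoly,
      Algebra.norm_eq_prod_embeddings F (AlgebraicClosure F), eval_prod]
    simp
  rw [supNorm_eq_gaussNorm_map v spectralNorm_extends, hmap]
  change gaussHom v hv _ = _
  rw [map_prod]
  have : ∀ σ : K →ₐ[F] AlgebraicClosure F, gaussHom v hv (X - C (σ y)) =
      max 1 (spectralNorm F K y) := fun σ => by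
    refine (gaussNorm_X_sub_C v _).trans ?_
    change max 1 (spectralNorm F (AlgebraicClosure F) (σ y)) = _
    rw [spectralNorm, spectralNorm, minpoly.algHom_eq σ σ.injective]
  simp only [this, Finset.prod_const, Finset.card_univ, AlgHom.card]
  rcases le_total (spectralNorm F K y) 1 with h | h
  · rw [max_eq_left h, max_eq_left (pow_le_one₀ (spectralNorm_nonneg _) h), one_pow]
  · rw [max_eq_right h, max_eq_right (one_le_pow₀ h)]

end SpectralNorm

/-! ### Norm, trace and discriminant of a product of algebras -/

section Pi

variable {F : Type*} [Field F] {I : Type*} [Fintype I] {A : I → Type*} [∀ i, CommRing (A i)]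
  [∀ i, Algebra F (A i)] {J : I → Type*} [∀ i, Fintype (J i)]

theorem leftMulMatrix_piBasis [DecidableEq I] [∀ i, DecidableEq (J i)]
    (b : ∀ i, Module.Basis (J i) F (A i)) (x : ∀ i, A i) :
    Algebra.leftMulMatrix (Pi.basis b) x =
      Matrix.blockDiagonal' fun i => Algebra.leftMulMatrix (b i) (x i) := by
  ext ⟨i, j⟩ ⟨i', j'⟩
  rw [Algebra.leftMulMatrix_eq_repr_mul, Pi.basis_repr, Pi.basis_apply]
  by_cases h : i = i'
  · subst h
    rw [Matrix.blockDiagonal'_apply_eq, Algebra.leftMulMatrix_eq_repr_mul]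
    simp
  · rw [Matrix.blockDiagonal'_apply_ne _ _ _ h]
    simp [h]

theorem _root_.Matrix.det_blockDiagonal'_eq_prod [DecidableEq I] [∀ i, DecidableEq (J i)]
    (M : ∀ i, Matrix (J i) (J i) F) : (Matrix.blockDiagonal' M).det = ∏ i, (M i).det := by
  let : LinearOrder I := LinearOrder.lift' (Fintype.equivFin I) (Fintype.equivFin I).injective
  rw [(Matrix.blockTriangular_blockDiagonal' M).det_fintype]
  refine Finset.prod_congr rfl fun i _ => ?_
  rw [← Matrix.det_submatrix_equiv_self (Equiv.sigmaSubtype i).symm]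
  congr 1
  ext j j'
  exact Matrix.blockDiagonal'_apply_eq _ _ _ _

theorem norm_pi_eq_prod [∀ i, Module.Finite F (A i)] (x : ∀ i, A i) :
    Algebra.norm F x = ∏ i, Algebra.norm F (x i) := by
  classical
  have b : ∀ i, Module.Basis (Fin (Module.finrank F (A i))) F (A i) := fun i => Module.finBasis F (A i)
  rw [Algebra.norm_eq_matrix_det (Pi.basis b), leftMulMatrix_piBasis, Matrix.det_blockDiagonal'_eq_prod]
  simp_rw [Algebra.norm_eq_matrix_det (b _)]

theorem trace_pi_eq_sum [∀ i, Module.Finite F (A i)] (x : ∀ i, A i) :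
    Algebra.trace F _ x = ∑ i, Algebra.trace F _ (x i) := by
  classical
  have b : ∀ i, Module.Basis (Fin (Module.finrank F (A i))) F (A i) := fun i => Module.finBasis F (A i)
  rw [Algebra.trace_eq_matrix_trace (Pi.basis b), leftMulMatrix_piBasis, Matrix.trace_blockDiagonal']
  simp_rw [Algebra.trace_eq_matrix_trace (b _)]

theorem discr_piBasis [DecidableEq I] [∀ i, DecidableEq (J i)] [∀ i, Module.Finite F (A i)] (b : ∀ i, Module.Basis (J i) F (A i)) :
    Algebra.discr F (Pi.basis b) = ∏ i, Algebra.discr F (b i) := by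
  have h : Algebra.traceMatrix F (Pi.basis b) =
      Matrix.blockDiagonal' fun i => Algebra.traceMatrix F (b i) := by
    ext ⟨i, j⟩ ⟨i', j'⟩
    rw [Algebra.traceMatrix_apply, Algebra.traceForm_apply, trace_pi_eq_sum, Pi.basis_apply, Pi.basis_apply]
    by_cases h : i = i'
    · subst h
      rw [Matrix.blockDiagonal'_apply_eq, Algebra.traceMatrix_apply, Algebra.traceForm_apply,
        Finset.sum_eq_single i]
      · simp
      · intro k _ hk
        simp [hk]
      · simp
    · rw [Matrix.blockDiagonal'_apply_ne _ _ _ h]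
      refine Finset.sum_eq_zero fun k _ => ?_
      by_cases hk : k = i
      · subst hk; simp [h]
      · simp [hk]
  rw [Algebra.discr_def, h, Matrix.det_blockDiagonal'_eq_prod]
  rfl
end Pi

section Reduced
variable (F : Type*) [NontriviallyNormedField F] [IsUltrametricDist F] {E : Type*} [CommRing E] [Algebra F E] [Module.Finite F E] [IsReduced E]

/-- A reduced finite algebra is the product of its factors. -/
noncomputable def factorEquiv : E ≃ₐ[F] ∀ 𝔪 : MaximalSpectrum E, Factor 𝔪 :=
  have := IsArtinianRing.of_finite F E
  (IsArtinianRing.equivPi E).restrictScalars F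

omit [IsUltrametricDist F] in
theorem factorEquiv_apply (x : E) (𝔪 : MaximalSpectrum E) :
    factorEquiv F x 𝔪 = toFactor F 𝔪 x := rfl

omit [IsUltrametricDist F] in
theorem norm_eq_prod_norm_toFactor [Fintype (MaximalSpectrum E)] (x : E) :
    Algebra.norm F x = ∏ 𝔪 : MaximalSpectrum E, Algebra.norm F (toFactor F 𝔪 x) := by
  rw [← Algebra.norm_eq_of_algEquiv (factorEquiv F), norm_pi_eq_prod]; rfl

end Reduced

end

/-! ### Integral bases and the discriminant -/

section IntegralBasis

variable {F : Type*} [NontriviallyNormedField F] [IsUltrametricDist F] [ProperSpace F]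
  [CharZero F]

section Field
variable {K : Type*} [Field K] [Algebra F K] [FiniteDimensional F K]

theorem mem_fieldIntegers {F K : Type*} [NontriviallyNormedField F] [IsUltrametricDist F]
    [Field K] [Algebra F K] [Algebra.IsAlgebraic F K] {y : K} : y ∈ fieldIntegers F K ↔ spectralNorm F K y ≤ 1 := Iff.rfl

/-- The spectral norm is at most `1` exactly when the minimal polynomial has coefficients in `𝒪_F`,
and `𝒪_F` is integrally closed. Identifying `𝒪_K` with the integral closure of `𝒪_F` makes it finite
free. -/
theorem mem_fieldIntegers_iff_isIntegral {y : K} :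
    y ∈ fieldIntegers F K ↔ IsIntegral (OF F) y := by
  rw [mem_fieldIntegers, spectralNorm,
    spectralValue_le_one_iff (minpoly.monic (Algebra.IsIntegral.isIntegral y))]
  constructor
  · intro h
    have hl : minpoly F y ∈ lifts (algebraMap (OF F) F) := by
      rw [lifts_iff_coeff_lifts]
      exact fun i => ⟨⟨_, h i⟩, rfl⟩
    obtain ⟨P, hP, -, hPm⟩ := lifts_and_degree_eq_and_monic hl
      (minpoly.monic (Algebra.IsIntegral.isIntegral y))
    refine ⟨P, hPm, ?_⟩
    have := minpoly.aeval F y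
    rw [← hP, aeval_map_algebraMap] at this
    exact this
  · intro h i
    rw [minpoly.isIntegrallyClosed_eq_field_fractions' F h, coeff_map]
    exact (coeff (minpoly (OF F) y) i).2

instance : IsIntegralClosure (fieldIntegers F K) (OF F) K where
  algebraMap_injective := Subtype.val_injective
  isIntegral_iff {y} := by
    rw [← mem_fieldIntegers_iff_isIntegral]
    exact ⟨fun h => ⟨⟨y, h⟩, rfl⟩, by rintro ⟨z, rfl⟩; exact z.2⟩

theorem nonempty_basis_fieldIntegers :
    Nonempty (Module.Basis (Fin (Module.finrank F K)) (OF F) (fieldIntegers F K)) := by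
  have : Module.Free (OF F) (fieldIntegers F K) :=
    IsIntegralClosure.module_free (OF F) F K (fieldIntegers F K)
  have : Module.Finite (OF F) (fieldIntegers F K) :=
    IsIntegralClosure.finite (OF F) F K (fieldIntegers F K)
  exact ⟨Module.finBasisOfFinrankEq _ _ (IsIntegralClosure.rank (OF F) F K (fieldIntegers F K))⟩

/-- The basis is the very one chosen in `fieldDiscr`, so the discriminants agree exactly and
independence of the basis is never needed. -/
theorem exists_basis_fieldIntegers (F K : Type*) [NontriviallyNormedField F] [IsUltrametricDist F] [ProperSpace F]
  [CharZero F] [Field K] [Algebra F K] [FiniteDimensional F K] :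
    ∃ b : Module.Basis (Fin (Module.finrank F K)) F K,
      (∀ y, y ∈ fieldIntegers F K ↔ ∀ i, b.repr y i ∈ OF F) ∧
      Algebra.discr F b = fieldDiscr F K := by
  have h := nonempty_basis_fieldIntegers (F := F) (K := K)
  let c := h.some
  have hli : LinearIndependent F fun i => (c i : K) := by
    rw [← LinearIndependent.iff_fractionRing (R := OF F)]
    exact c.linearIndependent.map' ((fieldIntegers F K).val.toLinearMap)
      (LinearMap.ker_eq_bot.2 Subtype.val_injective)
  let b := basisOfLinearIndependentOfCardEqFinrank' _ hli (by simp)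
  have hb : ∀ i, b i = c i := fun i => by simp [b]
  refine ⟨b, fun y => ⟨fun hy i => ?_, fun hy => ?_⟩, ?_⟩
  · have h1 : y = ∑ i, ((c.repr ⟨y, hy⟩ i : OF F) : F) • b i := by
      have := congrArg (fun z : fieldIntegers F K => (z : K)) (c.sum_repr ⟨y, hy⟩)
      simp only [AddSubmonoidClass.coe_finsetSum] at this
      refine this.symm.trans ?_
      refine Finset.sum_congr rfl fun i _ => ?_
      rw [hb]
      rfl
    rw [h1, b.repr_sum_self]
    exact (c.repr ⟨y, hy⟩ i).2
  · rw [← b.sum_repr y]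
    refine sum_mem fun i _ => ?_
    rw [hb]
    exact (fieldIntegers F K).smul_mem (c i).2 ⟨_, hy i⟩
  · rw [fieldDiscr, dif_pos h]
    congr 1
    ext i
    exact hb i
end Field

variable (F) (E : Type*) [CommRing E] [Algebra F E] [Module.Finite F E] [IsReduced E]

theorem exists_basis_etaleIntegers :
    ∃ b : Module.Basis (Fin (Module.finrank F E)) F E,
      (∀ x, x ∈ etaleIntegers F E ↔ ∀ i, b.repr x i ∈ OF F) ∧
      Algebra.discr F b = etaleDiscr F E := by
  classical
  have := finite_maximalSpectrum F E
  have := Fintype.ofFinite (MaximalSpectrum E)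
  choose b hb hd using fun 𝔪 : MaximalSpectrum E => exists_basis_fieldIntegers F (Factor 𝔪)
  let B := (Pi.basis b).map (factorEquiv F).symm.toLinearEquiv
  let e : (Σ 𝔪 : MaximalSpectrum E, Fin (Module.finrank F (Factor 𝔪))) ≃
      Fin (Module.finrank F E) := Fintype.equivFinOfCardEq (Module.finrank_eq_card_basis B).symm
  refine ⟨B.reindex e, fun x => ?_, ?_⟩
  · change etaleNorm F x ≤ 1 ↔ _
    rw [etaleNorm_le_one_iff]
    simp only [hb]
    rw [← e.forall_congr_right]
    simp only [Sigma.forall, Module.Basis.repr_reindex_apply, Equiv.symm_apply_apply]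
    rfl
  · rw [Module.Basis.coe_reindex, Algebra.discr_reindex F B e, etaleDiscr, finprod_eq_prod_of_fintype]
    simp only [← hd]
    rw [← discr_piBasis, Algebra.discr_eq_discr_of_algEquiv _ (factorEquiv F)]
    congr 1
    ext1 i
    simp [B]

end IntegralBasis

/-! ### The height as a Gauss norm -/

section Height

variable {F : Type*} [NontriviallyNormedField F] [IsUltrametricDist F] [CompleteSpace F]
  [CharZero F] {E : Type*} [CommRing E] [Algebra F E] [Module.Finite F E] [IsReduced E]

/-- The way the height enters the density: with Gauss's lemma, `χ_x Q` is integral if and only if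
the coefficients of `Q` are bounded by `1 / H(x)`. It reduces to the field case because `χ_x` is the
product of the characteristic polynomials of the components of `x`. -/
theorem supNorm_charPoly (x : E) : (charPoly F x).supNorm = height F x := by
  have := finite_maximalSpectrum F E
  have := Fintype.ofFinite (MaximalSpectrum E)
  have h : charPoly F x = ∏ 𝔪 : MaximalSpectrum E, charPoly F (toFactor F 𝔪 x) := by
    refine charPoly_eq_of_eval fun t => ?_
    rw [eval_prod, norm_eq_prod_norm_toFactor]
    exact Finset.prod_congr rfl fun 𝔪 _ => by
      rw [eval_charPoly, map_sub (toFactor F 𝔪), AlgHom.commutes]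
  rw [h, supNorm_prod, height, finprod_eq_prod_of_fintype]
  exact Finset.prod_congr rfl fun 𝔪 _ => supNorm_charPoly_field _

omit [CompleteSpace F] [CharZero F] [IsReduced E] in
theorem one_le_height (x : E) : 1 ≤ height F x := by
  have := finite_maximalSpectrum F E
  have := Fintype.ofFinite (MaximalSpectrum E)
  rw [height, finprod_eq_prod_of_fintype]
  exact Finset.prod_induction _ (1 ≤ ·) (fun _ _ => one_le_mul_of_one_le_of_one_le) le_rfl
    fun 𝔪 _ => le_max_left _ _

theorem norm_algebraNorm_eq_prod (x : E) [Fintype (MaximalSpectrum E)] :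
    ‖Algebra.norm F x‖ = ∏ 𝔪 : MaximalSpectrum E,
      spectralNorm F (Factor 𝔪) (toFactor F 𝔪 x) ^ Module.finrank F (Factor 𝔪) := by
  rw [norm_eq_prod_norm_toFactor, norm_prod]
  exact Finset.prod_congr rfl fun 𝔪 _ => norm_algebraNorm_eq_spectralNorm_pow _

omit [CharZero F] [CompleteSpace F] [IsReduced E] in
theorem height_eq_one_of_mem {x : E} (hx : x ∈ etaleIntegers F E) : height F x = 1 := by
  rw [height]
  refine finprod_eq_one_of_forall_eq_one fun 𝔪 => ?_
  have := (etaleNorm_le_one_iff F x).1 hx 𝔪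
  exact max_eq_left (pow_le_one₀ (spectralNorm_nonneg _) this)

theorem coeff_charPoly_mem {x : E} (hx : x ∈ etaleIntegers F E) (i : ℕ) :
    (charPoly F x).coeff i ∈ OF F := by
  rw [mem_OF, ← height_eq_one_of_mem hx, ← supNorm_charPoly]
  exact le_supNorm _ i

/-- The height of `u / v` when the pair `(u, v)` has the same maximum norm as `(x, 1)`. -/
theorem height_mul_norm_eq {x y u : E}
    (h : ∀ 𝔪 : MaximalSpectrum E,
      max (spectralNorm F (Factor 𝔪) (toFactor F 𝔪 u))
        (spectralNorm F (Factor 𝔪) (toFactor F 𝔪 (y * u))) =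
      max 1 (spectralNorm F (Factor 𝔪) (toFactor F 𝔪 x))) :
    height F y * ‖Algebra.norm F u‖ = height F x := by
  have := finite_maximalSpectrum F E
  have := Fintype.ofFinite (MaximalSpectrum E)
  have hm : ∀ (a b : ℝ) (k : ℕ), 0 ≤ a → 0 ≤ b → max (a ^ k) (b ^ k) = max a b ^ k := by
    intro a b k ha hb
    rcases le_total a b with h | h
    · rw [max_eq_right h, max_eq_right (pow_le_pow_left₀ ha h k)]
    · rw [max_eq_left h, max_eq_left (pow_le_pow_left₀ hb h k)]
  rw [height, height, finprod_eq_prod_of_fintype, finprod_eq_prod_of_fintype,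
    norm_algebraNorm_eq_prod, ← Finset.prod_mul_distrib]
  refine Finset.prod_congr rfl fun 𝔪 _ => ?_
  have h1 := h 𝔪
  rw [map_mul, ← spectralMulAlgNorm_def (toFactor F 𝔪 y * _), map_mul, spectralMulAlgNorm_def,
    spectralMulAlgNorm_def] at h1
  have n0 := fun z : Factor 𝔪 => spectralNorm_nonneg (K := F) z
  rw [max_mul_of_nonneg _ _ (pow_nonneg (n0 _) _), one_mul, ← mul_pow,
    hm _ _ _ (n0 _) (mul_nonneg (n0 _) (n0 _)), h1]
  conv_rhs => rw [← one_pow (Module.finrank F (Factor 𝔪)), hm _ _ _ zero_le_one (n0 _)]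

end Height

/-! ### Polynomials as coefficient vectors -/

section VecPoly

/-- The polynomial of degree `< m` with given coefficients. -/
noncomputable def vecPoly {R : Type*} [CommRing R] {m : ℕ} : (Fin m → R) →ₗ[R] R[X] where
  toFun a := ∑ i : Fin m, monomial (i : ℕ) (a i)
  map_add' a b := by simp [Finset.sum_add_distrib]
  map_smul' c a := by simp [Finset.smul_sum, smul_monomial]

variable {R : Type*} [CommRing R] {m : ℕ}

theorem vecPoly_apply (a : Fin m → R) : vecPoly a = ∑ i : Fin m, monomial (i : ℕ) (a i) := rfl

theorem coeff_vecPoly (a : Fin m → R) (i : ℕ) :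
    (vecPoly a).coeff i = if h : i < m then a ⟨i, h⟩ else 0 := by
  rw [vecPoly_apply, finsetSum_coeff]
  simp only [coeff_monomial]
  split_ifs with h
  · rw [Finset.sum_eq_single ⟨i, h⟩]
    · simp
    · intro j _ hj
      rw [if_neg fun h' => hj (Fin.ext h')]
    · simp
  · exact Finset.sum_eq_zero fun j _ => if_neg fun h' : (j : ℕ) = i => h (h' ▸ j.2)

@[simp] theorem coeff_vecPoly_fin (a : Fin m → R) (i : Fin m) : (vecPoly a).coeff i = a i := by
  rw [coeff_vecPoly, dif_pos i.2]

theorem degree_vecPoly_lt (a : Fin m → R) : (vecPoly a).degree < m := by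
  rw [degree_lt_iff_coeff_zero]
  intro i hi
  rw [coeff_vecPoly, dif_neg (not_lt.2 hi)]

theorem vecPoly_coeff {P : R[X]} (hP : P.degree < m) :
    vecPoly (fun i : Fin m => P.coeff i) = P := by
  ext i
  rw [coeff_vecPoly]
  split_ifs with h
  · rfl
  · exact ((degree_lt_iff_coeff_zero _ _).1 hP i (not_lt.1 h)).symm

theorem vecPoly_injective : Function.Injective (vecPoly : (Fin m → R) → R[X]) := fun a b h =>
  funext fun i => by rw [← coeff_vecPoly_fin a, h, coeff_vecPoly_fin]

theorem aeval_vecPoly {A : Type*} [CommRing A] [Algebra R A] (x : A) (a : Fin m → R) :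
    aeval x (vecPoly a) = ∑ i : Fin m, a i • x ^ (i : ℕ) := by
  rw [vecPoly_apply, map_sum]
  simp [aeval_monomial, Algebra.smul_def]

/-- Evaluation at `x` of the polynomials of degree `< m`. -/
noncomputable def evalVec {A : Type*} [CommRing A] [Algebra R A] (x : A) (m : ℕ) :
    (Fin m → R) →ₗ[R] A :=
  (aeval x).toLinearMap ∘ₗ vecPoly

theorem evalVec_apply {A : Type*} [CommRing A] [Algebra R A] (x : A) (a : Fin m → R) :
    evalVec x m a = aeval x (vecPoly a) := rfl

end VecPoly

/-! ### New elements: `E = F[x]` -/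

section New

variable {F : Type*} [NontriviallyNormedField F] {E : Type*} [CommRing E]
  [Algebra F E] [Module.Finite F E]

omit [Module.Finite F E] in
theorem isNew_iff_surjective_aeval {x : E} :
    IsNew F x ↔ Function.Surjective (aeval x : F[X] → E) := by
  rw [IsNew, Algebra.adjoin_singleton_eq_range_aeval, AlgHom.range_eq_top]

theorem exists_evalVec_eq {x : E} {m : ℕ} (hm : Module.finrank F E ≤ m) (P : F[X]) :
    ∃ a : Fin m → F, evalVec x m a = aeval x P := by
  refine ⟨fun i => (P %ₘ charPoly F x).coeff i, ?_⟩
  rw [evalVec_apply, vecPoly_coeff]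
  · conv_rhs => rw [← modByMonic_add_div P (charPoly F x)]
    simp [aeval_charPoly]
  · rcases subsingleton_or_nontrivial E with h | h
    · have : charPoly F x = 1 :=
        (charPoly_monic x).natDegree_eq_zero.1
          ((natDegree_charPoly x).trans (Module.finrank_zero_of_subsingleton))
      simp [this, modByMonic_one]
    · refine (degree_modByMonic_lt P (charPoly_monic x)).trans_le ?_
      rw [degree_eq_natDegree (charPoly_monic x).ne_zero, natDegree_charPoly]
      exact_mod_cast hm

theorem isNew_iff_surjective_evalVec {x : E} {m : ℕ} (hm : Module.finrank F E ≤ m) :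
    IsNew F x ↔ Function.Surjective (evalVec (R := F) x m) := by
  rw [isNew_iff_surjective_aeval]
  constructor
  · intro h y
    obtain ⟨P, rfl⟩ := h y
    exact exists_evalVec_eq hm P
  · intro h y
    obtain ⟨a, rfl⟩ := h y
    exact ⟨_, rfl⟩

theorem isNew_iff_injective_evalVec {x : E} :
    IsNew F x ↔ Function.Injective (evalVec (R := F) x (Module.finrank F E)) := by
  rw [isNew_iff_surjective_evalVec le_rfl, ← LinearMap.injective_iff_surjective_of_finrank_eq_finrank]
  simp

/-- The remainder of `P` modulo `χ_x` has degree less than `r` and vanishes at `x`, while `1, x, …,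
x^{r-1}` are independent. So `χ_x` plays the role of a minimal polynomial although `E` need not be a
field. -/
theorem IsNew.charPoly_dvd {x : E} (hx : IsNew F x) {P : F[X]} (hP : aeval x P = 0) :
    charPoly F x ∣ P := by
  rw [← modByMonic_eq_zero_iff_dvd (charPoly_monic x)]
  have hd : (P %ₘ charPoly F x).degree < Module.finrank F E := by
    have := degree_modByMonic_lt P (charPoly_monic x)
    rwa [degree_eq_natDegree (charPoly_monic x).ne_zero, natDegree_charPoly] at this
  have h0 : aeval x (P %ₘ charPoly F x) = 0 := by
    have := congrArg (aeval x) (modByMonic_add_div P (charPoly F x))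
    simpa [aeval_charPoly, hP] using this
  rw [← vecPoly_coeff hd, ← evalVec_apply] at h0
  have := isNew_iff_injective_evalVec.1 hx (h0.trans (map_zero _).symm)
  rw [← vecPoly_coeff hd, this, map_zero]

/-- If `χ_x = P² Q`, then `(P Q)(x)` has square zero, so it vanishes and `χ_x` divides `P Q`. This
forces `P` to be a unit. -/
theorem IsNew.separable_charPoly [CharZero F] [IsReduced E] {x : E} (hx : IsNew F x) :
    (charPoly F x).Separable := by
  rw [PerfectField.separable_iff_squarefree]
  intro P hP
  obtain ⟨Q, hQ⟩ := hP
  have h0 : charPoly F x ≠ 0 := (charPoly_monic x).ne_zero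
  have h1 : aeval x (P * Q) = 0 := by
    have h2 : aeval x (P * Q) ^ 2 = 0 := by
      rw [← map_pow]
      have : (P * Q) ^ 2 = charPoly F x * Q := by rw [hQ]; ring
      rw [this, map_mul, aeval_charPoly, zero_mul]
    exact pow_eq_zero_iff two_ne_zero |>.1 h2
  obtain ⟨R, hR⟩ := hx.charPoly_dvd h1
  have h3 : P * Q ≠ 0 := fun h => h0 (by rw [hQ, mul_assoc, h, mul_zero])
  refine IsUnit.of_mul_eq_one R ?_
  have : (P * Q) * (P * R) = (P * Q) * 1 := by
    conv_rhs => rw [hR, hQ]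
    ring
  exact mul_left_cancel₀ h3 this

/-- The basis `1, x, …, x^{r-1}` of `E = F[x]`. -/
noncomputable def IsNew.basis {x : E} (hx : IsNew F x) :
    Module.Basis (Fin (Module.finrank F E)) F E :=
  (Pi.basisFun F _).map (LinearEquiv.ofBijective (evalVec x _)
    (show Function.Bijective _ from
      ⟨isNew_iff_injective_evalVec.1 hx, (isNew_iff_surjective_evalVec le_rfl).1 hx⟩))

theorem IsNew.basis_apply {x : E} (hx : IsNew F x) (i) : hx.basis i = x ^ (i : ℕ) := by
  have h : hx.basis i = evalVec x _ (Pi.single i (1 : F)) := by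
    rw [← Pi.basisFun_apply]; rfl
  rw [h, evalVec_apply, aeval_vecPoly, Finset.sum_eq_single i]
  · simp
  · intro j _ hj; simp [hj]
  · simp

/-- The classical identity `disc(1, x, …, x^{r-1}) = ± N(χ'(x))`. Over the algebraic closure the
Vandermonde matrix of the roots `α_j` of `χ` diagonalizes multiplication by `P(x)`, with eigenvalues
`P(α_j)`. Traces and norms become sums and products over roots, and both sides become products of
differences `α_i - α_j`. -/
theorem IsNew.norm_discr_eq [CharZero F] [IsReduced E] {x : E} (hx : IsNew F x) :
    ‖Algebra.discr F hx.basis‖ = ‖Algebra.norm F (aeval x (derivative (charPoly F x)))‖ := by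
  classical
  set r := Module.finrank F E
  set Ω := AlgebraicClosure F
  set χ := charPoly F x
  have hsplit : (χ.map (algebraMap F Ω)).Splits := IsAlgClosed.splits _
  have hcard : Fintype.card (χ.rootSet Ω) = r :=
    (card_rootSet_eq_natDegree hx.separable_charPoly hsplit).trans (natDegree_charPoly x)
  let e : Fin r ≃ χ.rootSet Ω := (Fintype.equivFinOfCardEq hcard).symm
  let α : Fin r → Ω := fun j => e j
  have hα : Function.Injective α := Subtype.val_injective.comp e.injective
  have hroot : ∀ j, aeval (α j) χ = 0 := fun j => aeval_eq_zero_of_mem_rootSet (e j).2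
  have hprod : χ.map (algebraMap F Ω) = Lagrange.nodal Finset.univ α := by
    have hmem : ∀ a, a ∈ χ.rootSet Ω ↔ a ∈ (χ.map (algebraMap F Ω)).roots := fun a => by
      rw [rootSet_def, Finset.mem_coe, Multiset.mem_toFinset]
    have hroots : (χ.map (algebraMap F Ω)).roots = Finset.univ.val.map α := by
      refine (Multiset.Nodup.ext (nodup_roots hx.separable_charPoly.map)
        (Finset.univ.nodup.map hα)).2 fun a => ?_
      rw [Multiset.mem_map]
      constructor
      · intro ha
        exact ⟨e.symm ⟨a, (hmem a).2 ha⟩, Finset.mem_univ_val _, by simp [α]⟩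
      · rintro ⟨j, -, rfl⟩
        exact (hmem _).1 (e j).2
    rw [hsplit.eq_prod_roots_of_monic ((charPoly_monic x).map _), hroots, Multiset.map_map]
    rfl
  -- Evaluation at `α j` factors through evaluation at `x`: it is a homomorphism from `E` to the
  -- algebraic closure.
  have hdiv : ∀ (P Q : F[X]), aeval x P = aeval x Q → ∀ j, aeval (α j) P = aeval (α j) Q := by
    intro P Q h j
    obtain ⟨R, hR⟩ := hx.charPoly_dvd (P := P - Q) (by rw [map_sub, h, sub_self])
    have := congrArg (aeval (α j)) hR
    rwa [map_mul, hroot, zero_mul, map_sub, sub_eq_zero] at this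
  let V : Matrix (Fin r) (Fin r) Ω := Matrix.vandermonde α
  have hV : IsUnit V.det := isUnit_iff_ne_zero.2 (Matrix.det_vandermonde_ne_zero_iff.2 hα)
  have hVM : ∀ P : F[X], V * (Algebra.leftMulMatrix hx.basis (aeval x P)).map (algebraMap F Ω) =
      Matrix.diagonal (fun j => aeval (α j) P) * V := by
    intro P
    ext j k
    rw [Matrix.diagonal_mul, Matrix.mul_apply]
    have h1 := hdiv (P * X ^ (k : ℕ))
      (vecPoly fun i => Algebra.leftMulMatrix hx.basis (aeval x P) i k) (by
        rw [aeval_vecPoly]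
        simp only [Algebra.leftMulMatrix_eq_repr_mul, ← hx.basis_apply]
        rw [hx.basis.sum_repr, hx.basis_apply]
        simp) j
    rw [map_mul, map_pow, aeval_X] at h1
    simp only [V, Matrix.vandermonde_apply, Matrix.map_apply]
    rw [h1, aeval_vecPoly]
    exact Finset.sum_congr rfl fun i _ => by rw [Algebra.smul_def, mul_comm]
  have hconj : ∀ P : F[X], (Algebra.leftMulMatrix hx.basis (aeval x P)).map (algebraMap F Ω) =
      V⁻¹ * (Matrix.diagonal (fun j => aeval (α j) P) * V) := by
    intro P
    rw [← hVM, ← Matrix.mul_assoc, Matrix.nonsing_inv_mul _ hV, Matrix.one_mul]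
  have hnorm : ∀ P : F[X], algebraMap F Ω (Algebra.norm F (aeval x P)) = ∏ j, aeval (α j) P := by
    intro P
    have h1 := congrArg Matrix.det (hVM P)
    rw [Matrix.det_mul, Matrix.det_mul, Matrix.det_diagonal, mul_comm V.det] at h1
    rw [Algebra.norm_eq_matrix_det hx.basis, RingHom.map_det]
    exact hV.mul_right_cancel h1
  have htrace : ∀ P : F[X], algebraMap F Ω (Algebra.trace F E (aeval x P)) = ∑ j, aeval (α j) P := by
    intro P
    rw [Algebra.trace_eq_matrix_trace hx.basis, AddMonoidHom.map_trace]
    refine (congrArg Matrix.trace (hconj P)).trans ?_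
    rw [Matrix.trace_mul_comm, Matrix.mul_assoc, Matrix.mul_nonsing_inv _ hV, Matrix.mul_one,
      Matrix.trace_diagonal]
  have hdisc : algebraMap F Ω (Algebra.discr F hx.basis) = V.det ^ 2 := by
    have : (Algebra.traceMatrix F hx.basis).map (algebraMap F Ω) = V.transpose * V := by
      ext i k
      rw [Matrix.map_apply, Algebra.traceMatrix_apply, Algebra.traceForm_apply, hx.basis_apply,
        hx.basis_apply, ← pow_add]
      have := htrace (X ^ ((i : ℕ) + k))
      rw [map_pow, aeval_X] at this
      rw [this, Matrix.mul_apply]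
      simp [V, Matrix.vandermonde_apply, pow_add]
    rw [Algebra.discr_def, RingHom.map_det, RingHom.mapMatrix_apply, this, Matrix.det_mul,
      Matrix.det_transpose, sq]
  have hder : algebraMap F Ω (Algebra.norm F (aeval x (derivative χ))) =
      ∏ j, ∏ i ∈ {j}ᶜ, (α j - α i) := by
    rw [hnorm]
    refine Finset.prod_congr rfl fun j _ => ?_
    rw [← eval_map_algebraMap, ← derivative_map, hprod,
      Lagrange.eval_nodal_derivative_eval_node_eq (Finset.mem_univ j), Lagrange.eval_nodal]
    refine Finset.prod_congr ?_ fun _ _ => rfl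
    ext i; simp
  -- The sign `(-1)^{r(r-1)/2}`, which the norm ignores.
  let s : F := ∏ i : Fin r, ∏ j ∈ Finset.Ioi i, (-1 : F)
  have hs : ‖s‖ = 1 := by simp [s, norm_prod]
  have key : Algebra.norm F (aeval x (derivative χ)) = s * Algebra.discr F hx.basis := by
    apply (algebraMap F Ω).injective
    rw [hder, map_mul, hdisc, Matrix.det_vandermonde]
    have h1 := Finset.prod_prod_Ioi_mul_eq_prod_prod_off_diag (fun i j : Fin r => α j - α i)
    rw [← h1]
    simp only [s, map_prod, sq, ← Finset.prod_mul_distrib]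
    refine Finset.prod_congr rfl fun i _ => Finset.prod_congr rfl fun j _ => ?_
    simp; ring
  rw [key, norm_mul, hs, one_mul]

end New

/-! ### Euclidean division preserves volume -/

section MulAdd

/-- The coefficient vector of `R + χ Q`, for `R` and `Q` given by their coefficient vectors. -/
noncomputable def mulAdd {F : Type*} [CommRing F] (χ : F[X]) (r k m : ℕ) :
    ((Fin r → F) × (Fin k → F)) →ₗ[F] (Fin m → F) where
  toFun p i := (vecPoly p.1 + χ * vecPoly p.2).coeff i
  map_add' p q := by ext i; simp [mul_add]; ring
  map_smul' c p := by ext i; simp [mul_add]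

theorem vecPoly_mulAdd {F : Type*} [CommRing F] {χ : F[X]} {r k m : ℕ} (hχ : χ.degree ≤ r)
    (hm : r + k = m) (p : (Fin r → F) × (Fin k → F)) :
    vecPoly (m := m) (R := F) (mulAdd χ r k m p) = vecPoly p.1 + χ * vecPoly p.2 := by
  suffices h : (vecPoly p.1 + χ * vecPoly p.2).degree < m from vecPoly_coeff h
  refine (degree_add_le _ _).trans_lt (max_lt ?_ ?_)
  · exact (degree_vecPoly_lt _).trans_le (by exact_mod_cast (by lia))
  · refine (degree_mul_le _ _).trans_lt ?_
    have h2 := degree_vecPoly_lt p.2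
    rcases eq_or_ne χ.degree ⊥ with h | h
    · rw [h, WithBot.bot_add]; exact WithBot.bot_lt_coe m
    · rw [← hm, Nat.cast_add]
      exact WithBot.add_lt_add_of_le_of_lt h hχ h2

variable {F : Type*} [NontriviallyNormedField F] [IsUltrametricDist F] [ProperSpace F]
  [MeasurableSpace F] [BorelSpace F]

/-- Splitting a vector of length `r + k` in its first `r` and its last `k` coordinates. -/
def finSplit (F : Type*) [MeasurableSpace F] (r k : ℕ) :
    (Fin (r + k) → F) ≃ᵐ (Fin r → F) × (Fin k → F) :=
  (MeasurableEquiv.piCongrLeft (fun _ : Fin r ⊕ Fin k => F) finSumFinEquiv.symm).trans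
    (MeasurableEquiv.sumPiEquivProdPi fun _ : Fin r ⊕ Fin k => F)

omit [NontriviallyNormedField F] [IsUltrametricDist F] [ProperSpace F] [BorelSpace F] in
theorem finSplit_apply {r k : ℕ} (a : Fin (r + k) → F) :
    finSplit F r k a =
      ((fun i : Fin r => a (Fin.castAdd k i)), (fun j : Fin k => a (Fin.natAdd r j))) := by
  have h := fun s : Fin r ⊕ Fin k => Equiv.piCongrLeft_apply_apply
    (fun _ : Fin r ⊕ Fin k => F) finSumFinEquiv.symm a (finSumFinEquiv s)
  ext i
  · have := h (Sum.inl i)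
    rw [Equiv.symm_apply_apply] at this
    exact this
  · have := h (Sum.inr i)
    rw [Equiv.symm_apply_apply] at this
    exact this

theorem measurePreserving_finSplit (r k : ℕ) :
    MeasurePreserving (finSplit F r k) (piHaar F (Fin (r + k)))
      ((piHaar F (Fin r)).prod (piHaar F (Fin k))) :=
  (measurePreserving_sumPiEquivProdPi (fun _ : Fin r ⊕ Fin k => haarF F)).comp
    (measurePreserving_piCongrLeft (fun _ : Fin r ⊕ Fin k => haarF F) finSumFinEquiv.symm)

/-- The top `k` coefficients of `R + χ Q` depend on `Q` alone, through a triangular matrix with ones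
on the diagonal because `χ` is monic. The lower `r` coefficients are those of `R`, translated by a
vector depending on `Q` alone. -/
theorem measurePreserving_mulAdd [IsNormalized F] {χ : F[X]} {r k m : ℕ} (hχ : χ.Monic)
    (hr : χ.natDegree = r) (hm : r + k = m) :
    MeasurePreserving (mulAdd χ r k m) ((piHaar F (Fin r)).prod (piHaar F (Fin k)))
      (piHaar F (Fin m)) := by
  subst hm
  let U : (Fin k → F) →ₗ[F] (Fin k → F) :=
    { toFun := fun Q j => (χ * vecPoly Q).coeff (r + j)
      map_add' := fun P Q => by ext j; simp [mul_add]
      map_smul' := fun c Q => by ext j; simp }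
  have hU : ∀ i j, LinearMap.toMatrix' U i j =
      if (j : ℕ) ≤ r + i then χ.coeff (r + i - j) else 0 := by
    intro i j
    have : vecPoly (Pi.single j (1 : F)) = X ^ (j : ℕ) := by
      ext l
      rw [coeff_vecPoly, coeff_X_pow]
      split_ifs with h h' h'
      · have : (⟨l, h⟩ : Fin k) = j := Fin.ext h'
        rw [this, Pi.single_eq_same]
      · rw [Pi.single_eq_of_ne fun h'' => h' (congrArg Fin.val h'')]
      · exact absurd (h' ▸ j.2) h
      · rfl
    rw [LinearMap.toMatrix'_apply]
    change (χ * vecPoly _).coeff (r + i) = _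
    rw [this, coeff_mul_X_pow']
  have hdet : LinearMap.det U = 1 := by
    rw [← LinearMap.det_toMatrix', Matrix.det_of_isUpperTriangular]
    · refine Finset.prod_eq_one fun i _ => ?_
      rw [hU, if_pos (Nat.le_add_left _ _), Nat.add_sub_cancel, ← hr]
      exact hχ
    · intro i j hij
      have hij' : (j : ℕ) < i := hij
      rw [hU, if_pos (by lia)]
      exact coeff_eq_zero_of_natDegree_lt (by lia)
  have hUm : MeasurePreserving U (piHaar F (Fin k)) (piHaar F (Fin k)) := by
    refine ⟨(LinearMap.continuous_on_pi U).measurable, ?_⟩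
    rw [map_linearMap_piHaar (by rw [hdet]; exact one_ne_zero), hdet]
    simp
  let Lo : (Fin k → F) →ₗ[F] (Fin r → F) :=
    { toFun := fun Q i => (χ * vecPoly Q).coeff i
      map_add' := fun P Q => by ext j; simp [mul_add]
      map_smul' := fun c Q => by ext j; simp }
  have hLo : Continuous Lo := LinearMap.continuous_on_pi Lo
  have hskew : MeasurePreserving (fun p : (Fin k → F) × (Fin r → F) => (U p.1, p.2 + Lo p.1))
      ((piHaar F (Fin k)).prod (piHaar F (Fin r))) ((piHaar F (Fin k)).prod (piHaar F (Fin r))) :=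
    hUm.skew_product (g := fun Q R => R + Lo Q) (by fun_prop)
      (Filter.Eventually.of_forall fun Q => map_add_right_eq_self _ _)
  have hT := (Measure.measurePreserving_swap.comp hskew).comp
    (Measure.measurePreserving_swap (μ := piHaar F (Fin r)) (ν := piHaar F (Fin k)))
  have hS := (measurePreserving_finSplit (F := F) r k).symm
  have := hS.comp hT
  have heq : ⇑(mulAdd χ r k (r + k)) = (finSplit F r k).symm ∘ ((Prod.swap ∘
      fun p : (Fin k → F) × (Fin r → F) => (U p.1, p.2 + Lo p.1)) ∘ Prod.swap) := by
    ext1 p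
    rw [Function.comp_apply, MeasurableEquiv.eq_symm_apply, finSplit_apply]
    refine Prod.ext ?_ ?_
    · ext i
      simp [mulAdd, Lo]
    · ext j
      have : (vecPoly p.1).coeff (r + j) = 0 := by rw [coeff_vecPoly, dif_neg (by lia)]
      simp [mulAdd, U, this]
  rw [heq]
  exact this

end MulAdd

/-! ### Haar measure on `E` and the volume of the power lattice -/

section Coordinates

variable {F : Type*} [NontriviallyNormedField F]
  {E : Type*} [CommRing E] [Algebra F E] [Module.Finite F E]

/-- A basis of `E` which is an `𝒪_F`-basis of `𝒪_E`, with the right discriminant. -/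
structure IsIntegralBasis [IsUltrametricDist F] (b : Module.Basis (Fin (Module.finrank F E)) F E) :
    Prop where
  mem_iff : ∀ x, x ∈ etaleIntegers F E ↔ ∀ i, b.repr x i ∈ OF F
  discr_eq : Algebra.discr F b = etaleDiscr F E

theorem exists_isIntegralBasis (F E : Type*) [NontriviallyNormedField F] [IsUltrametricDist F]
    [ProperSpace F] [CharZero F] [CommRing E] [Algebra F E] [Module.Finite F E] [IsReduced E] :
    ∃ b : Module.Basis (Fin (Module.finrank F E)) F E, IsIntegralBasis b :=
  (exists_basis_etaleIntegers F E).imp fun _ h => ⟨h.1, h.2⟩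

variable [TopologicalSpace E] [IsModuleTopology F E]

/-- Coordinates in a basis, as a homeomorphism. -/
noncomputable def coordHomeo (b : Module.Basis (Fin (Module.finrank F E)) F E) :
    (Fin (Module.finrank F E) → F) ≃ₜ E where
  toEquiv := b.equivFun.symm.toEquiv
  continuous_toFun := by
    have := IsModuleTopology.toContinuousAdd F E
    exact LinearMap.continuous_on_pi (b.equivFun.symm : (Fin (Module.finrank F E) → F) →ₗ[F] E)
  continuous_invFun := by
    have : Continuous (b.equivFun.toLinearMap : E → _) :=
      IsModuleTopology.continuous_of_linearMap b.equivFun.toLinearMap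
    exact this

theorem coordHomeo_apply (b : Module.Basis (Fin (Module.finrank F E)) F E)
    (c : Fin (Module.finrank F E) → F) : coordHomeo b c = b.equivFun.symm c := rfl

theorem isTopologicalRing_of_isModuleTopology (F E : Type*) [NontriviallyNormedField F]
    [CommRing E] [Algebra F E] [Module.Finite F E] [TopologicalSpace E] [IsModuleTopology F E] :
    IsTopologicalRing E := IsModuleTopology.isTopologicalRing F E

theorem t2Space_of_isModuleTopology (F E : Type*) [NontriviallyNormedField F]
    [CommRing E] [Algebra F E] [Module.Finite F E] [TopologicalSpace E] [IsModuleTopology F E] :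
    T2Space E := (coordHomeo (Module.finBasis F E)).t2Space

theorem secondCountableTopology_of_isModuleTopology (F E : Type*) [NontriviallyNormedField F]
    [ProperSpace F]
    [CommRing E] [Algebra F E] [Module.Finite F E] [TopologicalSpace E] [IsModuleTopology F E] :
    SecondCountableTopology E := (coordHomeo (Module.finBasis F E)).symm.secondCountableTopology

theorem locallyCompactSpace_of_isModuleTopology (F E : Type*) [NontriviallyNormedField F]
    [ProperSpace F]
    [CommRing E] [Algebra F E] [Module.Finite F E] [TopologicalSpace E] [IsModuleTopology F E] :
    LocallyCompactSpace E :=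
  (coordHomeo (Module.finBasis F E)).symm.isClosedEmbedding.locallyCompactSpace

variable [IsUltrametricDist F]

theorem IsIntegralBasis.image_cube {b : Module.Basis (Fin (Module.finrank F E)) F E}
    (hb : IsIntegralBasis b) : coordHomeo b '' cube F _ = (etaleIntegers F E : Set E) := by
  ext x
  rw [(coordHomeo b).image_eq_preimage_symm, Set.mem_preimage, mem_cube, SetLike.mem_coe, hb.mem_iff]
  rfl

variable [ProperSpace F] [MeasurableSpace E] [BorelSpace E]

theorem etaleHaar_spec [CharZero F] [IsReduced E] :
    (etaleHaar F E).IsAddHaarMeasure ∧ etaleHaar F E (etaleIntegers F E) = 1 := by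
  obtain ⟨b, hb⟩ := exists_isIntegralBasis F E
  have := isTopologicalRing_of_isModuleTopology F E
  refine normalizedHaar_spec ?_ ?_
  · rw [← hb.image_cube]; exact isCompact_cube.image (coordHomeo b).continuous
  · have : IsOpen (etaleIntegers F E : Set E) := by
      rw [← hb.image_cube]; exact (coordHomeo b).isOpenMap _ isOpen_cube
    rw [this.interior_eq]
    exact ⟨0, zero_mem _⟩

variable [MeasurableSpace F] [BorelSpace F]

/-- Uniqueness of Haar measure: both measures give mass `1` to `𝒪_E`, the image of the cube. -/
theorem IsIntegralBasis.map_coordHomeo {b : Module.Basis (Fin (Module.finrank F E)) F E}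
    [CharZero F] [IsReduced E] (hb : IsIntegralBasis b) :
    (piHaar F _).map (coordHomeo b) = etaleHaar F E := by
  have := isTopologicalRing_of_isModuleTopology F E
  have := t2Space_of_isModuleTopology F E
  have := secondCountableTopology_of_isModuleTopology F E
  have := locallyCompactSpace_of_isModuleTopology F E
  have h1 := (etaleHaar_spec (F := F) (E := E)).1
  have h2 : ((piHaar F (Fin (Module.finrank F E))).map (coordHomeo b)).IsAddHaarMeasure :=
    b.equivFun.symm.toAddEquiv.isAddHaarMeasure_map _ (coordHomeo b).continuous
      (coordHomeo b).symm.continuous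
  have h3 := Measure.isAddLeftInvariant_eq_smul
    ((piHaar F (Fin (Module.finrank F E))).map (coordHomeo b)) (etaleHaar F E)
  have h4 := congrArg (fun μ => μ (etaleIntegers F E : Set E)) h3
  simp only [Measure.smul_apply, (etaleHaar_spec (F := F) (E := E)).2] at h4
  have h5 : (coordHomeo b) ⁻¹' (etaleIntegers F E : Set E) = cube F _ := by
    rw [← hb.image_cube, Set.preimage_image_eq _ (coordHomeo b).injective]
  have h6 := (coordHomeo b).toMeasurableEquiv.map_apply (μ := piHaar F _)
    (etaleIntegers F E : Set E)
  rw [Homeomorph.toMeasurableEquiv_coe, h5, piHaar_cube] at h6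
  rw [h6] at h4
  have h7 : (Measure.addHaarScalarFactor
    ((piHaar F (Fin (Module.finrank F E))).map (coordHomeo b)) (etaleHaar F E)) = 1 := by
    have : ((Measure.addHaarScalarFactor
    ((piHaar F (Fin (Module.finrank F E))).map (coordHomeo b)) (etaleHaar F E)) : ℝ≥0∞) = 1 := by
      rw [h4, ENNReal.smul_def, smul_eq_mul, mul_one]
    exact_mod_cast this
  rw [h3, h7, one_smul]

theorem IsIntegralBasis.etaleHaar_apply {b : Module.Basis (Fin (Module.finrank F E)) F E}
    [CharZero F] [IsReduced E] (hb : IsIntegralBasis b) (s : Set E) :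
    etaleHaar F E s = piHaar F _ (coordHomeo b ⁻¹' s) := by
  rw [← hb.map_coordHomeo]
  exact (coordHomeo b).toMeasurableEquiv.map_apply _

theorem IsIntegralBasis.measurePreserving {b : Module.Basis (Fin (Module.finrank F E)) F E}
    [CharZero F] [IsReduced E] (hb : IsIntegralBasis b) :
    MeasurePreserving (coordHomeo b) (piHaar F _) (etaleHaar F E) :=
  ⟨(coordHomeo b).measurable, hb.map_coordHomeo⟩

variable [IsNormalized F] [CharZero F] [IsReduced E]

theorem IsIntegralBasis.etaleHaar_image_evalVec
    {b : Module.Basis (Fin (Module.finrank F E)) F E} (hb : IsIntegralBasis b)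
    (x : E) (s : Set (Fin (Module.finrank F E) → F)) (hx : IsNew F x) :
    etaleHaar F E (evalVec x _ '' s) =
      ENNReal.ofReal ‖b.det fun i : Fin (Module.finrank F E) => x ^ (i : ℕ)‖ * piHaar F _ s := by
  let f : (Fin (Module.finrank F E) → F) →ₗ[F] (Fin (Module.finrank F E) → F) :=
    b.equivFun.toLinearMap ∘ₗ evalVec x _
  have hf : LinearMap.det f = b.det fun i : Fin (Module.finrank F E) => x ^ (i : ℕ) := by
    rw [← LinearMap.det_toMatrix', Module.Basis.det_apply]
    congr 1
    ext i j
    rw [LinearMap.toMatrix'_apply, Module.Basis.toMatrix_apply]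
    change b.repr (evalVec x _ _) i = _
    rw [evalVec_apply, aeval_vecPoly]
    congr 2
    rw [Finset.sum_eq_single j]
    · simp
    · intro k _ hk; simp [hk]
    · simp
  have h0 : LinearMap.det f ≠ 0 := by
    intro h
    refine (LinearMap.bot_lt_ker_of_det_eq_zero h).ne' (LinearMap.ker_eq_bot.2 ?_)
    exact b.equivFun.injective.comp (isNew_iff_injective_evalVec.1 hx)
  rw [hb.etaleHaar_apply, ← hf, ← piHaar_image_linearMap_of_det_ne_zero h0]
  congr 1
  ext c
  simp only [Set.mem_preimage, Set.mem_image, f, LinearMap.comp_apply, coordHomeo_apply]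
  refine exists_congr fun a => and_congr_right fun _ => ?_
  exact LinearEquiv.eq_symm_apply b.equivFun

theorem powerLattice_eq_image {F : Type*} [NontriviallyNormedField F] [IsUltrametricDist F]
    {E : Type*} [CommRing E] [Algebra F E] [Module.Finite F E] (x : E) :
    powerLattice F x = evalVec x (Module.finrank F E) '' cube F _ := by
  ext y
  constructor
  · rintro ⟨a, rfl⟩
    exact ⟨fun i => (a i : F), mem_cube.2 fun i => (a i).2, rfl⟩
  · rintro ⟨a, ha, rfl⟩
    exact ⟨fun i => ⟨a i, mem_cube.1 ha i⟩, rfl⟩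

theorem etaleHaar_powerLattice_of_not_isNew {x : E} (hx : ¬ IsNew F x) :
    etaleHaar F E (powerLattice F x) = 0 := by
  have := isTopologicalRing_of_isModuleTopology F E
  have := t2Space_of_isModuleTopology F E
  have := secondCountableTopology_of_isModuleTopology F E
  have := locallyCompactSpace_of_isModuleTopology F E
  have h1 := (etaleHaar_spec (F := F) (E := E)).1
  refine measure_mono_null (t := (LinearMap.range (evalVec (R := F) x (Module.finrank F E)) : Set E))
    ?_ (addHaar_submodule_eq_zero (F := F) _ ?_)
  · rw [powerLattice_eq_image]
    exact Set.image_subset_range _ _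
  · rw [Ne, LinearMap.range_eq_top]
    exact fun h => hx ((isNew_iff_surjective_evalVec le_rfl).2 h)

/-- Stated for every `x`, since both sides vanish when `x` is not new. The determinant depends
continuously on `x`, which yields continuity of the volume on all of `E`. -/
theorem IsIntegralBasis.etaleHaar_powerLattice
    {b : Module.Basis (Fin (Module.finrank F E)) F E} (hb : IsIntegralBasis b) (x : E) :
    etaleHaar F E (powerLattice F x) =
      ENNReal.ofReal ‖b.det fun i : Fin (Module.finrank F E) => x ^ (i : ℕ)‖ := by
  by_cases hx : IsNew F x
  · rw [powerLattice_eq_image, hb.etaleHaar_image_evalVec x _ hx, piHaar_cube, mul_one]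
  · rw [etaleHaar_powerLattice_of_not_isNew hx]
    have : b.det (fun i : Fin (Module.finrank F E) => x ^ (i : ℕ)) = 0 := by
      by_contra h
      refine hx ((isNew_iff_surjective_evalVec le_rfl).2 ?_)
      have h2 := (b.is_basis_iff_det).2 (isUnit_iff_ne_zero.2 h)
      intro y
      have hy : y ∈ Submodule.span F (Set.range fun i : Fin (Module.finrank F E) => x ^ (i : ℕ)) := by
        rw [h2.2]; trivial
      obtain ⟨c, hc⟩ := (Submodule.mem_span_range_iff_exists_fun F).1 hy
      exact ⟨c, by rw [evalVec_apply, aeval_vecPoly, hc]⟩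
    rw [this, norm_zero, ENNReal.ofReal_zero]

/-- The volume of the lattice spanned by `1, x, …, x^{r-1}`. -/
noncomputable def latVol (F : Type*) [NontriviallyNormedField F] [IsUltrametricDist F]
    {E : Type*} [CommRing E] [Algebra F E] [Module.Finite F E] [TopologicalSpace E]
    [MeasurableSpace E] (x : E) : ℝ :=
  (etaleHaar F E (powerLattice F x)).toReal

theorem IsIntegralBasis.latVol_eq
    {b : Module.Basis (Fin (Module.finrank F E)) F E} (hb : IsIntegralBasis b) (x : E) :
    latVol F x = ‖b.det fun i : Fin (Module.finrank F E) => x ^ (i : ℕ)‖ := by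
  rw [latVol, hb.etaleHaar_powerLattice, ENNReal.toReal_ofReal (norm_nonneg _)]

theorem continuous_latVol : Continuous (latVol F : E → ℝ) := by
  obtain ⟨b, hb⟩ := exists_isIntegralBasis F E
  have := isTopologicalRing_of_isModuleTopology F E
  simp only [funext fun x : E => hb.latVol_eq x, Module.Basis.det_apply]
  refine continuous_norm.comp (Continuous.matrix_det ?_)
  refine continuous_matrix fun i j => ?_
  simp only [Module.Basis.toMatrix_apply]
  exact (continuous_apply i).comp ((coordHomeo b).symm.continuous.comp (continuous_pow _))

theorem latVol_pos {x : E} (hx : IsNew F x) : 0 < latVol F x := by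
  obtain ⟨b, hb⟩ := exists_isIntegralBasis F E
  rw [hb.latVol_eq, norm_pos_iff]
  have : (fun i : Fin (Module.finrank F E) => x ^ (i : ℕ)) = hx.basis := by
    ext i; rw [hx.basis_apply]
  rw [this]
  exact (b.isUnit_det hx.basis).ne_zero

theorem latVol_eq_zero {x : E} (hx : ¬ IsNew F x) : latVol F x = 0 := by
  rw [latVol, etaleHaar_powerLattice_of_not_isNew hx, ENNReal.toReal_zero]

/-- Passing from an integral basis to the powers of `x` multiplies the discriminant by the square of
the transition determinant, whose norm is the volume of the power lattice. -/
theorem norm_derivative_charPoly_eq {x : E} (hx : IsNew F x) :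
    ‖Algebra.norm F (aeval x (derivative (charPoly F x)))‖ =
      ‖etaleDiscr F E‖ * latVol F x ^ 2 := by
  obtain ⟨b, hb⟩ := exists_isIntegralBasis F E
  rw [← hx.norm_discr_eq, ← hb.discr_eq, hb.latVol_eq]
  have : (fun i : Fin (Module.finrank F E) => x ^ (i : ℕ)) = hx.basis := by
    ext i; rw [hx.basis_apply]
  rw [this, ← b.toMatrix_map_vecMul hx.basis, Algebra.discr_of_matrix_vecMul, norm_mul, norm_pow,
    mul_comm, ← Module.Basis.det_apply, b.toMatrix_map_vecMul hx.basis]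

theorem etaleHaar_image_mul_left (u : E) (hu : Algebra.norm F u ≠ 0) (s : Set E) :
    etaleHaar F E ((u * ·) '' s) = ENNReal.ofReal ‖Algebra.norm F u‖ * etaleHaar F E s := by
  obtain ⟨b, hb⟩ := exists_isIntegralBasis F E
  let f : (Fin (Module.finrank F E) → F) →ₗ[F] (Fin (Module.finrank F E) → F) :=
    b.equivFun.toLinearMap ∘ₗ Algebra.lmul F E u ∘ₗ b.equivFun.symm.toLinearMap
  have hf : LinearMap.det f = Algebra.norm F u := by
    rw [Algebra.norm_apply]
    exact LinearMap.det_conj (Algebra.lmul F E u) b.equivFun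
  rw [hb.etaleHaar_apply, hb.etaleHaar_apply, ← hf,
    ← piHaar_image_linearMap_of_det_ne_zero (hf ▸ hu)]
  congr 1
  ext c
  simp only [Set.mem_preimage, Set.mem_image, f, LinearMap.comp_apply, coordHomeo_apply,
    LinearEquiv.coe_coe]
  constructor
  · rintro ⟨y, hy, h⟩
    refine ⟨b.equivFun y, by simpa using hy, ?_⟩
    rw [LinearEquiv.symm_apply_apply]
    exact (LinearEquiv.eq_symm_apply b.equivFun).1 h
  · rintro ⟨d, hd, h⟩
    refine ⟨_, hd, ?_⟩
    exact (LinearEquiv.eq_symm_apply b.equivFun).2 h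

end Coordinates

/-! ### Continuity of characteristic polynomial, norm and height -/

section Continuity

variable {F : Type*} [NontriviallyNormedField F] {E : Type*} [CommRing E] [Algebra F E]
  [Module.Finite F E]

/-- The coefficients of the characteristic polynomial of `x` are polynomial functions of the
coordinates of `x`. -/
theorem exists_mvPolynomial_coeff_charPoly
    (b : Module.Basis (Fin (Module.finrank F E)) F E) (i : ℕ) :
    ∃ P : MvPolynomial (Fin (Module.finrank F E)) F, ∀ x : E,
      (charPoly F x).coeff i = MvPolynomial.eval (b.equivFun x) P := by
  refine ⟨((Algebra.lmul F E).toLinearMap.polyCharpoly b).coeff i, fun x => ?_⟩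
  have h := LinearMap.polyCharpoly_map_eq_charpoly (Algebra.lmul F E).toLinearMap b x
  have h' := congrArg (fun P => coeff P i) h
  rw [coeff_map] at h'
  exact h'.symm

variable [TopologicalSpace E] [IsModuleTopology F E]

theorem continuous_coeff_charPoly (i : ℕ) : Continuous fun x : E => (charPoly F x).coeff i := by
  obtain ⟨P, hP⟩ := exists_mvPolynomial_coeff_charPoly (Module.finBasis F E) i
  simp only [hP]
  exact (MvPolynomial.continuous_eval P).comp (coordHomeo (Module.finBasis F E)).symm.continuous

theorem continuous_algebraNorm : Continuous (Algebra.norm F : E → F) := by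
  have h : (Algebra.norm F : E → F) = fun x =>
      (-1) ^ Module.finrank F E * (charPoly F x).coeff 0 := by
    ext x
    rw [Algebra.norm_apply, LinearMap.det_eq_sign_charpoly_coeff]
    rfl
  rw [h]
  exact continuous_const.mul (continuous_coeff_charPoly 0)

/-- As a Gauss norm, the height is a maximum of finitely many norms of coefficients of `χ_x`, each a
polynomial function of `x`. -/
theorem continuous_height [IsUltrametricDist F] [CompleteSpace F] [CharZero F] [IsReduced E] :
    Continuous (height F : E → ℝ) := by
  have h : (height F : E → ℝ) = fun x =>
      (Finset.range (Module.finrank F E + 1)).sup' Finset.nonempty_range_add_one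
        fun i => ‖(charPoly F x).coeff i‖ := by
    ext x
    rw [← supNorm_charPoly]
    refine le_antisymm (supNorm_le_iff.2 fun i => ?_)
      (Finset.sup'_le _ _ fun i _ => le_supNorm _ i)
    by_cases hi : i < Module.finrank F E + 1
    · exact Finset.le_sup' (fun i => ‖(charPoly F x).coeff i‖) (Finset.mem_range.2 hi)
    · rw [coeff_eq_zero_of_natDegree_lt (by rw [natDegree_charPoly]; lia), norm_zero]
      exact (norm_nonneg _).trans (Finset.le_sup' (fun i => ‖(charPoly F x).coeff i‖)
        (Finset.mem_range.2 (Nat.succ_pos _)))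
  rw [h]
  exact Continuous.finset_sup'_apply _ fun i _ => (continuous_coeff_charPoly i).norm

end Continuity

/-! ### Vanishing and continuity of the density -/

section Density

variable {F : Type*} [NontriviallyNormedField F] [IsUltrametricDist F]
  {E : Type*} [CommRing E] [Algebra F E]

theorem toPoly_eq_vecPoly {m : ℕ} (a : Fin m → OF F) : toPoly a = vecPoly fun i => (a i : F) := rfl

theorem aeval_toPoly {m : ℕ} (a : Fin m → OF F) (x : E) :
    aeval x (toPoly a) = ∑ i, (a i : F) • x ^ (i : ℕ) := by
  rw [toPoly_eq_vecPoly, aeval_vecPoly]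

variable [Module.Finite F E] [TopologicalSpace E] [IsModuleTopology F E]

theorem continuous_aeval_toPoly (m : ℕ) :
    Continuous fun p : E × (Fin m → OF F) => aeval p.1 (toPoly p.2) := by
  have := isTopologicalRing_of_isModuleTopology F E
  have := IsModuleTopology.toContinuousSMul F E
  simp only [aeval_toPoly]
  fun_prop

variable [ProperSpace F] [MeasurableSpace F] [BorelSpace F]

/-- The mean value of the norm of `Q(x)`, for `Q` integral of degree `< k`. -/
noncomputable def meanNorm (F : Type*) [NontriviallyNormedField F] [IsUltrametricDist F]
    [MeasurableSpace F] {E : Type*} [CommRing E] [Algebra F E] (k : ℕ) (x : E) : ℝ :=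
  ∫ a, ‖Algebra.norm F (aeval x (toPoly a))‖ ∂(coeffMeasure F k)

theorem continuous_meanNorm (k : ℕ) : Continuous (meanNorm F k : E → ℝ) := by
  have := secondCountableTopology_of_isModuleTopology F E
  have := locallyCompactSpace_of_isModuleTopology F E
  have h := continuous_parametric_integral_of_continuous (μ := coeffMeasure F k)
    (f := fun (x : E) (a : Fin k → OF F) => ‖Algebra.norm F (aeval x (toPoly a))‖)
    ((continuous_algebraNorm.comp (continuous_aeval_toPoly k)).norm) isCompact_univ
  simpa only [Measure.restrict_univ] using! h

variable [MeasurableSpace E] [BorelSpace E]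

omit [IsModuleTopology F E] [ProperSpace F] [BorelSpace F] [BorelSpace E] in
theorem density_eq (n : ℕ) (x : E) : density F E n x =
    ‖etaleDiscr F E‖ * latVol F x / height F x ^ (n + 1) *
      meanNorm F (n + 1 - Module.finrank F E) x := rfl

variable [IsNormalized F] [CharZero F] [IsReduced E]

/-- The zero polynomial has value of norm `0`, except when `E = 0`, where the norm is an empty
determinant, equal to `1`. -/
theorem meanNorm_zero (h : 0 < Module.finrank F E) (x : E) : meanNorm F 0 x = 0 := by
  have := Module.nontrivial_of_finrank_pos h
  have h0 : ∀ a : Fin 0 → OF F, toPoly a = 0 := fun a => by simp [toPoly]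
  simp [meanNorm, h0, Algebra.norm_zero]

theorem density_eq_zero (n : ℕ) (x : E) (h : ¬ IsNew F x ∨ n < Module.finrank F E) :
    density F E n x = 0 := by
  rw [density_eq]
  rcases h with h | h
  · rw [latVol_eq_zero h]; simp
  · rw [Nat.sub_eq_zero_of_le h, meanNorm_zero (Nat.zero_lt_of_lt h), mul_zero]

theorem continuous_density (n : ℕ) : Continuous (density F E n) := by
  have h : density F E n = fun x => _ := funext (density_eq n)
  rw [h]
  refine Continuous.mul (Continuous.div₀ (continuous_const.mul continuous_latVol)
    (continuous_height.pow _) fun x => ?_) (continuous_meanNorm _)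
  exact pow_ne_zero _ (zero_lt_one.trans_le (one_le_height x)).ne'

end Density

/-! ### Transformation under homographies -/

section Homography

section Homogeneous

variable {R : Type*} [CommRing R]

/-- The value at `(u, v)` of the homogenization in degree `m - 1` of the polynomial of degree `< m`
with coefficients `a`. -/
def homEval {A : Type*} [CommRing A] [Algebra R A] {m : ℕ} (a : Fin m → R) (u v : A) : A :=
  ∑ i : Fin m, a i • (u ^ (i : ℕ) * v ^ (m - 1 - i))

theorem homEval_mul {A : Type*} [CommRing A] [Algebra R A] {m : ℕ} (a : Fin m → R) (s u v : A) :
    homEval a (s * u) (s * v) = s ^ (m - 1) * homEval a u v := by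
  rw [homEval, homEval, Finset.mul_sum]
  refine Finset.sum_congr rfl fun i _ => ?_
  rw [mul_smul_comm, mul_pow, mul_pow]
  congr 1
  have : m - 1 = (i : ℕ) + (m - 1 - i) := by lia
  conv_rhs => rw [this, pow_add]
  rw [Nat.add_sub_cancel_left]
  ring

theorem homEval_one {A : Type*} [CommRing A] [Algebra R A] {m : ℕ} (a : Fin m → R) (u : A) :
    homEval a u 1 = aeval u (vecPoly a) := by
  simp [homEval, aeval_vecPoly]

theorem map_homEval {A B : Type*} [CommRing A] [Algebra R A] [CommRing B] [Algebra R B]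
    (f : A →ₐ[R] B) {m : ℕ} (a : Fin m → R) (u v : A) :
    f (homEval a u v) = homEval a (f u) (f v) := by
  simp [homEval]

theorem degree_homEval_lt {m : ℕ} (a : Fin m → R) {u v : R[X]} (hu : u.degree ≤ 1)
    (hv : v.degree ≤ 1) : (homEval a u v).degree < m := by
  have : ∀ i : Fin m, (u ^ (i : ℕ) * v ^ (m - 1 - i)).degree < m := fun i => by
    refine (degree_mul_le _ _).trans_lt ?_
    have h1 : (u ^ (i : ℕ)).degree ≤ (i : ℕ) := by
      refine (degree_pow_le _ _).trans ?_
      simpa using nsmul_le_nsmul_right hu (i : ℕ)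
    have h2 : (v ^ (m - 1 - i)).degree ≤ (m - 1 - i : ℕ) := by
      refine (degree_pow_le _ _).trans ?_
      simpa using nsmul_le_nsmul_right hv (m - 1 - i : ℕ)
    refine (add_le_add h1 h2).trans_lt ?_
    rw [← Nat.cast_add]
    exact_mod_cast (by lia)
  refine (degree_sum_le _ _).trans_lt ?_
  exact (Finset.sup_lt_iff (WithBot.bot_lt_coe m)).2
    fun i _ => (degree_smul_le _ _).trans_lt (this i)

/-- The action of a matrix on polynomials of degree `< m`. -/
noncomputable def homogTransform (γ : Matrix (Fin 2) (Fin 2) R) (m : ℕ) :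
    (Fin m → R) →ₗ[R] (Fin m → R) where
  toFun a i := (homEval a (C (γ 0 0) * X + C (γ 0 1)) (C (γ 1 0) * X + C (γ 1 1))).coeff i
  map_add' a b := by ext i; simp [homEval, add_smul, Finset.sum_add_distrib]
  map_smul' c a := by ext i; simp [homEval, mul_smul, Finset.mul_sum]

theorem aeval_homogTransform {A : Type*} [CommRing A] [Algebra R A]
    (γ : Matrix (Fin 2) (Fin 2) R) {m : ℕ} (a : Fin m → R) (x : A) :
    aeval x (vecPoly (homogTransform γ m a)) =
      homEval a (γ 0 0 • x + algebraMap R A (γ 0 1)) (γ 1 0 • x + algebraMap R A (γ 1 1)) := by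
  have h : vecPoly (homogTransform γ m a) =
      homEval a (C (γ 0 0) * X + C (γ 0 1)) (C (γ 1 0) * X + C (γ 1 1)) :=
    vecPoly_coeff (degree_homEval_lt a degree_linear_le degree_linear_le)
  rw [h, map_homEval]
  simp [Algebra.smul_def]

end Homogeneous

variable {F : Type*} [NontriviallyNormedField F] [IsUltrametricDist F]

/-- It is enough to compare values at the infinitely many `t` where the denominator `v` of the
homography of `δ` is nonzero; there one can dehomogenize at `u / v`. -/
theorem homogTransform_homogTransform {γ δ : Matrix (Fin 2) (Fin 2) (OF F)} (h : γ * δ = 1)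
    {m : ℕ} (a : Fin m → OF F) :
    homogTransform δ m (homogTransform γ m a) = a := by
  apply vecPoly_injective
  apply map_injective (algebraMap (OF F) F) Subtype.val_injective
  have h00 : γ 0 0 * δ 0 0 + γ 0 1 * δ 1 0 = 1 := by
    simpa [Matrix.mul_apply] using congrFun (congrFun h 0) 0
  have h01 : γ 0 0 * δ 0 1 + γ 0 1 * δ 1 1 = 0 := by
    simpa [Matrix.mul_apply] using congrFun (congrFun h 0) 1
  have h10 : γ 1 0 * δ 0 0 + γ 1 1 * δ 1 0 = 0 := by
    simpa [Matrix.mul_apply] using congrFun (congrFun h 1) 0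
  have h11 : γ 1 0 * δ 0 1 + γ 1 1 * δ 1 1 = 1 := by
    simpa [Matrix.mul_apply] using congrFun (congrFun h 1) 1
  -- The bottom row of an invertible matrix is not zero.
  have hne : C (δ 1 0 : F) * X + C (δ 1 1 : F) ≠ 0 := by
    intro h0
    have e0 : (δ 1 0 : F) = 0 := by simpa using congrArg (fun P => coeff P 1) h0
    have e1 : (δ 1 1 : F) = 0 := by simpa using congrArg (fun P => coeff P 0) h0
    have e0' : δ 1 0 = 0 := Subtype.ext e0
    have e1' : δ 1 1 = 0 := Subtype.ext e1
    have h' : δ 1 0 * γ 0 1 + δ 1 1 * γ 1 1 = 1 := by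
      simpa [Matrix.mul_apply] using congrFun (congrFun ((_root_.mul_eq_one_comm (a := γ) (b := δ)).1 h) 1) 1
    rw [e0', e1'] at h'
    simp at h'
  refine eq_of_infinite_eval_eq _ _ (Set.Infinite.mono (s := {t : F |
    eval t (C (δ 1 0 : F) * X + C (δ 1 1 : F)) ≠ 0}) ?_ ?_)
  · intro t ht
    change eval t _ = eval t _
    rw [eval_map_algebraMap, eval_map_algebraMap, aeval_homogTransform]
    set v : F := δ 1 0 • t + algebraMap (OF F) F (δ 1 1) with hv
    set u : F := δ 0 0 • t + algebraMap (OF F) F (δ 0 1) with hu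
    have hv0 : v ≠ 0 := by
      rw [hv, Algebra.smul_def]
      simpa using! ht
    have e : homEval (homogTransform γ m a) u v =
        v ^ (m - 1) * homEval (homogTransform γ m a) (u / v) 1 := by
      rw [← homEval_mul, mul_one, mul_div_cancel₀ _ hv0]
    rw [e, homEval_one, aeval_homogTransform, ← homEval_mul, ← homEval_one]
    have c00 := congrArg (algebraMap (OF F) F) h00
    have c01 := congrArg (algebraMap (OF F) F) h01
    have c10 := congrArg (algebraMap (OF F) F) h10
    have c11 := congrArg (algebraMap (OF F) F) h11
    simp only [map_add, map_mul, map_one, map_zero] at c00 c01 c10 c11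
    congr 1
    · rw [Algebra.smul_def, mul_add]
      rw [Algebra.smul_def] at hu hv
      field_simp
      rw [hu, hv]
      linear_combination t * c00 + c01
    · rw [Algebra.smul_def, mul_add]
      rw [Algebra.smul_def] at hu hv
      field_simp
      rw [hu, hv]
      linear_combination t * c10 + c11
  · have := (rootSet_finite (C (δ 1 0 : F) * X + C (δ 1 1 : F)) F).infinite_compl
    refine Set.Infinite.mono (fun t ht => ?_) this
    refine fun h0 => (Set.mem_compl_iff _ _).1 ht ?_
    rw [mem_rootSet]
    exact ⟨hne, by simpa using h0⟩

variable [ProperSpace F] [MeasurableSpace F] [BorelSpace F]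

/-- An automorphism of a compact group preserves its Haar probability measure. -/
theorem measurePreserving_linearEquiv_coeffMeasure {m : ℕ}
    (L : (Fin m → OF F) ≃ₗ[OF F] (Fin m → OF F)) :
    MeasurePreserving L (coeffMeasure F m) (coeffMeasure F m) := by
  have h1 : Continuous L := LinearMap.continuous_on_pi L.toLinearMap
  have h2 : Continuous L.symm := LinearMap.continuous_on_pi L.symm.toLinearMap
  have := L.toAddEquiv.isAddHaarMeasure_map (coeffMeasure F m) h1 h2
  have h3 : IsProbabilityMeasure ((coeffMeasure F m).map L) :=
    Measure.isProbabilityMeasure_map h1.measurable.aemeasurable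
  exact ⟨h1.measurable, Measure.isAddHaarMeasure_eq_of_isProbabilityMeasure _ _⟩

/-- The action of an invertible matrix on polynomials of degree `< m`. -/
noncomputable def homogEquiv (γ : Matrix.GeneralLinearGroup (Fin 2) (OF F)) (m : ℕ) :
    (Fin m → OF F) ≃ₗ[OF F] (Fin m → OF F) :=
  LinearEquiv.ofLinearMap (homogTransform γ.1 m) (homogTransform γ⁻¹.1 m)
    (LinearMap.ext fun a => homogTransform_homogTransform (by simp) a)
    (LinearMap.ext fun a => homogTransform_homogTransform (by simp) a)

variable {E : Type*} [CommRing E] [Algebra F E]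

omit [ProperSpace F] [MeasurableSpace F] [BorelSpace F] in
-- With `y = V / u`, the left side is the homogenization of the polynomial at `(V, u)`, which is the
-- transformed polynomial at `x`. This is the source of the powers of `N(u)` for both the lattice
-- and the mean value.
theorem aeval_mul_pow_eq_aeval_homogEquiv (γ : Matrix.GeneralLinearGroup (Fin 2) (OF F)) (m : ℕ)
    (a : Fin m → OF F) {x y u : E} (hu : u = γ 1 0 • x + algebraMap (OF F) E (γ 1 1))
    (hy : u * y = γ 0 0 • x + algebraMap (OF F) E (γ 0 1)) :
    u ^ (m - 1) * aeval y (toPoly a) = aeval x (toPoly (homogEquiv γ m a)) := by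
  have h : ∀ (b : Fin m → OF F) (z : E), aeval z (toPoly b) = aeval z (vecPoly b) := by
    intro b z
    rw [aeval_toPoly, aeval_vecPoly]
    rfl
  rw [h, h]
  change _ = aeval x (vecPoly (homogTransform γ.1 m a))
  rw [aeval_homogTransform, ← homEval_one, ← homEval_mul, mul_one, hy, hu]

variable [Module.Finite F E] [TopologicalSpace E] [IsModuleTopology F E]
  [MeasurableSpace E] [BorelSpace E] [IsNormalized F] [CharZero F] [IsReduced E]

theorem meanNorm_homography (γ : Matrix.GeneralLinearGroup (Fin 2) (OF F)) (m : ℕ)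
    {x y u : E} (hu : u = γ 1 0 • x + algebraMap (OF F) E (γ 1 1))
    (hy : u * y = γ 0 0 • x + algebraMap (OF F) E (γ 0 1)) :
    ‖Algebra.norm F u‖ ^ (m - 1) * meanNorm F m y = meanNorm F m x := by
  have hc : Continuous fun a : Fin m → OF F => ‖Algebra.norm F (aeval x (toPoly a))‖ :=
    (continuous_algebraNorm.comp ((continuous_aeval_toPoly m).comp
      (continuous_const.prodMk continuous_id))).norm
  rw [meanNorm, meanNorm, ← integral_const_mul,
    ← (measurePreserving_linearEquiv_coeffMeasure (homogEquiv γ m)).map_eq,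
    integral_map (measurePreserving_linearEquiv_coeffMeasure _).measurable.aemeasurable
      hc.aestronglyMeasurable, (measurePreserving_linearEquiv_coeffMeasure (homogEquiv γ m)).map_eq]
  refine integral_congr_ae (Filter.Eventually.of_forall fun a => ?_)
  simp only
  rw [← norm_pow, ← map_pow, ← norm_mul, ← map_mul,
    aeval_mul_pow_eq_aeval_homogEquiv γ m a hu hy]

theorem latVol_homography (γ : Matrix.GeneralLinearGroup (Fin 2) (OF F))
    {x y u : E} (hu : u = γ 1 0 • x + algebraMap (OF F) E (γ 1 1))
    (hy : u * y = γ 0 0 • x + algebraMap (OF F) E (γ 0 1)) (hN : Algebra.norm F u ≠ 0) :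
    ‖Algebra.norm F u‖ ^ (Module.finrank F E - 1) * latVol F y = latVol F x := by
  have h : powerLattice F x = (u ^ (Module.finrank F E - 1) * ·) '' powerLattice F y := by
    rw [powerLattice, powerLattice, ← Set.range_comp,
      ← (homogEquiv γ (Module.finrank F E)).surjective.range_comp]
    congr 1
    ext a
    exact (aeval_mul_pow_eq_aeval_homogEquiv γ _ a hu hy).symm
  rw [latVol, latVol, h, etaleHaar_image_mul_left _ (by rw [map_pow]; exact pow_ne_zero _ hN),
    ENNReal.toReal_mul, map_pow, norm_pow, ENNReal.toReal_ofReal (by positivity)]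

omit [ProperSpace F] [MeasurableSpace F] [BorelSpace F] [TopologicalSpace E] [IsModuleTopology F E]
  [MeasurableSpace E] [BorelSpace E] [IsNormalized F] in
-- In each factor of `E` the pairs `(x, 1)` and `(y u, u)` are exchanged by `γ` and its inverse.
-- Both matrices are integral, so the two pairs have the same maximum norm.
theorem height_homography [CompleteSpace F] (γ : Matrix.GeneralLinearGroup (Fin 2) (OF F))
    {x y u : E} (hu : u = γ 1 0 • x + algebraMap (OF F) E (γ 1 1))
    (hy : u * y = γ 0 0 • x + algebraMap (OF F) E (γ 0 1)) :
    height F y * ‖Algebra.norm F u‖ = height F x := by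
  refine height_mul_norm_eq fun 𝔪 => ?_
  have key : ∀ (a b : OF F) (s t : Factor 𝔪), spectralNorm F (Factor 𝔪)
      (algebraMap F _ a * s + algebraMap F _ b * t) ≤
      max (spectralNorm F (Factor 𝔪) s) (spectralNorm F (Factor 𝔪) t) := by
    intro a b s t
    refine (isNonarchimedean_spectralNorm _ _).trans (max_le_max ?_ ?_)
    · rw [← spectralMulAlgNorm_def, map_mul, spectralMulAlgNorm_def, spectralMulAlgNorm_def,
        spectralNorm_extends]
      exact mul_le_of_le_one_left (spectralNorm_nonneg _) a.2
    · rw [← spectralMulAlgNorm_def, map_mul, spectralMulAlgNorm_def, spectralMulAlgNorm_def,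
        spectralNorm_extends]
      exact mul_le_of_le_one_left (spectralNorm_nonneg _) b.2
  have h1 : spectralNorm F (Factor 𝔪) 1 = 1 := spectralNorm_one
  set X := toFactor F 𝔪 x with hX
  have hU : toFactor F 𝔪 u = algebraMap F _ (γ 1 0 : F) * X + algebraMap F _ (γ 1 1 : F) * 1 := by
    rw [hu, map_add, hX, mul_one, ← AlgHom.commutes (toFactor F 𝔪), ← AlgHom.commutes (toFactor F 𝔪),
      ← map_mul, ← Algebra.smul_def]
    rfl
  have hV : toFactor F 𝔪 (y * u) =
      algebraMap F _ (γ 0 0 : F) * X + algebraMap F _ (γ 0 1 : F) * 1 := by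
    rw [mul_comm, hy, map_add, hX, mul_one, ← AlgHom.commutes (toFactor F 𝔪),
      ← AlgHom.commutes (toFactor F 𝔪), ← map_mul, ← Algebra.smul_def]
    rfl
  set U := toFactor F 𝔪 u
  set V := toFactor F 𝔪 (y * u)
  have hinv : (γ⁻¹).1 * γ.1 = 1 := by simp
  have e : ∀ i j, (γ⁻¹).1 i 0 * γ.1 0 j + (γ⁻¹).1 i 1 * γ.1 1 j = (1 : Matrix _ _ (OF F)) i j := by
    intro i j
    rw [← hinv, Matrix.mul_apply, Fin.sum_univ_two]
  have e' : ∀ i j, algebraMap F (Factor 𝔪) ((γ⁻¹).1 i 0 : F) * algebraMap F _ (γ.1 0 j : F) +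
      algebraMap F _ ((γ⁻¹).1 i 1 : F) * algebraMap F _ (γ.1 1 j : F) =
      algebraMap F _ ((1 : Matrix _ _ (OF F)) i j : F) := by
    intro i j
    rw [← e]
    change _ = algebraMap F (Factor 𝔪) (_ * _ + _ * _)
    rw [map_add, map_mul, map_mul]
  have hX' : X = algebraMap F _ ((γ⁻¹).1 0 0 : F) * V + algebraMap F _ ((γ⁻¹).1 0 1 : F) * U := by
    have a0 := (e' 0 0).trans (by simp : _ = (1 : Factor 𝔪))
    have a1 := (e' 0 1).trans (by simp : _ = (0 : Factor 𝔪))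
    rw [hU, hV]
    linear_combination (-X) * a0 - a1
  have h1' : (1 : Factor 𝔪) =
      algebraMap F _ ((γ⁻¹).1 1 0 : F) * V + algebraMap F _ ((γ⁻¹).1 1 1 : F) * U := by
    have a0 := (e' 1 0).trans (by simp : _ = (0 : Factor 𝔪))
    have a1 := (e' 1 1).trans (by simp : _ = (1 : Factor 𝔪))
    rw [hU, hV]
    linear_combination (-X) * a0 - a1
  have k1 := key (γ 1 0) (γ 1 1) X 1
  have k2 := key (γ 0 0) (γ 0 1) X 1
  have k3 := key ((γ⁻¹).1 0 0) ((γ⁻¹).1 0 1) V U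
  have k4 := key ((γ⁻¹).1 1 0) ((γ⁻¹).1 1 1) V U
  rw [← hU, h1] at k1
  rw [← hV, h1] at k2
  rw [← hX'] at k3
  rw [← h1', h1] at k4
  refine le_antisymm (max_le ?_ ?_) (max_le ?_ ?_)
  · rwa [max_comm]
  · rwa [max_comm]
  · rwa [max_comm]
  · rwa [max_comm]

theorem density_homography (n : ℕ) (γ : Matrix.GeneralLinearGroup (Fin 2) (OF F)) (x : E) (u : Eˣ)
    (hu : (u : E) = γ 1 0 • x + algebraMap (OF F) E (γ 1 1)) :
    density F E n ((γ 0 0 • x + algebraMap (OF F) E (γ 0 1)) * (↑u⁻¹ : E)) =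
      ‖Algebra.norm F (u : E)‖ ^ 2 * density F E n x := by
  set y := (γ 0 0 • x + algebraMap (OF F) E (γ 0 1)) * (↑u⁻¹ : E) with hy
  have hy : (u : E) * y = γ 0 0 • x + algebraMap (OF F) E (γ 0 1) := by
    rw [hy, mul_comm, mul_assoc, Units.inv_mul, mul_one]
  have hN : Algebra.norm F (u : E) ≠ 0 := (u.isUnit.map (Algebra.norm F)).ne_zero
  -- The exponents `r - 1` and `n - r` used below are natural numbers only if `r ≤ n` and `r > 0`;
  -- the cases `n < r` and `E = 0` are treated apart.
  rcases Nat.lt_or_ge n (Module.finrank F E) with hn | hn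
  · rw [density_eq_zero _ _ (Or.inr hn), density_eq_zero _ _ (Or.inr hn), mul_zero]
  rcases subsingleton_or_nontrivial E with hE | hE
  · rw [Subsingleton.elim y x, Subsingleton.elim (u : E) 1, map_one, norm_one, one_pow, one_mul]
  have hr : 0 < Module.finrank F E := Module.finrank_pos
  rw [density_eq, density_eq, ← latVol_homography γ hu hy hN, ← height_homography γ hu hy,
    ← meanNorm_homography γ _ hu hy]
  have h1 : height F y ≠ 0 := (zero_lt_one.trans_le (one_le_height y)).ne'
  have h2 : ‖Algebra.norm F (u : E)‖ ≠ 0 := norm_ne_zero_iff.2 hN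
  obtain ⟨d, hd⟩ : ∃ d, Module.finrank F E = d + 1 := ⟨_, (Nat.succ_pred hr.ne').symm⟩
  obtain ⟨k, hk⟩ : ∃ k, n = d + 1 + k := ⟨_, (Nat.add_sub_cancel' (hd ▸ hn)).symm⟩
  have h3 : n + 1 - Module.finrank F E = k + 1 := by lia
  rw [h3, hd, hk, Nat.add_sub_cancel, Nat.add_sub_cancel]
  -- The powers of `‖N(u)‖` are `-(r-1)` from the lattice, `n + 1` from the height and `-(n-r)` from
  -- the mean value; they add up to `2`.
  field_simp
  ring

end Homography

/-! ### Distribution of the value `P(x)` -/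

section Lattice

variable {F : Type*} [NontriviallyNormedField F] [IsUltrametricDist F]

theorem vecPoly_mem_cube_iff {m : ℕ} {a : Fin m → F} :
    a ∈ cube F (Fin m) ↔ (vecPoly a).supNorm ≤ 1 := by
  rw [mem_cube, supNorm_le_iff]
  constructor
  · intro h i
    rw [coeff_vecPoly]
    split_ifs with hi
    · exact h _
    · simp
  · intro h i
    have := h i
    rwa [coeff_vecPoly_fin] at this

variable [ProperSpace F] [MeasurableSpace F] [BorelSpace F]

theorem piHaar_smul_cube [IsNormalized F] {h : F} (h0 : h ≠ 0) (k : ℕ) :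
    piHaar F (Fin k) {Q | h • Q ∈ cube F (Fin k)} = ENNReal.ofReal (‖h‖⁻¹) ^ k := by
  let f : (Fin k → F) →ₗ[F] (Fin k → F) := h⁻¹ • LinearMap.id
  have hf : LinearMap.det f = h⁻¹ ^ k := by simp [f]
  have h1 : {Q | h • Q ∈ cube F (Fin k)} = f '' cube F (Fin k) := by
    ext Q
    constructor
    · intro hQ
      exact ⟨h • Q, hQ, inv_smul_smul₀ h0 Q⟩
    · rintro ⟨P, hP, rfl⟩
      change h • h⁻¹ • P ∈ cube F (Fin k)
      rwa [smul_inv_smul₀ h0]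
  rw [h1, piHaar_image_linearMap_of_det_ne_zero (by rw [hf]; exact pow_ne_zero _ (inv_ne_zero h0)),
    hf, piHaar_cube, mul_one, norm_pow, norm_inv, ENNReal.ofReal_pow (by positivity)]

open Classical in
/-- The volume of the set of those `Q` for which `R + χ Q` is integral. -/
theorem piHaar_setOf_mulAdd_mem [IsNormalized F] {χ : F[X]} {r k m : ℕ} (hχ : χ.Monic)
    (hr : χ.natDegree = r) (hm : r + k = m) (R : Fin r → F) :
    piHaar F (Fin k) {Q | mulAdd χ r k m (R, Q) ∈ cube F (Fin m)} =
      if ∃ Q, mulAdd χ r k m (R, Q) ∈ cube F (Fin m) then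
        ENNReal.ofReal (χ.supNorm⁻¹) ^ k else 0 := by
  split_ifs with hQ
  · obtain ⟨Q₀, hQ₀⟩ := hQ
    -- A coefficient of maximal norm replaces `χ` by a scalar: by Gauss's lemma `χ * Q` is integral
    -- exactly when `χ.coeff i • Q` is. The set is a translate by `Q₀` of the set of such `Q`.
    obtain ⟨i, hi⟩ := χ.exists_eq_supNorm
    have h0 : χ.coeff i ≠ 0 := by
      rw [← norm_ne_zero_iff, ← hi, Ne, supNorm_eq_zero_iff]
      exact hχ.ne_zero
    rw [hi, ← piHaar_smul_cube h0, ← measure_preimage_add_right _ (-Q₀) {Q | χ.coeff i • Q ∈ cube F (Fin k)}]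
    congr 1
    ext Q
    have h1 : mulAdd χ r k m (R, Q) = mulAdd χ r k m (R, Q₀) + mulAdd χ r k m (0, Q - Q₀) := by
      rw [← map_add]; simp
    have hadd : ∀ a b : Fin m → F, a ∈ cube F (Fin m) →
        (a + b ∈ cube F (Fin m) ↔ b ∈ cube F (Fin m)) := by
      intro a b ha
      simp only [mem_cube] at ha ⊢
      refine ⟨fun h i => ?_, fun h i => add_mem (ha i) (h i)⟩
      simpa using sub_mem (h i) (ha i)
    have hd : χ.degree ≤ r := by rw [← hr]; exact degree_le_natDegree
    rw [Set.mem_ofPred_eq, h1, hadd _ _ hQ₀, vecPoly_mem_cube_iff, vecPoly_mulAdd hd hm, map_zero,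
      zero_add, supNorm_mul, Set.mem_preimage, Set.mem_ofPred_eq, vecPoly_mem_cube_iff, map_smul,
      smul_eq_C_mul, supNorm_mul, supNorm_C, hi, sub_eq_add_neg]
  · have : {Q | mulAdd χ r k m (R, Q) ∈ cube F (Fin m)} = ∅ :=
      Set.eq_empty_of_forall_notMem fun Q h => hQ ⟨Q, h⟩
    rw [this, measure_empty]

variable {E : Type*} [CommRing E] [Algebra F E]

/-- The lattice spanned by `1, x, …, x^{k-1}`. -/
def lattice (F : Type*) [NontriviallyNormedField F] [IsUltrametricDist F] {E : Type*} [CommRing E]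
    [Algebra F E] (k : ℕ) (x : E) : Set E :=
  Set.range fun a : Fin k → OF F => aeval x (toPoly a)

omit [ProperSpace F] [MeasurableSpace F] [BorelSpace F] in
theorem mem_lattice_iff_supNorm {k : ℕ} {x y : E} :
    y ∈ lattice F k x ↔ ∃ P : F[X], P.degree < k ∧ P.supNorm ≤ 1 ∧ aeval x P = y := by
  constructor
  · rintro ⟨a, rfl⟩
    refine ⟨toPoly a, degree_vecPoly_lt _, ?_, rfl⟩
    rw [toPoly_eq_vecPoly, ← vecPoly_mem_cube_iff, mem_cube]
    exact fun i => (a i).2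
  · rintro ⟨P, hd, hP, rfl⟩
    refine ⟨fun i => ⟨P.coeff i, supNorm_le_iff.1 hP i⟩, ?_⟩
    change aeval x (vecPoly fun i : Fin k => P.coeff i) = _
    rw [vecPoly_coeff hd]

variable [Module.Finite F E] [TopologicalSpace E] [IsModuleTopology F E]
  [MeasurableSpace E] [BorelSpace E]

omit [MeasurableSpace F] [BorelSpace F] in
theorem isCompact_lattice (k : ℕ) (x : E) : IsCompact (lattice F k x) :=
  isCompact_range ((continuous_aeval_toPoly k).comp (continuous_const.prodMk continuous_id))

omit [MeasurableSpace F] [BorelSpace F] in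
theorem measurableSet_lattice (k : ℕ) (x : E) : MeasurableSet (lattice F k x) := by
  have := t2Space_of_isModuleTopology F E
  exact (isCompact_lattice k x).measurableSet

variable [IsNormalized F] [CharZero F] [IsReduced E]

omit [ProperSpace F] [MeasurableSpace F] [BorelSpace F] [TopologicalSpace E] [IsModuleTopology F E]
  [MeasurableSpace E] [BorelSpace E] [IsNormalized F] [CharZero F] [IsReduced E] in
theorem IsNew.exists_mulAdd_mem_cube_iff {x : E} (hx : IsNew F x) {k : ℕ}
    (R : Fin (Module.finrank F E) → F) :
    (∃ Q, mulAdd (charPoly F x) (Module.finrank F E) k (Module.finrank F E + k) (R, Q) ∈ cube F _) ↔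
      evalVec x _ R ∈ lattice F (Module.finrank F E + k) x := by
  have hd : (charPoly F x).degree ≤ Module.finrank F E := by
    rw [← natDegree_charPoly (F := F) x]; exact degree_le_natDegree
  rw [mem_lattice_iff_supNorm]
  constructor
  · rintro ⟨Q, hQ⟩
    rw [vecPoly_mem_cube_iff, vecPoly_mulAdd hd rfl] at hQ
    refine ⟨_, ?_, hQ, ?_⟩
    · rw [← vecPoly_mulAdd hd rfl (R, Q)]; exact degree_vecPoly_lt _
    · simp [evalVec_apply, aeval_charPoly]
  · rintro ⟨P, hP, hP1, hPx⟩
    obtain ⟨Q, hQ⟩ : charPoly F x ∣ P - vecPoly R :=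
      hx.charPoly_dvd (by rw [map_sub, hPx, evalVec_apply, sub_self])
    have hQd : Q.degree < k := by
      have hlt : (P - vecPoly R).degree < (Module.finrank F E + k : ℕ) := by
        refine (degree_sub_le _ _).trans_lt (max_lt hP ((degree_vecPoly_lt R).trans_le ?_))
        exact_mod_cast Nat.le_add_right _ _
      rw [hQ, mul_comm, (charPoly_monic x).degree_mul, add_comm, degree_eq_natDegree (charPoly_monic x).ne_zero,
        natDegree_charPoly, Nat.cast_add] at hlt
      exact lt_of_add_lt_add_left hlt
    refine ⟨fun i => Q.coeff i, ?_⟩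
    rw [vecPoly_mem_cube_iff, vecPoly_mulAdd hd rfl]
    simp only [vecPoly_coeff hQd]
    rwa [← hQ, add_sub_cancel]

theorem IsNew.lintegral_evalVec {x : E} (hx : IsNew F x) {f : E → ℝ≥0∞} (hf : Measurable f) :
    ∫⁻ R, f (evalVec x (Module.finrank F E) R) ∂(piHaar F _) =
      (ENNReal.ofReal (latVol F x))⁻¹ * ∫⁻ t, f t ∂(etaleHaar F E) := by
  obtain ⟨b, hb⟩ := exists_isIntegralBasis F E
  have := isTopologicalRing_of_isModuleTopology F E
  have := IsModuleTopology.toContinuousSMul F E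
  have hm : Measurable (evalVec (R := F) x (Module.finrank F E)) :=
    (LinearMap.continuous_on_pi _).measurable
  have hv := latVol_pos hx
  have h : (piHaar F _).map (evalVec x (Module.finrank F E)) =
      (ENNReal.ofReal (latVol F x))⁻¹ • etaleHaar F E := by
    ext s hs
    have h1 := hb.etaleHaar_image_evalVec x ((evalVec x (Module.finrank F E)) ⁻¹' s) hx
    rw [Set.image_preimage_eq _ ((isNew_iff_surjective_evalVec le_rfl).1 hx), ← hb.latVol_eq] at h1
    rw [Measure.map_apply hm hs, Measure.smul_apply, h1, smul_eq_mul, ← mul_assoc,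
      ENNReal.inv_mul_cancel (by simpa using hv) ENNReal.ofReal_ne_top, one_mul]
  rw [← lintegral_map hf hm, h, lintegral_smul_measure, smul_eq_mul]

/-- Write `P = R + χ_x Q`, so that `P(x) = R(x)`. For fixed `R` the admissible `Q` have volume
`H(x)^{-k}` if `R(x)` lies in the lattice and `0` otherwise. Hence `P(x)` is uniformly distributed
on the lattice. -/
theorem IsNew.lintegral_coeffMeasure {x : E} (hx : IsNew F x) (k : ℕ) {f : E → ℝ≥0∞}
    (hf : Measurable f) :
    ∫⁻ a, f (aeval x (toPoly a)) ∂(coeffMeasure F (Module.finrank F E + k)) =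
      ENNReal.ofReal ((height F x)⁻¹) ^ k * (ENNReal.ofReal (latVol F x))⁻¹ *
        ∫⁻ t in lattice F (Module.finrank F E + k) x, f t ∂(etaleHaar F E) := by
  classical
  have := isTopologicalRing_of_isModuleTopology F E
  have := IsModuleTopology.toContinuousSMul F E
  set r := Module.finrank F E with hr
  have hd : (charPoly F x).degree ≤ r := by
    rw [hr, ← natDegree_charPoly (F := F) x]; exact degree_le_natDegree
  have hm : ∀ m, Measurable (evalVec (R := F) x m) := fun m =>
    (LinearMap.continuous_on_pi _).measurable
  have hmp := measurePreserving_mulAdd (k := k) (charPoly_monic (F := F) x) (natDegree_charPoly x) rfl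
  rw [← hr] at hmp
  have hcm := (isOpen_cube (F := F) (ι := Fin (r + k))).measurableSet
  calc ∫⁻ a, f (aeval x (toPoly a)) ∂(coeffMeasure F (r + k))
      = ∫⁻ P in cube F (Fin (r + k)), f (evalVec x (r + k) P) ∂(piHaar F _) := by
        rw [← map_coe_coeffMeasure, lintegral_map (f := fun P => f (evalVec x (r + k) P))
          (hf.comp (hm _)) (isOpenEmbedding_coe_pi (r + k)).continuous.measurable]
        rfl
    _ = ∫⁻ p, (mulAdd (charPoly F x) r k (r + k) ⁻¹' cube F _).indicator
          (fun p => f (evalVec x r p.1)) p ∂((piHaar F (Fin r)).prod (piHaar F (Fin k))) := by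
        rw [← lintegral_indicator hcm, ← hmp.lintegral_comp
          (f := (cube F _).indicator fun P => f (evalVec x (r + k) P))
          ((hf.comp (hm _)).indicator hcm)]
        refine lintegral_congr fun p => ?_
        have h1 : evalVec x (r + k) (mulAdd (charPoly F x) r k (r + k) p) = evalVec x r p.1 := by
          rw [evalVec_apply, vecPoly_mulAdd hd rfl, map_add, map_mul, aeval_charPoly, zero_mul,
            add_zero, evalVec_apply]
        simp only [Set.indicator, Set.mem_preimage, h1]
    _ = ∫⁻ R, ∫⁻ Q, {Q | mulAdd (charPoly F x) r k (r + k) (R, Q) ∈ cube F _}.indicator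
          (fun _ => f (evalVec x r R)) Q ∂(piHaar F (Fin k)) ∂(piHaar F (Fin r)) := by
        rw [lintegral_prod]
        · rfl
        · exact (((hf.comp (hm _)).comp measurable_fst).indicator
            (hmp.measurable hcm)).aemeasurable
    _ = ∫⁻ R, ENNReal.ofReal ((height F x)⁻¹) ^ k *
          (lattice F (r + k) x).indicator f (evalVec x r R) ∂(piHaar F (Fin r)) := by
        refine lintegral_congr fun R => ?_
        have hms : MeasurableSet {Q | mulAdd (charPoly F x) r k (r + k) (R, Q) ∈ cube F _} :=
          (hmp.measurable.comp measurable_prodMk_left) hcm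
        rw [lintegral_indicator_const hms, piHaar_setOf_mulAdd_mem (charPoly_monic x)
          (natDegree_charPoly x) rfl, supNorm_charPoly, hx.exists_mulAdd_mem_cube_iff,
          Set.indicator_apply, mul_comm]
        split_ifs <;> simp
    _ = _ := by
        rw [lintegral_const_mul (f := fun R => (lattice F (r + k) x).indicator f (evalVec x r R))
            _ ((hf.indicator (measurableSet_lattice _ _)).comp (hm _)),
          hx.lintegral_evalVec (hf.indicator (measurableSet_lattice _ _)),
          lintegral_indicator (measurableSet_lattice _ _), mul_assoc]

/-- The previous formula for `f = 1`: the coefficient measure has total mass `1`. -/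
theorem IsNew.etaleHaar_lattice {x : E} (hx : IsNew F x) (k : ℕ) :
    etaleHaar F E (lattice F (Module.finrank F E + k) x) =
      ENNReal.ofReal (height F x ^ k * latVol F x) := by
  have h := hx.lintegral_coeffMeasure k (f := 1) measurable_one
  simp only [Pi.one_apply, lintegral_one, measure_univ, Measure.restrict_apply_univ] at h
  have hh : 0 < height F x := zero_lt_one.trans_le (one_le_height x)
  have hv := latVol_pos hx
  rw [ENNReal.ofReal_mul (by positivity), ENNReal.ofReal_pow hh.le]
  rw [ENNReal.ofReal_inv_of_pos hh, ← ENNReal.inv_pow,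
    ← ENNReal.mul_inv (Or.inr ENNReal.ofReal_ne_top) (Or.inr (by simpa using hv))] at h
  have h2 : (ENNReal.ofReal (height F x) ^ k * ENNReal.ofReal (latVol F x)) ≠ 0 :=
    mul_ne_zero (pow_ne_zero _ (by simpa using hh)) (by simpa using hv)
  have h3 : (ENNReal.ofReal (height F x) ^ k * ENNReal.ofReal (latVol F x)) ≠ ⊤ :=
    ENNReal.mul_ne_top (ENNReal.pow_ne_top ENNReal.ofReal_ne_top) ENNReal.ofReal_ne_top
  have h4 := congrArg (fun t => (ENNReal.ofReal (height F x) ^ k * ENNReal.ofReal (latVol F x)) * t) h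
  simp only [mul_one] at h4
  rw [← mul_assoc, ENNReal.mul_inv_cancel h2 h3, one_mul] at h4
  exact h4.symm

theorem IsNew.meanNorm_eq {x : E} (hx : IsNew F x) (k : ℕ) :
    height F x ^ k * latVol F x * meanNorm F (Module.finrank F E + k) x =
      ∫ t in lattice F (Module.finrank F E + k) x, ‖Algebra.norm F t‖ ∂(etaleHaar F E) := by
  have hh : 0 < height F x := zero_lt_one.trans_le (one_le_height x)
  have hv := latVol_pos hx
  have hc : Continuous fun t : E => ‖Algebra.norm F t‖ := continuous_algebraNorm.norm
  have hc' : Continuous fun a : Fin (Module.finrank F E + k) → OF F =>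
      ‖Algebra.norm F (aeval x (toPoly a))‖ :=
    hc.comp ((continuous_aeval_toPoly _).comp (continuous_const.prodMk continuous_id))
  rw [meanNorm, integral_eq_lintegral_of_nonneg_ae (Filter.Eventually.of_forall fun _ => norm_nonneg _)
    hc.aestronglyMeasurable, integral_eq_lintegral_of_nonneg_ae
    (Filter.Eventually.of_forall fun _ => norm_nonneg _) hc'.aestronglyMeasurable,
    hx.lintegral_coeffMeasure k (f := fun t => ENNReal.ofReal ‖Algebra.norm F t‖)
      hc.measurable.ennreal_ofReal, ENNReal.toReal_mul, ENNReal.toReal_mul, ENNReal.toReal_pow,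
    ENNReal.toReal_ofReal (by positivity), ENNReal.toReal_inv, ENNReal.toReal_ofReal hv.le]
  rw [inv_pow]
  field_simp

end Lattice

/-! ### Ultimate constancy -/

section Constancy

/-- An element of norm `1` in a locally compact field has a power close to `1`. -/
theorem exists_pow_sub_one_norm_lt {K : Type*} [NormedField K] [ProperSpace K] {y : K}
    (hy : ‖y‖ = 1) : ∃ M : ℕ, 0 < M ∧ ‖y ^ M - 1‖ < 1 := by
  -- By compactness two distinct powers of `y` are at distance less than `1`; dividing by the lower
  -- one does not change the norm.
  obtain ⟨z, -, φ, hφ, hz⟩ := tendsto_subseq_of_bounded (x := fun n => y ^ n)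
    (Metric.isBounded_closedBall (x := (0 : K)) (r := 1)) fun n => by simp [hy]
  obtain ⟨N, hN⟩ := Metric.cauchySeq_iff'.1 hz.cauchySeq 1 one_pos
  have h := hN (N + 1) (Nat.le_succ N)
  have hlt := hφ (Nat.lt_succ_self N)
  refine ⟨φ (N + 1) - φ N, Nat.sub_pos_of_lt hlt, ?_⟩
  have e : y ^ φ (N + 1) - y ^ φ N = y ^ φ N * (y ^ (φ (N + 1) - φ N) - 1) := by
    rw [mul_sub, mul_one, ← pow_add, Nat.add_sub_cancel' hlt.le]
  rw [Function.comp_apply, Function.comp_apply, dist_eq_norm, e, norm_mul, norm_pow, hy, one_pow,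
    one_mul] at h
  exact h

theorem norm_pow_sub_one_lt_of_norm_sub_one_lt {K : Type*} [NormedField K] [IsUltrametricDist K]
    {z : K} (h : ‖z - 1‖ < 1) (c : ℕ) : ‖z ^ c - 1‖ < 1 := by
  have hz : ‖z‖ ≤ 1 := by
    have := IsUltrametricDist.norm_add_le_max (z - 1) 1
    rw [sub_add_cancel, norm_one] at this
    exact this.trans (max_le h.le le_rfl)
  induction c with
  | zero => simp
  | succ c ih =>
    have e : z ^ (c + 1) - 1 = z ^ c * (z - 1) + (z ^ c - 1) := by ring
    rw [e]
    refine (IsUltrametricDist.norm_add_le_max _ _).trans_lt (max_lt ?_ ih)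
    rw [norm_mul, norm_pow]
    exact mul_lt_one_of_nonneg_of_lt_one_right (pow_le_one₀ (norm_nonneg _) hz) (norm_nonneg _) h

theorem norm_sub_le_max_norm {K : Type*} [SeminormedAddCommGroup K] [IsUltrametricDist K]
    (y z : K) : ‖y - z‖ ≤ max ‖y‖ ‖z‖ := by
  simpa [sub_eq_add_neg] using IsUltrametricDist.norm_add_le_max y (-z)

/-- One term dominates: `y^{M+e}` if `‖y‖ > 1`, and `1` otherwise. In the second case `y^e (y^M -
1)` has norm less than `1`, thanks to its first factor if `‖y‖ < 1` and to its second one if `‖y‖ =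
1`. -/
theorem norm_trinomial {K : Type*} [NormedField K] [IsUltrametricDist K] {y : K} {M e : ℕ}
    (hM : 0 < M) (he : 0 < e) (h : ‖y‖ = 1 → ‖y ^ M - 1‖ < 1) :
    ‖y ^ (M + e) - y ^ e + 1‖ = max 1 ‖y‖ ^ (M + e) := by
  have e1 : y ^ (M + e) - y ^ e = y ^ e * (y ^ M - 1) := by ring
  rcases lt_or_ge 1 ‖y‖ with h1 | h1
  · have hle : ‖y ^ e - 1‖ ≤ ‖y‖ ^ e := by
      refine (norm_sub_le_max_norm _ _).trans (max_le (norm_pow _ _).le ?_)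
      rw [norm_one]
      exact one_le_pow₀ h1.le
    have hlt : ‖-(y ^ e - 1)‖ < ‖y ^ (M + e)‖ := by
      rw [norm_neg, norm_pow]
      exact hle.trans_lt (pow_lt_pow_right₀ h1 (by lia))
    rw [show y ^ (M + e) - y ^ e + 1 = y ^ (M + e) + -(y ^ e - 1) by ring,
      IsUltrametricDist.norm_add_eq_max_of_norm_ne_norm hlt.ne', max_eq_left hlt.le, norm_pow,
      max_eq_right h1.le]
  · have hlt : ‖y ^ (M + e) - y ^ e‖ < ‖(1 : K)‖ := by
      rw [e1, norm_mul, norm_pow, norm_one]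
      rcases h1.lt_or_eq with h2 | h2
      · refine mul_lt_one_of_nonneg_of_lt_one_left (by positivity)
          (pow_lt_one₀ (norm_nonneg _) h2 he.ne') ?_
        refine (norm_sub_le_max_norm _ _).trans (max_le ?_ norm_one.le)
        rw [norm_pow]
        exact pow_le_one₀ (norm_nonneg _) h1
      · rw [h2, one_pow, one_mul]
        exact h h2
    rw [IsUltrametricDist.norm_add_eq_max_of_norm_ne_norm hlt.ne, max_eq_right hlt.le, norm_one,
      max_eq_left h1, one_pow]

/-- All multiples of `M` are allowed so that one exponent can serve every factor of `E` at once. -/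
theorem exists_spectralNorm_trinomial {F : Type*} [NontriviallyNormedField F] [IsUltrametricDist F]
    [ProperSpace F] {K : Type*} [Field K] [Algebra F K] [FiniteDimensional F K] (y : K) :
    ∃ M : ℕ, 0 < M ∧ ∀ N, 0 < N → M ∣ N → ∀ e, 0 < e →
      spectralNorm F K (y ^ (N + e) - y ^ e + 1) = max 1 (spectralNorm F K y) ^ (N + e) := by
  let _ : NormedField K := spectralNorm.normedField F K
  let _ : NormedAlgebra F K := spectralNorm.normedAlgebra F K
  have : ProperSpace K := FiniteDimensional.proper F K
  have : IsUltrametricDist K :=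
    IsUltrametricDist.isUltrametricDist_of_isNonarchimedean_norm isNonarchimedean_spectralNorm
  have hn : ∀ z : K, spectralNorm F K z = ‖z‖ := fun z => rfl
  simp only [hn]
  by_cases hy : ‖y‖ = 1
  · obtain ⟨M, hM, h⟩ := exists_pow_sub_one_norm_lt hy
    refine ⟨M, hM, fun N hN hMN e he => norm_trinomial hN he fun _ => ?_⟩
    obtain ⟨c, rfl⟩ := hMN
    rw [pow_mul]
    exact norm_pow_sub_one_lt_of_norm_sub_one_lt h c
  · exact ⟨1, one_pos, fun N hN _ e he => norm_trinomial hN he fun h => absurd h hy⟩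

variable {F : Type*} [NontriviallyNormedField F] [IsUltrametricDist F] [ProperSpace F]
  {E : Type*} [CommRing E] [Algebra F E] [Module.Finite F E] [IsReduced E] [CharZero F]

/-- There is `N` such that the trinomials `X ^ (N + e) - X ^ e + 1` take at `x` a value of maximal
norm. -/
theorem exists_norm_trinomial_eq_height (x : E) :
    ∃ N : ℕ, 0 < N ∧ ∀ e, 0 < e →
      ‖Algebra.norm F (x ^ (N + e) - x ^ e + 1)‖ = height F x ^ (N + e) := by
  have := finite_maximalSpectrum F E
  have := Fintype.ofFinite (MaximalSpectrum E)
  choose M hM h using fun 𝔪 : MaximalSpectrum E =>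
    exists_spectralNorm_trinomial (F := F) (toFactor F 𝔪 x)
  have hpos : 0 < ∏ 𝔪, M 𝔪 := Finset.prod_pos fun 𝔪 _ => hM 𝔪
  refine ⟨∏ 𝔪, M 𝔪, hpos, fun e he => ?_⟩
  rw [norm_algebraNorm_eq_prod, height, finprod_eq_prod_of_fintype, ← Finset.prod_pow]
  refine Finset.prod_congr rfl fun 𝔪 _ => ?_
  have h1 := h 𝔪 _ hpos (Finset.dvd_prod_of_mem M (Finset.mem_univ 𝔪)) e he
  have h0 := spectralNorm_nonneg (K := F) (toFactor F 𝔪 x)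
  rw [map_add, map_sub, map_pow, map_pow, map_one, h1]
  rcases le_total (spectralNorm F (Factor 𝔪) (toFactor F 𝔪 x)) 1 with h2 | h2
  · rw [max_eq_left h2, max_eq_left (pow_le_one₀ h0 h2), one_pow, one_pow]
  · rw [max_eq_right h2, max_eq_right (one_le_pow₀ h2), ← pow_mul, ← pow_mul, mul_comm]

variable [TopologicalSpace E] [IsModuleTopology F E] [MeasurableSpace E] [BorelSpace E]
  [MeasurableSpace F] [BorelSpace F] [IsNormalized F]

omit [IsUltrametricDist F] [ProperSpace F] [IsReduced E] [CharZero F] [TopologicalSpace E]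
  [IsModuleTopology F E] [MeasurableSpace E] [BorelSpace E] [MeasurableSpace F] [BorelSpace F]
  [IsNormalized F] in
theorem isUnit_iff_norm_ne_zero {u : E} : IsUnit u ↔ Algebra.norm F u ≠ 0 := by
  refine ⟨fun h => (h.map (Algebra.norm F)).ne_zero, fun h => ?_⟩
  obtain ⟨v, hv⟩ := (LinearMap.equivOfDetNeZero (Algebra.lmul F E u) h).surjective 1
  exact IsUnit.of_mul_eq_one v hv

/-- One factor `‖N(u)‖` comes from the volume, the other from the integrand. -/
theorem setIntegral_norm_image_mul {u : E} (hu : Algebra.norm F u ≠ 0) (s : Set E) :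
    ∫ t in (u * ·) '' s, ‖Algebra.norm F t‖ ∂(etaleHaar F E) =
      ‖Algebra.norm F u‖ ^ 2 * ∫ t in s, ‖Algebra.norm F t‖ ∂(etaleHaar F E) := by
  have := isTopologicalRing_of_isModuleTopology F E
  obtain ⟨v, rfl⟩ := isUnit_iff_norm_ne_zero.2 hu
  let φ : E ≃ₜ E := Homeomorph.smul v
  have hmap : (etaleHaar F E).map φ.symm =
      ENNReal.ofReal ‖Algebra.norm F (v : E)‖ • etaleHaar F E := by
    ext t ht
    rw [φ.symm.measurableEmbedding.map_apply, Measure.smul_apply, smul_eq_mul,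
      ← etaleHaar_image_mul_left _ hu]
    congr 1
    exact (φ.image_eq_preimage_symm t).symm
  have h := φ.symm.measurableEmbedding.setIntegral_map (μ := etaleHaar F E)
    (fun t => ‖Algebra.norm F (φ t)‖) s
  rw [hmap, ← φ.image_eq_preimage_symm] at h
  simp only [Homeomorph.apply_symm_apply] at h
  have h2 : ((v : E) * ·) '' s = φ '' s := rfl
  rw [h2, ← h, Measure.restrict_smul, integral_smul_measure, ENNReal.toReal_ofReal (norm_nonneg _),
    smul_eq_mul, pow_two, mul_assoc]
  congr 1
  rw [← integral_const_mul]
  refine integral_congr_ae (Filter.Eventually.of_forall fun t => ?_)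
  change ‖Algebra.norm F ((v : E) * t)‖ = _
  rw [map_mul, norm_mul]

omit [ProperSpace F] [IsReduced E] [CharZero F] [TopologicalSpace E] [Module.Finite F E]
  [IsModuleTopology F E] [MeasurableSpace E] [BorelSpace E] [MeasurableSpace F] [BorelSpace F]
  [IsNormalized F] in
theorem image_mul_lattice_subset {x : E} {h : F[X]} {d k : ℕ} (hh : h.supNorm ≤ 1)
    (hd : h.natDegree ≤ d) : (aeval x h * ·) '' lattice F k x ⊆ lattice F (k + d) x := by
  rintro _ ⟨y, hy, rfl⟩
  obtain ⟨P, hP, hP1, rfl⟩ := mem_lattice_iff_supNorm.1 hy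
  refine mem_lattice_iff_supNorm.2 ⟨h * P, ?_, ?_, map_mul _ _ _⟩
  · rw [degree_lt_iff_coeff_zero] at hP ⊢
    intro i hi
    rw [coeff_mul]
    refine Finset.sum_eq_zero fun p hp => ?_
    have hp := Finset.HasAntidiagonal.mem_antidiagonal.1 hp
    by_cases h1 : d < p.1
    · rw [coeff_eq_zero_of_natDegree_lt (hd.trans_lt h1), zero_mul]
    · rw [hP _ (by lia), mul_zero]
  · rw [supNorm_mul]
    exact mul_le_one₀ hh (supNorm_nonneg _) hP1

/-- The integral of the norm over the lattice spanned by `1, x, …, x^{k-1}`. -/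
noncomputable def latticeIntegral (F : Type*) [NontriviallyNormedField F] [IsUltrametricDist F]
    {E : Type*} [CommRing E] [Algebra F E] [Module.Finite F E] [TopologicalSpace E]
    [MeasurableSpace E] (k : ℕ) (x : E) : ℝ :=
  ∫ t in lattice F k x, ‖Algebra.norm F t‖ ∂(etaleHaar F E)

/-- Multiplication by `h(x)` sends the first lattice into the second. Its image has volume
multiplied by `H(x)^d`, which is exactly the ratio of the two volumes, so the image is the second
lattice up to a null set. -/
theorem IsNew.latticeIntegral_add_of_norm_eq {x : E} (hx : IsNew F x) {h : F[X]} {d : ℕ}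
    (hh : h.supNorm ≤ 1) (hd : h.natDegree ≤ d)
    (hn : ‖Algebra.norm F (aeval x h)‖ = height F x ^ d) (k : ℕ) :
    latticeIntegral F (Module.finrank F E + k + d) x =
      height F x ^ (2 * d) * latticeIntegral F (Module.finrank F E + k) x := by
  have hH : 0 < height F x := zero_lt_one.trans_le (one_le_height x)
  have hu : Algebra.norm F (aeval x h) ≠ 0 := by
    rw [← norm_ne_zero_iff, hn]
    positivity
  have hvol : etaleHaar F E ((aeval x h * ·) '' lattice F (Module.finrank F E + k) x) =
      etaleHaar F E (lattice F (Module.finrank F E + k + d) x) := by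
    rw [etaleHaar_image_mul_left _ hu, hx.etaleHaar_lattice, add_assoc, hx.etaleHaar_lattice, hn,
      ← ENNReal.ofReal_mul (by positivity)]
    congr 1
    ring
  have hae : (aeval x h * ·) '' lattice F (Module.finrank F E + k) x =ᵐ[etaleHaar F E]
      lattice F (Module.finrank F E + k + d) x := by
    have := isTopologicalRing_of_isModuleTopology F E
    have := t2Space_of_isModuleTopology F E
    refine ae_eq_of_subset_of_measure_ge (image_mul_lattice_subset hh hd) hvol.ge ?_ ?_
    · exact ((isCompact_lattice _ x).image (continuous_const_mul _)).measurableSet.nullMeasurableSet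
    · rw [add_assoc, hx.etaleHaar_lattice]
      exact ENNReal.ofReal_ne_top
  rw [latticeIntegral, ← setIntegral_congr_set hae, setIntegral_norm_image_mul hu, hn, ← pow_mul,
    mul_comm d 2, latticeIntegral]

/-- An integral polynomial of degree `1` with value of maximal norm need not exist. Trinomials of
the consecutive degrees `N + 1` and `N + 2` do, and comparing them isolates a single step. -/
theorem IsNew.latticeIntegral_succ {x : E} (hx : IsNew F x) (k : ℕ) :
    latticeIntegral F (Module.finrank F E + k + 1) x =
      height F x ^ 2 * latticeIntegral F (Module.finrank F E + k) x := by
  have hH : 0 < height F x := zero_lt_one.trans_le (one_le_height x)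
  obtain ⟨N, hN, h⟩ := exists_norm_trinomial_eq_height (F := F) x
  have key : ∀ e, 0 < e → ∀ k, latticeIntegral F (Module.finrank F E + k + (N + e)) x =
      height F x ^ (2 * (N + e)) * latticeIntegral F (Module.finrank F E + k) x := by
    intro e he k
    refine hx.latticeIntegral_add_of_norm_eq (h := X ^ (N + e) - X ^ e + 1) ?_ ?_ ?_ k
    · rw [supNorm_le_iff]
      intro i
      rw [coeff_add, coeff_sub, coeff_X_pow, coeff_X_pow, coeff_one]
      have : ∀ (p : Prop) [Decidable p], (if p then (1 : F) else 0) ∈ OF F := by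
        intro p _
        split_ifs
        · exact one_mem _
        · exact zero_mem _
      exact add_mem (sub_mem (this _) (this _)) (this _)
    · compute_degree!
    · simpa using h e he
  have h1 := key 1 one_pos (k + 1)
  have h2 := key 2 two_pos k
  -- The same lattice is reached from length `r + k` with `e = 2` and from length `r + k + 1` with
  -- `e = 1`.
  rw [show Module.finrank F E + k + (N + 2) = Module.finrank F E + (k + 1) + (N + 1) by ring,
    h1] at h2
  have h3 : height F x ^ (2 * (N + 1)) ≠ 0 := by positivity
  apply mul_left_cancel₀ h3
  rw [add_assoc, h2]
  ring

theorem IsNew.density_eq_latticeIntegral {x : E} (hx : IsNew F x) {n : ℕ}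
    (hn : 2 * Module.finrank F E - 1 ≤ n) :
    density F E n x = ‖etaleDiscr F E‖ / height F x ^ (2 * Module.finrank F E) *
      latticeIntegral F (Module.finrank F E) x := by
  have hH : 0 < height F x := zero_lt_one.trans_le (one_le_height x)
  have hv := latVol_pos hx
  obtain ⟨k, hk⟩ : ∃ k, n + 1 = Module.finrank F E + (Module.finrank F E + k) :=
    ⟨n + 1 - 2 * Module.finrank F E, by lia⟩
  have hL : ∀ k, latticeIntegral F (Module.finrank F E + k) x =
      height F x ^ (2 * k) * latticeIntegral F (Module.finrank F E) x := by
    intro k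
    induction k with
    | zero => simp
    | succ k ih => rw [← add_assoc, hx.latticeIntegral_succ, ih]; ring
  have h1 := hx.meanNorm_eq k
  rw [← latticeIntegral, hL] at h1
  have h2 : meanNorm F (Module.finrank F E + k) x = height F x ^ (2 * k) *
      latticeIntegral F (Module.finrank F E) x / (height F x ^ k * latVol F x) := by
    rw [← h1]; field_simp
  rw [density_eq, hk, Nat.add_sub_cancel_left, h2]
  field_simp
  ring

theorem density_eq_of_le {n : ℕ} (hn : 2 * Module.finrank F E - 1 ≤ n) :
    density F E n = density F E (2 * Module.finrank F E - 1) := by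
  ext x
  by_cases hx : IsNew F x
  · rw [hx.density_eq_latticeIntegral hn, hx.density_eq_latticeIntegral le_rfl]
  · rw [density_eq_zero _ _ (Or.inl hx), density_eq_zero _ _ (Or.inl hx)]

end Constancy

section

open scoped Pointwise in
theorem relIndex_mul_addHaar {V : Type*} [AddCommGroup V] [TopologicalSpace V]
    [IsTopologicalAddGroup V] [MeasurableSpace V] [BorelSpace V] (μ : Measure V)
    [μ.IsAddHaarMeasure] {A B : AddSubgroup V} (hA : IsOpen (A : Set V)) (hB : IsOpen (B : Set V))
    (hBc : IsCompact (B : Set V)) (h : A ≤ B) :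
    ((A.addSubgroupOf B).index : ℝ≥0∞) * μ A = μ B := by
  have hemb : Topology.IsOpenEmbedding (Subtype.val : B → V) := hB.isOpenEmbedding_subtypeVal
  have h1 : (μ.comap (Subtype.val : B → V)).IsAddHaarMeasure :=
    Measure.IsAddHaarMeasure.comap (mH := inferInstance) μ (f := B.subtype) hemb
  have hAo : IsOpen ((A.addSubgroupOf B : AddSubgroup B) : Set B) := hA.preimage hemb.continuous
  have : CompactSpace B := isCompact_iff_compactSpace.1 hBc
  have := AddSubgroup.quotient_finite_of_isOpen (A.addSubgroupOf B) hAo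
  have : (A.addSubgroupOf B).FiniteIndex := AddSubgroup.finiteIndex_of_finite_quotient
  have h2 := AddSubgroup.index_mul_measure (A.addSubgroupOf B) hAo.measurableSet
    (μ.comap (Subtype.val : B → V))
  rw [hemb.measurableEmbedding.comap_apply, hemb.measurableEmbedding.comap_apply] at h2
  have e1 : (Subtype.val : B → V) '' (A.addSubgroupOf B : AddSubgroup B) = A := by
    ext v
    constructor
    · rintro ⟨w, hw, rfl⟩; exact hw
    · intro hv; exact ⟨⟨v, h hv⟩, hv, rfl⟩
  rw [e1, Set.image_univ, Subtype.range_coe_subtype] at h2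
  exact h2

/-! ### The integral of `‖a‖ ^ r` over the ring of integers -/

section ResidueField

variable {F : Type*} [NontriviallyNormedField F] [IsUltrametricDist F] [ProperSpace F]
  [MeasurableSpace F] [BorelSpace F] [IsNormalized F]

open scoped Pointwise in
/-- The uniformizers have norm `1 / q`. -/
theorem exists_norm_eq_inv_resCard (F : Type*) [NontriviallyNormedField F] [IsUltrametricDist F]
    [ProperSpace F] [MeasurableSpace F] [BorelSpace F] [IsNormalized F] :
    ∃ u : Fˣ, ‖(u : F)‖ = (resCard F : ℝ)⁻¹ ∧ {a : F | ‖a‖ < 1} = u • (OF F : Set F) ∧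
      1 < resCard F := by
  obtain ⟨ϖ, hϖ⟩ := IsDiscreteValuationRing.exists_irreducible (OF F)
  have hϖ0 : (ϖ : F) ≠ 0 := fun h => hϖ.ne_zero (Subtype.ext h)
  have hm : {a : F | ‖a‖ < 1} = Units.mk0 (ϖ : F) hϖ0 • (OF F : Set F) := by
    ext a
    constructor
    · intro ha
      have ha1 : ‖a‖ ≤ 1 := le_of_lt ha
      have : (⟨a, ha1⟩ : OF F) ∈ IsLocalRing.maximalIdeal (OF F) := mem_maximalIdeal_OF_iff.2 ha
      rw [hϖ.maximalIdeal_eq, Ideal.mem_span_singleton] at this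
      obtain ⟨c, hc⟩ := this
      exact ⟨c, c.2, (congrArg Subtype.val hc).symm⟩
    · rintro ⟨c, hc, rfl⟩
      have h1 : ‖(ϖ : F)‖ < 1 := by
        rw [← mem_maximalIdeal_OF_iff, hϖ.maximalIdeal_eq]
        exact Ideal.mem_span_singleton_self ϖ
      change ‖(ϖ : F) * c‖ < 1
      rw [norm_mul]
      exact mul_lt_one_of_nonneg_of_lt_one_left (norm_nonneg _) h1 hc
  have hlt : ‖(ϖ : F)‖ < 1 := by
    rw [← mem_maximalIdeal_OF_iff, hϖ.maximalIdeal_eq]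
    exact Ideal.mem_span_singleton_self ϖ
  -- `𝒪_F` is the disjoint union of `q` translates of its maximal ideal, and the latter has volume
  -- `‖ϖ‖`.
  have hind : (resCard F : ℝ≥0∞) * haarF F {a : F | ‖a‖ < 1} = 1 := by
    let A : AddSubgroup F := (IsLocalRing.maximalIdeal (OF F)).toAddSubgroup.map
      (OF F).subtype.toAddMonoidHom
    have hA : (A : Set F) = {a : F | ‖a‖ < 1} := by
      ext a
      constructor
      · rintro ⟨c, hc, rfl⟩
        exact mem_maximalIdeal_OF_iff.1 hc
      · intro ha
        exact ⟨⟨a, mem_OF.2 (le_of_lt ha)⟩, mem_maximalIdeal_OF_iff.2 ha, rfl⟩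
    have hle : A ≤ (OF F).toSubring.toAddSubgroup := by
      rintro _ ⟨c, -, rfl⟩; exact c.2
    have h := relIndex_mul_addHaar (haarF F) (A := A) (B := (OF F).toSubring.toAddSubgroup)
      (by rw [hA]; exact isOpen_lt continuous_norm continuous_const) isOpen_OF isCompact_OF hle
    have hB : haarF F ((OF F).toSubring.toAddSubgroup : Set F) = 1 := haarF_OF
    rw [hB, hA] at h
    rw [← h]
    congr 2
    have : A.addSubgroupOf (OF F).toSubring.toAddSubgroup =
        (IsLocalRing.maximalIdeal (OF F)).toAddSubgroup := by
      ext c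
      constructor
      · rintro ⟨d, hd, hdc⟩
        have : d = c := Subtype.ext hdc
        exact this ▸ hd
      · intro hc
        exact ⟨c, hc, rfl⟩
    rw [this]
    rfl
  rw [hm, haarF_units_smul, haarF_OF, mul_one] at hind
  have hr : (resCard F : ℝ) * ‖(ϖ : F)‖ = 1 := by
    have := congrArg ENNReal.toReal hind
    rwa [ENNReal.toReal_mul, ENNReal.toReal_natCast, ENNReal.toReal_ofReal (norm_nonneg _),
      ENNReal.toReal_one] at this
  refine ⟨_, eq_inv_of_mul_eq_one_right hr, hm, ?_⟩
  by_contra hcon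
  have : (resCard F : ℝ) ≤ 1 := by exact_mod_cast not_lt.1 hcon
  have := mul_lt_one_of_nonneg_of_lt_one_right this (norm_nonneg _) hlt
  exact this.ne hr

open scoped Pointwise in
-- If `I` is the integral, the units contribute `1 - q⁻¹` and the maximal ideal `ϖ 𝒪_F` contributes
-- `q^{-(r+1)} I` by rescaling; one solves for `I`.
theorem setIntegral_norm_pow (r : ℕ) :
    ∫ a in (OF F : Set F), ‖a‖ ^ r ∂(haarF F) =
      ((resCard F : ℝ) ^ (r + 1) - (resCard F : ℝ) ^ r) / ((resCard F : ℝ) ^ (r + 1) - 1) := by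
  obtain ⟨u, hu, hm, hq⟩ := exists_norm_eq_inv_resCard F
  have hc : Continuous fun a : F => ‖a‖ ^ r := continuous_norm.pow r
  have hsub : u • (OF F : Set F) ⊆ (OF F : Set F) := by
    rw [← hm]; exact fun a ha => mem_OF.2 (le_of_lt ha)
  have hmeas : MeasurableSet (u • (OF F : Set F)) := by
    rw [← hm]; exact (isOpen_lt continuous_norm continuous_const).measurableSet
  have hint : IntegrableOn (fun a : F => ‖a‖ ^ r) (OF F) (haarF F) :=
    hc.continuousOn.integrableOn_compact isCompact_OF
  have h1 : ∫ a in u • (OF F : Set F), ‖a‖ ^ r ∂(haarF F) =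
      ‖(u : F)‖ ^ (r + 1) * ∫ a in (OF F : Set F), ‖a‖ ^ r ∂(haarF F) := by
    let φ : F ≃ₜ F := Homeomorph.smul u
    have hmap : (haarF F).map φ.symm = ENNReal.ofReal ‖(u : F)‖ • haarF F := by
      ext t ht
      rw [φ.symm.measurableEmbedding.map_apply, Measure.smul_apply, smul_eq_mul,
        ← haarF_units_smul]
      congr 1
      exact (φ.image_eq_preimage_symm t).symm
    have h := φ.symm.measurableEmbedding.setIntegral_map (μ := haarF F)
      (fun t => ‖φ t‖ ^ r) (OF F : Set F)
    rw [hmap, ← φ.image_eq_preimage_symm] at h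
    simp only [Homeomorph.apply_symm_apply] at h
    have h2 : u • (OF F : Set F) = φ '' (OF F : Set F) := rfl
    rw [h2, ← h, Measure.restrict_smul, integral_smul_measure, ENNReal.toReal_ofReal (norm_nonneg _),
      smul_eq_mul, pow_succ', mul_assoc]
    congr 1
    rw [← integral_const_mul]
    refine integral_congr_ae (Filter.Eventually.of_forall fun t => ?_)
    change ‖(u : F) * t‖ ^ r = _
    rw [norm_mul, mul_pow]
  have h2 : ∫ a in (OF F : Set F) \ u • (OF F : Set F), ‖a‖ ^ r ∂(haarF F) =
      1 - ‖(u : F)‖ := by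
    rw [setIntegral_congr_fun (g := fun _ => (1 : ℝ)) (isOpen_OF.measurableSet.diff hmeas)]
    · rw [setIntegral_const, smul_eq_mul, mul_one, measureReal_sdiff hsub hmeas (by
        rw [haarF_OF]; simp), measureReal_def, measureReal_def, haarF_units_smul,
        haarF_OF, mul_one, ENNReal.toReal_ofReal (norm_nonneg _), ENNReal.toReal_one]
    · intro a ha
      rw [← hm] at ha
      have : ‖a‖ = 1 := le_antisymm ha.1 (not_lt.1 ha.2)
      simp [this]
  have h3 := setIntegral_sdiff hmeas hint hsub
  rw [h2, h1, hu] at h3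
  have hq' : (1 : ℝ) < resCard F := by exact_mod_cast hq
  have hq0 : (0 : ℝ) < resCard F := zero_lt_one.trans hq'
  have hq1 : (resCard F : ℝ) ^ (r + 1) - 1 ≠ 0 := (sub_pos.2 (one_lt_pow₀ hq' (Nat.succ_ne_zero r))).ne'
  rw [eq_div_iff hq1]
  set I := ∫ a in (OF F : Set F), ‖a‖ ^ r ∂(haarF F)
  set q := (resCard F : ℝ)
  have e1 : q ^ (r + 1) * q⁻¹ = q ^ r := by rw [pow_succ]; field_simp
  have e2 : q ^ (r + 1) * q⁻¹ ^ (r + 1) = 1 := by rw [← mul_pow, mul_inv_cancel₀ hq0.ne', one_pow]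
  linear_combination (-q ^ (r + 1)) * h3 - e1 + I * e2

end ResidueField

/-! ### Formulas at integral elements -/

section Integral

variable {F : Type*} [NontriviallyNormedField F] [IsUltrametricDist F] [ProperSpace F]
  {E : Type*} [CommRing E] [Algebra F E]

omit [ProperSpace F] in
theorem aeval_toPoly_eq_aeval_vecPoly {m : ℕ} (a : Fin m → OF F) (x : E) :
    aeval x (toPoly a) = aeval x (vecPoly a) := by
  rw [aeval_toPoly, aeval_vecPoly]
  rfl

variable [Module.Finite F E] [IsReduced E] [CharZero F]

/-- For integral `x` the monic polynomial `χ_x` has coefficients in `𝒪_F`, so division by it over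
`𝒪_F` lowers the degree below `r` without changing the value at `x`. -/
theorem lattice_eq_intAdjoin {x : E} (hx : x ∈ etaleIntegers F E) {k : ℕ}
    (hk : Module.finrank F E ≤ k) : lattice F k x = (intAdjoin F x : Set E) := by
  have hl : charPoly F x ∈ lifts (algebraMap (OF F) F) := by
    rw [lifts_iff_coeff_lifts]
    exact fun i => ⟨⟨_, coeff_charPoly_mem hx i⟩, rfl⟩
  obtain ⟨χ, hχ, hd, hχm⟩ := lifts_and_degree_eq_and_monic hl (charPoly_monic x)
  have hχx : aeval x χ = 0 := by
    rw [← aeval_map_algebraMap F, hχ, aeval_charPoly]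
  have hχd : χ.degree ≤ k := by
    rw [hd, degree_eq_natDegree (charPoly_monic x).ne_zero, natDegree_charPoly]
    exact_mod_cast hk
  ext y
  rw [SetLike.mem_coe, intAdjoin, Algebra.adjoin_singleton_eq_range_aeval]
  constructor
  · rintro ⟨a, rfl⟩
    exact ⟨vecPoly a, (aeval_toPoly_eq_aeval_vecPoly a x).symm⟩
  · rintro ⟨P, rfl⟩
    refine ⟨fun i => (P %ₘ χ).coeff i, ?_⟩
    simp only
    rw [aeval_toPoly_eq_aeval_vecPoly, vecPoly_coeff ((degree_modByMonic_lt P hχm).trans_le hχd)]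
    have := congrArg (aeval x) (modByMonic_add_div P χ)
    simpa [hχx] using this

variable [TopologicalSpace E] [IsModuleTopology F E] [MeasurableSpace E] [BorelSpace E]
  [MeasurableSpace F] [BorelSpace F] [IsNormalized F]

omit [MeasurableSpace F] [BorelSpace F] [IsNormalized F] [MeasurableSpace E] [BorelSpace E]
  [CharZero F] [IsReduced E] in
theorem IsNew.isOpen_lattice {x : E} (hx : IsNew F x) :
    IsOpen (lattice F (Module.finrank F E) x) := by
  have h : lattice F (Module.finrank F E) x = coordHomeo hx.basis '' cube F _ := by
    refine (powerLattice_eq_image x).trans (Set.image_congr fun a _ => ?_)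
    rw [coordHomeo_apply, Module.Basis.equivFun_symm_apply, evalVec_apply, aeval_vecPoly]
    simp only [hx.basis_apply]
  rw [h]
  exact (coordHomeo hx.basis).isOpenMap _ isOpen_cube

theorem latVol_eq_inv_intIndex {x : E} (hx : IsNew F x) (hxi : x ∈ etaleIntegers F E) :
    latVol F x = 1 / (intIndex F x : ℝ) := by
  have := isTopologicalRing_of_isModuleTopology F E
  have h1 := (etaleHaar_spec (F := F) (E := E)).1
  obtain ⟨b, hb⟩ := exists_isIntegralBasis F E
  let A : AddSubgroup E := (Subalgebra.toSubmodule (intAdjoin F x)).toAddSubgroup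
  let B : AddSubgroup E := (Subalgebra.toSubmodule (etaleIntegers F E)).toAddSubgroup
  have hA : (A : Set E) = lattice F (Module.finrank F E) x :=
    (lattice_eq_intAdjoin hxi le_rfl).symm
  have hB : (B : Set E) = coordHomeo b '' cube F _ := hb.image_cube.symm
  have hle : A ≤ B := by
    have : intAdjoin F x ≤ etaleIntegers F E := Algebra.adjoin_le (Set.singleton_subset_iff.2 hxi)
    exact this
  have h := relIndex_mul_addHaar (etaleHaar F E) (A := A) (B := B)
    (by rw [hA]; exact hx.isOpen_lattice)
    (by rw [hB]; exact (coordHomeo b).isOpenMap _ isOpen_cube)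
    (by rw [hB]; exact isCompact_cube.image (coordHomeo b).continuous) hle
  have hB1 : etaleHaar F E (B : Set E) = 1 := (etaleHaar_spec (F := F) (E := E)).2
  rw [hB1, hA] at h
  have h2 : (intIndex F x : ℝ) * latVol F x = 1 := by
    have := congrArg ENNReal.toReal h
    rwa [ENNReal.toReal_mul, ENNReal.toReal_natCast, ENNReal.toReal_one] at this
  rw [eq_div_iff (by rintro h0; rw [h0, zero_mul] at h2; exact zero_ne_one h2), mul_comm]
  exact h2

/-- The polynomials are constants `a`, and `N(a) = a^r`. -/
theorem meanNorm_one (x : E) : meanNorm F 1 x =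
    ((resCard F : ℝ) ^ (Module.finrank F E + 1) - (resCard F : ℝ) ^ Module.finrank F E) /
      ((resCard F : ℝ) ^ (Module.finrank F E + 1) - 1) := by
  rw [← setIntegral_norm_pow, meanNorm, coeffMeasure]
  have h1 := (measurePreserving_funUnique ((haarF F).comap (Subtype.val : OF F → F)) (Fin 1))
  have h2 := integral_subtype_comap (μ := haarF F) isOpen_OF.measurableSet
    fun a : F => ‖a‖ ^ Module.finrank F E
  rw [← h2]
  refine Eq.trans ?_ (h1.integral_comp' fun a : OF F => ‖(a : F)‖ ^ Module.finrank F E)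
  refine integral_congr_ae (Filter.Eventually.of_forall fun a => ?_)
  have : aeval x (toPoly a) = algebraMap F E (a 0 : F) := by
    simp [aeval_toPoly, Algebra.algebraMap_eq_smul_one]
  simp only
  rw [this, Algebra.norm_algebraMap, norm_pow]
  rfl

theorem density_finrank {x : E} (hx : IsNew F x) (hxi : x ∈ etaleIntegers F E) :
    density F E (Module.finrank F E) x = ‖etaleDiscr F E‖ * (1 / (intIndex F x : ℝ)) *
      (((resCard F : ℝ) ^ (Module.finrank F E + 1) - (resCard F : ℝ) ^ Module.finrank F E) /
        ((resCard F : ℝ) ^ (Module.finrank F E + 1) - 1)) := by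
  rw [density_eq, height_eq_one_of_mem hxi, Nat.add_sub_cancel_left, meanNorm_one, one_pow, div_one,
    latVol_eq_inv_intIndex hx hxi]

theorem density_eq_setIntegral {x : E} (hx : IsNew F x) (hxi : x ∈ etaleIntegers F E) {n : ℕ}
    (hn : 2 * Module.finrank F E - 1 ≤ n) :
    density F E n x = ‖etaleDiscr F E‖ *
      ∫ t in (intAdjoin F x : Set E), ‖Algebra.norm F t‖ ∂(etaleHaar F E) := by
  rw [hx.density_eq_latticeIntegral hn, height_eq_one_of_mem hxi, one_pow, div_one,
    latticeIntegral, lattice_eq_intAdjoin hxi le_rfl]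

end Integral

end

/-! ### An area formula in ultrametric spaces -/

section AreaFormula

open Metric Topology
open scoped NNReal

/-- A perturbation of the identity maps small balls of an ultrametric space onto balls. -/
theorem image_closedBall_of_approximatesLinearOn_id {F X : Type*} [NontriviallyNormedField F]
    [NormedAddCommGroup X] [NormedSpace F X] [IsUltrametricDist X] [CompleteSpace X] {Ψ : X → X}
    {a b : X} {ρ σ : ℝ} {c : ℝ≥0} (hc : c < 1)
    (h : ApproximatesLinearOn Ψ (ContinuousLinearMap.id F X) (closedBall a ρ) c)
    (hb : b ∈ closedBall a ρ) (hσ : 0 ≤ σ) (hσρ : σ ≤ ρ) :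
    Ψ '' closedBall b σ = closedBall (Ψ b) σ := by
  have hsub : closedBall b σ ⊆ closedBall a ρ := by
    rw [IsUltrametricDist.closedBall_eq_of_mem hb]
    exact closedBall_subset_closedBall hσρ
  have h' : ∀ x ∈ closedBall b σ, ∀ y ∈ closedBall b σ, ‖Ψ x - Ψ y - (x - y)‖ ≤ c * ‖x - y‖ :=
    fun x hx y hy => h x (hsub hx) y (hsub hy)
  have hbb : b ∈ closedBall b σ := mem_closedBall_self hσ
  have hc1 : (c : ℝ) ≤ 1 := by exact_mod_cast hc.le
  apply Set.Subset.antisymm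
  · rintro _ ⟨x, hx, rfl⟩
    have hx' : ‖x - b‖ ≤ σ := by rwa [← dist_eq_norm]
    rw [mem_closedBall, dist_eq_norm,
      show Ψ x - Ψ b = (Ψ x - Ψ b - (x - b)) + (x - b) by abel]
    refine (IsUltrametricDist.norm_add_le_max _ _).trans (max_le ?_ hx')
    exact (h' x hx b hbb).trans ((mul_le_of_le_one_left (norm_nonneg _) hc1).trans hx')
  · intro z hz
    have hz' : ‖Ψ b - z‖ ≤ σ := by rwa [← dist_eq_norm, dist_comm]
    -- The fixed points of `T` are the solutions of `Ψ x = z`. The ultrametric inequality keeps `T`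
    -- inside the ball with no loss of radius.
    let T : X → X := fun x => x - (Ψ x - z)
    have hT : Set.MapsTo T (closedBall b σ) (closedBall b σ) := by
      intro x hx
      have hx' : ‖x - b‖ ≤ σ := by rwa [← dist_eq_norm]
      rw [mem_closedBall, dist_eq_norm,
        show T x - b = -(Ψ x - Ψ b - (x - b)) + -(Ψ b - z) by simp only [T]; abel]
      refine (IsUltrametricDist.norm_add_le_max _ _).trans (max_le ?_ (by rwa [norm_neg]))
      rw [norm_neg]
      exact (h' x hx b hbb).trans ((mul_le_of_le_one_left (norm_nonneg _) hc1).trans hx')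
    have hTc : ContractingWith c (hT.restrict T (closedBall b σ) (closedBall b σ)) := by
      refine ⟨hc, LipschitzWith.of_dist_le_mul fun x y => ?_⟩
      change dist (T x) (T y) ≤ c * dist (x : X) y
      rw [dist_eq_norm, dist_eq_norm, ← norm_neg,
        show -(T x - T y) = Ψ x - Ψ y - ((x : X) - y) by simp only [T]; abel]
      exact h' x x.2 y y.2
    obtain ⟨y, hy, hfix, -⟩ := hTc.exists_fixedPoint' isClosed_closedBall.isComplete hT hbb
      (edist_ne_top _ _)
    refine ⟨y, hy, ?_⟩
    have : y - (Ψ y - z) = y := hfix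
    exact sub_eq_zero.1 (sub_eq_self.1 this)

theorem injOn_of_approximatesLinearOn_id {F X : Type*} [NontriviallyNormedField F]
    [NormedAddCommGroup X] [NormedSpace F X] {Ψ : X → X} {s : Set X} {c : ℝ≥0} (hc : c < 1)
    (h : ApproximatesLinearOn Ψ (ContinuousLinearMap.id F X) s c) : Set.InjOn Ψ s := by
  intro x hx y hy hxy
  have h1 := h x hx y hy
  rw [hxy, sub_self, zero_sub, norm_neg, ContinuousLinearMap.id_apply] at h1
  by_contra hne
  have h2 : 0 < ‖x - y‖ := norm_pos_iff.2 (sub_ne_zero.2 hne)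
  have h3 : (c : ℝ) < 1 := by exact_mod_cast hc
  nlinarith

variable {F X Y : Type*} [NontriviallyNormedField F]
  [NormedAddCommGroup X] [NormedSpace F X] [IsUltrametricDist X] [ProperSpace X]
  [MeasurableSpace X] [BorelSpace X] (μ : Measure X) [μ.IsAddHaarMeasure]
  [NormedAddCommGroup Y] [NormedSpace F Y] [MeasurableSpace Y] [BorelSpace Y] (ν : Measure Y)
  {Φ : X → Y} {J : X → ℝ≥0∞}

omit [ProperSpace X] [MeasurableSpace X] [BorelSpace X] [MeasurableSpace Y] [BorelSpace Y] in
-- Near `a` the map `A⁻¹ ∘ Φ` is a perturbation of the identity, so it is injective and maps balls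
-- onto balls of the same radius. The centre `b` may vary while the derivative stays the one at `a`;
-- this is what shows that the Jacobian is locally constant.
theorem exists_ball_of_hasStrictFDerivAt [CompleteSpace X] {a : X} (A : X ≃L[F] Y)
    (hA : HasStrictFDerivAt Φ (A : X →L[F] Y) a) :
    ∃ ρ > 0, Set.InjOn Φ (closedBall a ρ) ∧ ∀ b ∈ closedBall a ρ, ∀ σ, 0 < σ → σ ≤ ρ →
      Φ '' closedBall b σ = A '' closedBall (A.symm (Φ b)) σ := by
  have h1 : HasStrictFDerivAt (fun x => A.symm (Φ x)) (ContinuousLinearMap.id F X) a := by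
    have := (A.symm : Y →L[F] X).hasStrictFDerivAt.comp a hA
    rwa [A.coe_symm_comp_coe] at this
  obtain ⟨s, hs, happ⟩ := h1.approximates_deriv_on_nhds (c := 1 / 2) (Or.inr (by positivity))
  obtain ⟨ρ, hρ, hρs⟩ := Metric.nhds_basis_closedBall.mem_iff.1 hs
  have happ' := happ.mono_set hρs
  have hc : (1 / 2 : ℝ≥0) < 1 := by
    rw [← NNReal.coe_lt_coe]; norm_num
  refine ⟨ρ, hρ, ?_, fun b hb σ hσ hσρ => ?_⟩
  · intro x hx y hy hxy
    exact injOn_of_approximatesLinearOn_id hc happ' hx hy (congrArg A.symm hxy)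
  · have := image_closedBall_of_approximatesLinearOn_id hc happ' hb hσ.le hσρ
    rw [← this, ← Set.image_comp]
    exact Set.image_congr fun x _ => (A.apply_symm_apply _).symm

/-- The local form of the area formula. -/
theorem exists_good_ball {W : Set X} (hW : IsOpen W)
    (hΦ : ∀ a ∈ W, ∃ A : X ≃L[F] Y, HasStrictFDerivAt Φ (A : X →L[F] Y) a ∧
      ∀ s, ν (A '' s) = J a * μ s) {a : X} (ha : a ∈ W) :
    ∃ ρ > 0, ∀ σ, 0 < σ → σ ≤ ρ → closedBall a σ ⊆ W ∧ Set.InjOn Φ (closedBall a σ) ∧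
      IsClosed (Φ '' closedBall a σ) ∧ ν (Φ '' closedBall a σ) = ∫⁻ x in closedBall a σ, J x ∂μ := by
  have key : ∀ b ∈ W, ∃ ρ > 0, Set.InjOn Φ (closedBall b ρ) ∧
      ∀ x ∈ closedBall b ρ, ∀ σ, 0 < σ → σ ≤ ρ → IsClosed (Φ '' closedBall x σ) ∧
        ν (Φ '' closedBall x σ) = J b * μ (closedBall x σ) := by
    intro b hb
    obtain ⟨A, hA, hJ⟩ := hΦ b hb
    obtain ⟨ρ, hρ, hinj, him⟩ := exists_ball_of_hasStrictFDerivAt A hA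
    refine ⟨ρ, hρ, hinj, fun x hx σ hσ hσρ => ⟨?_, ?_⟩⟩
    · rw [him x hx σ hσ hσρ]
      exact A.toHomeomorph.isClosedMap _ isClosed_closedBall
    · rw [him x hx σ hσ hσρ, hJ]
      congr 1
      have e : ∀ z : X, μ (closedBall z σ) = μ (closedBall 0 σ) := by
        intro z
        rw [← measure_preimage_add μ z]
        congr 1
        ext y
        simp [dist_eq_norm]
      rw [e, e x]
  obtain ⟨ρ, hρ, hinj, him⟩ := key a ha
  obtain ⟨ρ', hρ', hsub⟩ := Metric.nhds_basis_closedBall.mem_iff.1 (hW.mem_nhds ha)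
  refine ⟨min ρ ρ', lt_min hρ hρ', fun σ hσ hσρ => ?_⟩
  have hσ1 := hσρ.trans (min_le_left _ _)
  have hσ2 := hσρ.trans (min_le_right _ _)
  have hsubW : closedBall a σ ⊆ W := (closedBall_subset_closedBall hσ2).trans hsub
  refine ⟨hsubW, hinj.mono (closedBall_subset_closedBall hσ1),
    (him a (mem_closedBall_self hρ.le) σ hσ hσ1).1, ?_⟩
  rw [(him a (mem_closedBall_self hρ.le) σ hσ hσ1).2]
  -- The volume of the image of a small ball around `b` can be computed from the derivative at `b`
  -- or from the one at `a`.
  have hJ : ∀ b ∈ closedBall a σ, J b = J a := by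
    intro b hb
    obtain ⟨τ, hτ, -, him'⟩ := key b (hsubW hb)
    have h1 := (him' b (mem_closedBall_self hτ.le) (min τ ρ) (lt_min hτ hρ) (min_le_left _ _)).2
    have h2 := (him b (closedBall_subset_closedBall hσ1 hb) (min τ ρ) (lt_min hτ hρ)
      (min_le_right _ _)).2
    rw [h1] at h2
    refine (ENNReal.mul_left_inj ?_ ?_).1 h2
    · exact (measure_closedBall_pos μ b (lt_min hτ hρ)).ne'
    · exact (isCompact_closedBall b _).measure_lt_top.ne
  rw [setLIntegral_congr_fun measurableSet_closedBall hJ, setLIntegral_const]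

/-- An open subset of an ultrametric space is a countable disjoint union of balls which are small
in a given sense. -/
theorem exists_countable_partition_balls {X : Type*} [PseudoMetricSpace X] [IsUltrametricDist X]
    [SecondCountableTopology X] {W : Set X} {good : Set X → Prop}
    (hgood : ∀ a ∈ W, ∃ ρ > 0, ∀ σ, 0 < σ → σ ≤ ρ → closedBall a σ ⊆ W ∧ good (closedBall a σ)) :
    ∃ 𝓑 : Set (Set X), 𝓑.Countable ∧ 𝓑.PairwiseDisjoint id ∧ ⋃₀ 𝓑 = W ∧
      ∀ B ∈ 𝓑, good B ∧ IsOpen B ∧ IsClosed B := by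
  classical
  have hex : ∀ a ∈ W, ∃ k : ℕ, closedBall a ((1 / 2) ^ k) ⊆ W ∧ good (closedBall a ((1 / 2) ^ k)) := by
    intro a ha
    obtain ⟨ρ, hρ, h⟩ := hgood a ha
    obtain ⟨k, hk⟩ := exists_pow_lt_of_lt_one hρ (by norm_num : (1 / 2 : ℝ) < 1)
    exact ⟨k, h _ (by positivity) hk.le⟩
  choose! k₀ hk₀ using hex
  let P : X → ℕ → Prop := fun a k => closedBall a ((1 / 2) ^ k) ⊆ W ∧ good (closedBall a ((1 / 2) ^ k))
  -- Each point receives its largest good ball of radius a power of `1 / 2`. Every point of an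
  -- ultrametric ball is a centre, so all points of that ball receive the same one, and these balls
  -- partition `W`.
  let k : X → ℕ := fun a => sInf {j | P a j}
  have hk : ∀ a ∈ W, P a (k a) := fun a ha => Nat.sInf_mem (s := {j | P a j}) ⟨k₀ a, hk₀ a ha⟩
  have hle : ∀ a j, P a j → k a ≤ j := fun a j h => Nat.sInf_le h
  let B : X → Set X := fun a => closedBall a ((1 / 2) ^ k a)
  have hBmem : ∀ a, a ∈ B a := fun a => mem_closedBall_self (by positivity)
  have hkeq : ∀ a ∈ W, ∀ b ∈ B a, k b ≤ k a := by
    intro a ha b hb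
    have := hk a ha
    refine hle b _ ?_
    change closedBall _ _ ⊆ W ∧ good (closedBall _ _)
    rw [← IsUltrametricDist.closedBall_eq_of_mem hb]
    exact this
  have hBeq : ∀ a ∈ W, ∀ b ∈ B a, B b = B a := by
    intro a ha b hb
    have hbW : b ∈ W := (hk a ha).1 hb
    have h1 := hkeq a ha b hb
    have hab : a ∈ B b := by
      have h3 : a ∈ closedBall b ((1 / 2) ^ k a) := by
        rw [← IsUltrametricDist.closedBall_eq_of_mem hb]
        exact hBmem a
      refine closedBall_subset_closedBall ?_ h3
      exact pow_le_pow_of_le_one (by norm_num) (by norm_num) h1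
    have h2 := hkeq b hbW a hab
    have h3 : k b = k a := le_antisymm h1 h2
    change closedBall b _ = closedBall a _
    rw [h3, ← IsUltrametricDist.closedBall_eq_of_mem hb]
  have hopen : ∀ a, IsOpen (B a) := fun a =>
    IsUltrametricDist.isOpen_closedBall a (by positivity)
  obtain ⟨D, hDc, hDd⟩ := TopologicalSpace.exists_countable_dense X
  refine ⟨B '' W, ?_, ?_, ?_, ?_⟩
  · refine ((hDc.mono Set.inter_subset_right).image B (s := W ∩ D)).mono ?_
    rintro _ ⟨a, ha, rfl⟩
    obtain ⟨d, hd, hdD⟩ := hDd.inter_open_nonempty (B a) (hopen a) ⟨a, hBmem a⟩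
    exact ⟨d, ⟨(hk a ha).1 hd, hdD⟩, hBeq a ha d hd⟩
  · rintro _ ⟨a, ha, rfl⟩ _ ⟨b, hb, rfl⟩ hne
    refine Set.disjoint_left.2 fun x hx hx' => hne ?_
    rw [← hBeq a ha x hx, ← hBeq b hb x hx']
  · apply Set.Subset.antisymm
    · rintro x ⟨_, ⟨a, ha, rfl⟩, hx⟩
      exact (hk a ha).1 hx
    · exact fun x hx => ⟨B x, ⟨x, hx, rfl⟩, hBmem x⟩
  · rintro _ ⟨a, ha, rfl⟩
    exact ⟨(hk a ha).2, hopen a, isClosed_closedBall⟩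

/-- Countable additivity of the counting measure, every subset being declared measurable. -/
theorem encard_sUnion_eq_tsum {α : Type*} {𝓑 : Set (Set α)} (hc : 𝓑.Countable)
    (hd : 𝓑.PairwiseDisjoint id) (s : Set α) (hs : s ⊆ ⋃₀ 𝓑) :
    (s.encard : ℝ≥0∞) = ∑' B : 𝓑, ((s ∩ B : Set α).encard : ℝ≥0∞) := by
  let _ : MeasurableSpace α := ⊤
  have := hc.to_subtype
  have h1 : s = ⋃ B : 𝓑, s ∩ B := by
    rw [← Set.inter_iUnion, ← Set.sUnion_eq_iUnion, Set.inter_eq_left.2 hs]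
  simp only [← Measure.count_apply (MeasurableSpace.measurableSet_top (s := _))]
  conv_lhs => rw [h1]
  refine measure_iUnion ?_ fun _ => MeasurableSpace.measurableSet_top
  intro B C hBC
  exact (hd B.2 C.2 fun h => hBC (Subtype.ext h)).mono Set.inter_subset_right Set.inter_subset_right

/-- The area formula for maps between ultrametric spaces, with an invertible derivative. -/
theorem area_formula {W : Set X} (hW : IsOpen W)
    (hΦ : ∀ a ∈ W, ∃ A : X ≃L[F] Y, HasStrictFDerivAt Φ (A : X →L[F] Y) a ∧
      ∀ s, ν (A '' s) = J a * μ s) :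
    (Measurable fun y => ({x | x ∈ W ∧ Φ x = y}.encard : ℝ≥0∞)) ∧
      ∫⁻ y, ({x | x ∈ W ∧ Φ x = y}.encard : ℝ≥0∞) ∂ν = ∫⁻ x in W, J x ∂μ := by
  classical
  obtain ⟨𝓑, hc, hd, hU, h𝓑⟩ := exists_countable_partition_balls
    (good := fun B => Set.InjOn Φ B ∧ IsClosed (Φ '' B) ∧ ν (Φ '' B) = ∫⁻ x in B, J x ∂μ)
    fun a ha => exists_good_ball μ ν hW hΦ ha
  have := hc.to_subtype
  -- `Φ` is injective on each ball of the partition, so a ball contributes at most one point to a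
  -- fibre.
  have hcount : ∀ y, ({x | x ∈ W ∧ Φ x = y}.encard : ℝ≥0∞) =
      ∑' B : 𝓑, (Φ '' (B : Set X)).indicator (fun _ => (1 : ℝ≥0∞)) y := by
    intro y
    rw [encard_sUnion_eq_tsum hc hd _ (by rw [hU]; exact fun x hx => hx.1)]
    refine tsum_congr fun B => ?_
    have hinj := (h𝓑 B B.2).1.1
    have hBW : (B : Set X) ⊆ W := by rw [← hU]; exact Set.subset_sUnion_of_mem B.2
    by_cases hy : y ∈ Φ '' (B : Set X)
    · obtain ⟨x, hx, rfl⟩ := hy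
      rw [Set.indicator_of_mem (Set.mem_image_of_mem Φ hx)]
      have : {x' | x' ∈ W ∧ Φ x' = Φ x} ∩ (B : Set X) = {x} := by
        ext x'
        constructor
        · rintro ⟨⟨_, h⟩, h'⟩
          exact hinj h' hx h
        · rintro rfl
          exact ⟨⟨hBW hx, rfl⟩, hx⟩
      rw [this]; simp
    · rw [Set.indicator_of_notMem hy]
      have : {x' | x' ∈ W ∧ Φ x' = y} ∩ (B : Set X) = ∅ := by
        ext x'
        simp only [Set.mem_inter_iff, Set.mem_empty_iff_false, iff_false]
        rintro ⟨⟨_, h⟩, h'⟩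
        exact hy ⟨x', h', h⟩
      rw [this]; simp
  have hmeas : ∀ B : 𝓑, Measurable ((Φ '' (B : Set X)).indicator fun _ => (1 : ℝ≥0∞)) := fun B =>
    measurable_const.indicator (h𝓑 B B.2).1.2.1.measurableSet
  simp only [hcount]
  refine ⟨Measurable.tsum hmeas, ?_⟩
  rw [lintegral_tsum fun B => (hmeas B).aemeasurable]
  rw [← hU, Set.sUnion_eq_iUnion, lintegral_iUnion (s := fun B : 𝓑 => (B : Set X))
    (fun B => (h𝓑 B B.2).2.2.measurableSet) fun B C hBC => hd B.2 C.2 fun h => hBC (Subtype.ext h)]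
  refine tsum_congr fun B => ?_
  rw [lintegral_indicator_const (h𝓑 B B.2).1.2.1.measurableSet, one_mul, (h𝓑 B B.2).1.2.2]

end AreaFormula

/-! ### Differentiating polynomial identities -/

section Differentiation

theorem exists_hasStrictFDerivAt_mvPolynomial {F : Type*} [NontriviallyNormedField F] {σ : Type*}
    [Fintype σ] (P : MvPolynomial σ F) (c : σ → F) :
    ∃ D : (σ → F) →L[F] F, HasStrictFDerivAt (fun c => MvPolynomial.eval c P) D c := by
  induction P using MvPolynomial.induction_on with
  | C a => exact ⟨0, by simpa using hasStrictFDerivAt_const a c⟩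
  | add P Q hP hQ =>
    obtain ⟨D, hD⟩ := hP
    obtain ⟨D', hD'⟩ := hQ
    exact ⟨D + D', by simpa using! hD.add hD'⟩
  | mul_X P i hP =>
    obtain ⟨D, hD⟩ := hP
    exact ⟨_, by simpa using! hD.mul (hasStrictFDerivAt_apply i c)⟩

variable {F : Type*} [Field F] [Infinite F] {E : Type*} [CommRing E] [Algebra F E]

/-- `E` may have zero divisors, so roots cannot be counted in `E`. Instead, the coordinates of `q`
in a basis are polynomials over the infinite field `F`. -/
theorem eq_zero_of_eval_algebraMap_eq_zero [Module.Finite F E] {q : E[X]}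
    (hq : ∀ t : F, eval (algebraMap F E t) q = 0) : q = 0 := by
  ext j
  let b := Module.finBasis F E
  refine b.ext_elem fun i => ?_
  let ℓ : F[X] := ∑ j ∈ Finset.range (q.natDegree + 1), monomial j (b.repr (q.coeff j) i)
  have hℓ : ℓ = 0 := by
    refine funext fun t => ?_
    have h1 := congrArg (fun y => b.repr y i) (hq t)
    simp only [eval_eq_sum_range, ← map_pow, mul_comm _ (algebraMap F E _), ← Algebra.smul_def,
      map_sum, map_smul, Finsupp.coe_finsetSum, Finset.sum_apply, Finsupp.smul_apply, smul_eq_mul,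
      map_zero, Finsupp.coe_zero, Pi.zero_apply] at h1
    rw [eval_zero, ← h1, eval_finsetSum]
    exact Finset.sum_congr rfl fun j _ => by rw [eval_monomial, mul_comm]
  have h2 := congrArg (fun P => coeff P j) hℓ
  simp only [ℓ, finsetSum_coeff, coeff_monomial, coeff_zero, Finset.sum_ite_eq',
    Finset.mem_range] at h2
  rw [coeff_zero, map_zero, Finsupp.coe_zero, Pi.zero_apply]
  split_ifs at h2 with h
  · exact h2
  · rw [coeff_eq_zero_of_natDegree_lt (by lia), map_zero]; rfl

/-- Differentiating the relation `∑ pᵢ(t) (x + t y) ^ i = 0` at `t = 0`. -/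
theorem sum_derivative_eval_zero [Module.Finite F E] {x y : E} {d : ℕ} {p : ℕ → F[X]}
    (h : ∀ t : F, ∑ i ∈ Finset.range d, (p i).eval t • (x + t • y) ^ i = 0) :
    ∑ i ∈ Finset.range d, (derivative (p i)).eval 0 • x ^ i +
      (∑ i ∈ Finset.range d, (p i).eval 0 • ((i : E) * x ^ (i - 1))) * y = 0 := by
  -- The relation holds for all `t` in `F`, hence formally in `E[X]`, where it can be differentiated
  -- algebraically.
  let q : E[X] := ∑ i ∈ Finset.range d, (p i).map (algebraMap F E) * (C x + C y * X) ^ i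
  have hq : q = 0 := by
    refine eq_zero_of_eval_algebraMap_eq_zero (F := F) fun t => ?_
    rw [← h t, eval_finsetSum]
    refine Finset.sum_congr rfl fun i _ => ?_
    rw [eval_mul, eval_map_algebraMap, aeval_algebraMap_apply, coe_aeval_eq_eval, Algebra.smul_def]
    rw [eval_pow, eval_add, eval_mul, eval_C, eval_C, eval_X, Algebra.smul_def t, mul_comm y]
  have h1 := congrArg (fun P => eval 0 (derivative P)) hq
  simp only [q, derivative_sum, derivative_mul, derivative_pow, derivative_map, derivative_zero,
    eval_zero, eval_finsetSum, eval_add, eval_mul, eval_pow, eval_C, eval_X, mul_zero, add_zero,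
    Finset.sum_add_distrib] at h1
  rw [← h1, Finset.sum_mul]
  have e : ∀ P : F[X], eval 0 (P.map (algebraMap F E)) = algebraMap F E (P.eval 0) := by
    intro P
    rw [eval_map_algebraMap, ← map_zero (algebraMap F E), aeval_algebraMap_apply, coe_aeval_eq_eval]
  congr 1
  · exact Finset.sum_congr rfl fun i _ => by rw [e, Algebra.smul_def]
  · refine Finset.sum_congr rfl fun i _ => ?_
    rw [e, Algebra.smul_def]
    simp
    ring

end Differentiation

/-! ### The derivative of `x ↦ χ_x` -/

section CharPolyDeriv

variable {F : Type*} [NontriviallyNormedField F] {E : Type*} [CommRing E] [Algebra F E]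
  [Module.Finite F E]

/-- The derivative of the characteristic polynomial of `x` in the direction `y` takes the value
`-χ'(x) y` at `x`. -/
theorem exists_hasStrictFDerivAt_coeff_charPoly
    (b : Module.Basis (Fin (Module.finrank F E)) F E) (c : Fin (Module.finrank F E) → F) :
    ∃ D : (Fin (Module.finrank F E) → F) →L[F] (Fin (Module.finrank F E) → F),
      (∀ i, ∃ Di : (Fin (Module.finrank F E) → F) →L[F] F,
        HasStrictFDerivAt (fun c => (charPoly F (b.equivFun.symm c)).coeff i) Di c ∧
        ∀ h, Di h = (vecPoly (D h)).coeff i) ∧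
      ∀ h, aeval (b.equivFun.symm c) (vecPoly (D h)) =
        -(aeval (b.equivFun.symm c) (derivative (charPoly F (b.equivFun.symm c))) *
          b.equivFun.symm h) := by
  choose p hp using exists_mvPolynomial_coeff_charPoly b
  have hp' : ∀ i c, (charPoly F (b.equivFun.symm c)).coeff i = MvPolynomial.eval c (p i) := by
    intro i c
    rw [hp, LinearEquiv.apply_symm_apply]
  choose D hD using fun i => exists_hasStrictFDerivAt_mvPolynomial (p i) c
  -- The leading coefficient is the constant `1` and higher ones are `0`, so the derivative of `χ`
  -- has degree less than `r` and is described by a vector of length `r`.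
  have hconst : ∀ i, Module.finrank F E ≤ i → D i = 0 := by
    intro i hi
    have h1 : (fun c => MvPolynomial.eval c (p i)) = fun _ => if i = Module.finrank F E then (1 : F) else 0 := by
      ext c
      rw [← hp']
      split_ifs with h
      · have := charPoly_monic (F := F) (b.equivFun.symm c)
        rw [Monic, leadingCoeff, natDegree_charPoly] at this
        rw [← this]
        exact congrArg _ h
      · exact coeff_eq_zero_of_natDegree_lt (by rw [natDegree_charPoly]; lia)
    have h2 := (hD i).hasFDerivAt
    rw [h1] at h2
    exact h2.unique (hasFDerivAt_const _ _)
  let D' : (Fin (Module.finrank F E) → F) →L[F] (Fin (Module.finrank F E) → F) := ContinuousLinearMap.pi fun i : Fin (Module.finrank F E) => D i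
  have hD' : ∀ h (i : ℕ), D i h = (vecPoly (D' h)).coeff i := by
    intro h i
    rw [coeff_vecPoly]
    split_ifs with hi
    · rfl
    · rw [hconst i (not_lt.1 hi)]; rfl
  refine ⟨D', fun i => ⟨D i, ?_, fun h => hD' h i⟩, fun h => ?_⟩
  · simp only [hp']
    exact hD i
  set x := b.equivFun.symm c with hx
  set y := b.equivFun.symm h with hy
  -- The `i`-th coefficient of `χ_{x+ty}`, as a polynomial in `t`.
  let P : ℕ → F[X] := fun i => MvPolynomial.aeval (fun j => C (c j) + C (h j) * X) (p i)
  have hPe : ∀ i t, (P i).eval t = MvPolynomial.eval (c + t • h) (p i) := by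
    intro i t
    change (evalRingHom t) (MvPolynomial.aeval _ (p i)) = _
    rw [MvPolynomial.aeval_def, MvPolynomial.hom_eval₂, MvPolynomial.eval, MvPolynomial.coe_eval₂Hom]
    congr 1
    · ext; simp
    · ext j
      simp
      ring
  have hPd : ∀ i, (derivative (P i)).eval 0 = D i h := by
    intro i
    have h1 := (P i).hasDerivAt 0
    have h2 : HasDerivAt (fun t : F => c + t • h) h 0 := by
      simpa using ((hasDerivAt_id (0 : F)).smul_const h).const_add c
    have h3 : HasFDerivAt (fun c => MvPolynomial.eval c (p i)) (D i) (c + (0 : F) • h) := by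
      simpa using (hD i).hasFDerivAt
    have h4 := h3.comp_hasDerivAt (0 : F) h2
    refine h1.unique ?_
    simpa only [hPe] using! h4
  -- Cayley-Hamilton for `x + t y`, differentiated at `t = 0`.
  have key := sum_derivative_eval_zero (x := x) (y := y) (d := Module.finrank F E + 1) (p := P) fun t => by
    have h1 := aeval_charPoly (F := F) (x + t • y)
    rw [aeval_eq_sum_range, natDegree_charPoly] at h1
    rw [← h1]
    refine Finset.sum_congr rfl fun i _ => ?_
    have : x + t • y = b.equivFun.symm (c + t • h) := by rw [map_add, map_smul]
    rw [hPe, this, hp']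
  have e1 : ∑ i ∈ Finset.range (Module.finrank F E + 1), (derivative (P i)).eval 0 • x ^ i =
      aeval x (vecPoly (D' h)) := by
    rw [aeval_eq_sum_range' (n := Module.finrank F E + 1)]
    · exact Finset.sum_congr rfl fun i _ => by rw [hPd, hD']
    · exact Nat.lt_succ_of_le (natDegree_le_of_degree_le (degree_vecPoly_lt _).le)
  have e2 : ∑ i ∈ Finset.range (Module.finrank F E + 1), (P i).eval 0 • ((i : E) * x ^ (i - 1)) =
      aeval x (derivative (charPoly F x)) := by
    conv_rhs => rw [(charPoly F x).as_sum_range_C_mul_X_pow, natDegree_charPoly, derivative_sum,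
      map_sum]
    refine Finset.sum_congr rfl fun i _ => ?_
    rw [derivative_C_mul_X_pow, map_mul, aeval_C, map_pow, aeval_X, hPe, zero_smul, add_zero,
      ← hp', map_mul, map_natCast, Algebra.smul_def]
    ring
  rw [e1, e2] at key
  exact eq_neg_of_add_eq_zero_left key

end CharPolyDeriv

/-! ### The Jacobian of `(x, Q) ↦ χ_x Q` -/

section Jacobian

variable {F : Type*} [NontriviallyNormedField F] {E : Type*} [CommRing E] [Algebra F E]
  [Module.Finite F E]

/-- The map `(x, Q) ↦ χ_x Q` in coordinates. -/
noncomputable def rootMap (b : Module.Basis (Fin (Module.finrank F E)) F E) (k m : ℕ)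
    (p : (Fin (Module.finrank F E) → F) × (Fin k → F)) : Fin m → F :=
  fun l => (charPoly F (b.equivFun.symm p.1) * vecPoly p.2).coeff l

theorem rootMap_eq_mulAdd (b : Module.Basis (Fin (Module.finrank F E)) F E) (k m : ℕ)
    (p : (Fin (Module.finrank F E) → F) × (Fin k → F)) :
    rootMap b k m p =
      mulAdd (charPoly F (b.equivFun.symm p.1)) (Module.finrank F E) k m (0, p.2) := by
  ext l
  simp [rootMap, mulAdd]

theorem degree_charPoly_le (x : E) : (charPoly F x).degree ≤ Module.finrank F E := by
  rw [← natDegree_charPoly (F := F) x]; exact degree_le_natDegree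

theorem vecPoly_rootMap (b : Module.Basis (Fin (Module.finrank F E)) F E) {k m : ℕ}
    (hm : Module.finrank F E + k = m) (p : (Fin (Module.finrank F E) → F) × (Fin k → F)) :
    vecPoly (rootMap b k m p) = charPoly F (b.equivFun.symm p.1) * vecPoly p.2 := by
  rw [rootMap_eq_mulAdd, vecPoly_mulAdd (degree_charPoly_le _) hm, map_zero, zero_add]

theorem IsNew.mulAdd_injective {x : E} (hx : IsNew F x) {k m : ℕ}
    (hm : Module.finrank F E + k = m) :
    Function.Injective (mulAdd (charPoly F x) (Module.finrank F E) k m) := by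
  rw [← LinearMap.ker_eq_bot, LinearMap.ker_eq_bot']
  rintro ⟨R, Q⟩ h
  have h1 := vecPoly_mulAdd (degree_charPoly_le x) hm (R, Q)
  rw [h, map_zero] at h1
  have h2 : evalVec x (Module.finrank F E) R = 0 := by
    have := congrArg (aeval x) h1
    simpa [aeval_charPoly, evalVec_apply] using this.symm
  have hR : R = 0 := isNew_iff_injective_evalVec.1 hx (h2.trans (map_zero _).symm)
  simp only [hR, map_zero, zero_add] at h1
  have hQ := (mul_eq_zero.1 h1.symm).resolve_left (charPoly_monic x).ne_zero
  have hQ' : Q = 0 := vecPoly_injective (hQ.trans (map_zero _).symm)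
  rw [hR, hQ']
  rfl

/-- The map `(x, Q) ↦ χ_x Q` is differentiable; its derivative is `(y, G) ↦ (D y) Q + χ_x G` where
`(D y)(x) = -χ_x'(x) y`. -/
theorem exists_hasStrictFDerivAt_rootMap (b : Module.Basis (Fin (Module.finrank F E)) F E)
    {k m : ℕ} (hm : Module.finrank F E + k = m)
    (p : (Fin (Module.finrank F E) → F) × (Fin k → F)) [CompleteSpace F] :
    ∃ L : ((Fin (Module.finrank F E) → F) × (Fin k → F)) →L[F] (Fin m → F),
      HasStrictFDerivAt (rootMap b k m) L p ∧
      (∀ G, L (0, G) = mulAdd (charPoly F (b.equivFun.symm p.1)) (Module.finrank F E) k m (0, G)) ∧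
      ∀ y, evalVec (b.equivFun.symm p.1) m (L (y, 0)) =
        -(aeval (b.equivFun.symm p.1) (derivative (charPoly F (b.equivFun.symm p.1))) *
          aeval (b.equivFun.symm p.1) (vecPoly p.2)) * b.equivFun.symm y := by
  obtain ⟨D, hD, hDx⟩ := exists_hasStrictFDerivAt_coeff_charPoly b p.1
  choose Di hDi hDi' using hD
  set x := b.equivFun.symm p.1 with hx
  let L₀ : ((Fin (Module.finrank F E) → F) × (Fin k → F)) →ₗ[F] (Fin m → F) :=
    { toFun := fun q l => (vecPoly (D q.1) * vecPoly p.2 + charPoly F x * vecPoly q.2).coeff l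
      map_add' := fun q q' => by ext l; simp [add_mul, mul_add]; ring
      map_smul' := fun a q => by ext l; simp [mul_add] }
  refine ⟨L₀.toContinuousLinearMap, ?_, fun G => ?_, fun y => ?_⟩
  · rw [hasStrictFDerivAt_pi']
    intro l
    let ℓ : ℕ → (Fin k → F) →L[F] F := fun j => (lcoeff F j ∘ₗ vecPoly).toContinuousLinearMap
    have h1 : (fun q : (Fin (Module.finrank F E) → F) × (Fin k → F) => rootMap b k m q l) =
        fun q => ∑ ij ∈ Finset.HasAntidiagonal.antidiagonal (l : ℕ),
          (charPoly F (b.equivFun.symm q.1)).coeff ij.1 * ℓ ij.2 q.2 := by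
      ext q
      exact coeff_mul _ _ _
    rw [h1]
    have h2 := HasStrictFDerivAt.fun_sum (u := Finset.HasAntidiagonal.antidiagonal (l : ℕ)) (x := p) fun ij _ =>
      ((hDi ij.1).comp p hasStrictFDerivAt_fst).mul
        ((ℓ ij.2).hasStrictFDerivAt.comp p hasStrictFDerivAt_snd)
    refine h2.congr_fderiv ?_
    refine ContinuousLinearMap.ext fun q => ?_
    change _ = (vecPoly (D q.1) * vecPoly p.2 + charPoly F x * vecPoly q.2).coeff l
    rw [coeff_add, coeff_mul, coeff_mul, ← Finset.sum_add_distrib, sum_apply]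
    refine Finset.sum_congr rfl fun ij _ => ?_
    rw [← hDi']
    change _ * (vecPoly q.2).coeff ij.2 + (vecPoly p.2).coeff ij.2 * _ = _
    rw [add_comm, mul_comm]
    rfl
  · ext l
    simp [L₀, mulAdd]
  · have h1 : evalVec x m (L₀ (y, 0)) = aeval x (vecPoly (D y) * vecPoly p.2) := by
      have hlt : (vecPoly (D y) * vecPoly p.2).degree < m := by
        rw [degree_lt_iff_coeff_zero]
        intro i hi
        rw [coeff_mul]
        refine Finset.sum_eq_zero fun ij hij => ?_
        have := Finset.HasAntidiagonal.mem_antidiagonal.1 hij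
        rw [coeff_vecPoly, coeff_vecPoly]
        split_ifs with h h'
        · lia
        · exact mul_zero _
        · exact zero_mul _
        · exact zero_mul _
      rw [evalVec_apply]
      congr 1
      refine Eq.trans ?_ (vecPoly_coeff hlt)
      congr 1
      ext l
      simp [L₀]
    change evalVec x m (L₀ (y, 0)) = _
    rw [h1, map_mul, hDx]
    ring

variable [IsUltrametricDist F] [ProperSpace F] [MeasurableSpace F] [BorelSpace F] [IsNormalized F]
  [CharZero F] [IsReduced E] [TopologicalSpace E] [IsModuleTopology F E] [MeasurableSpace E]
  [BorelSpace E]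

/-- The Jacobian of `(x, Q) ↦ χ_x Q`. -/
theorem IsIntegralBasis.exists_jacobian_rootMap
    {b : Module.Basis (Fin (Module.finrank F E)) F E} (hb : IsIntegralBasis b)
    {k m : ℕ} (hm : Module.finrank F E + k = m)
    (p : (Fin (Module.finrank F E) → F) × (Fin k → F)) (hx : IsNew F (b.equivFun.symm p.1))
    (hQ : Algebra.norm F (aeval (b.equivFun.symm p.1) (vecPoly p.2)) ≠ 0) :
    ∃ A : ((Fin (Module.finrank F E) → F) × (Fin k → F)) ≃L[F] (Fin m → F),
      HasStrictFDerivAt (rootMap b k m)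
        (A : ((Fin (Module.finrank F E) → F) × (Fin k → F)) →L[F] (Fin m → F)) p ∧
      ∀ s, piHaar F (Fin m) (A '' s) =
        ENNReal.ofReal (‖etaleDiscr F E‖ * latVol F (b.equivFun.symm p.1) *
          ‖Algebra.norm F (aeval (b.equivFun.symm p.1) (vecPoly p.2))‖) *
        ((piHaar F (Fin (Module.finrank F E))).prod (piHaar F (Fin k))) s := by
  obtain ⟨L, hL, hL0, hLx⟩ := exists_hasStrictFDerivAt_rootMap b hm p
  set x := b.equivFun.symm p.1 with hxdef
  set u := -(aeval x (derivative (charPoly F x)) * aeval x (vecPoly p.2)) with hu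
  have hv := latVol_pos hx
  have hNu : ‖Algebra.norm F u‖ = ‖etaleDiscr F E‖ * latVol F x ^ 2 *
      ‖Algebra.norm F (aeval x (vecPoly p.2))‖ := by
    rw [hu, ← neg_one_mul, map_mul, map_mul, norm_mul, norm_mul, norm_derivative_charPoly_eq hx]
    have : ‖Algebra.norm F (-1 : E)‖ = 1 := by
      rw [show (-1 : E) = algebraMap F E (-1) by simp, Algebra.norm_algebraMap, norm_pow, norm_neg,
        norm_one, one_pow]
    rw [this, one_mul]
  have hu0 : Algebra.norm F u ≠ 0 := by
    rw [hu, ← isUnit_iff_norm_ne_zero, IsUnit.neg_iff]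
    refine IsUnit.mul ?_ (isUnit_iff_norm_ne_zero.2 hQ)
    obtain ⟨P, R, hPR⟩ := hx.separable_charPoly
    refine IsUnit.of_mul_eq_one_right (aeval x R) ?_
    have := congrArg (aeval x) hPR
    simpa [aeval_charPoly] using this
  have hunit : IsUnit u := isUnit_iff_norm_ne_zero.2 hu0
  have hrank : Module.finrank F ((Fin (Module.finrank F E) → F) × (Fin k → F)) =
      Module.finrank F (Fin m → F) := by simp [hm]
  let M := LinearEquiv.ofInjectiveOfFinrankEq _ (hx.mulAdd_injective hm) hrank
  have hM : ∀ q, M q = mulAdd (charPoly F x) (Module.finrank F E) k m q := fun q => rfl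
  -- `ρ y` and `τ y` are the remainder and the quotient of the derivative in direction `y` on
  -- division by `χ_x`. Thus the derivative is the volume-preserving `M` composed with `(y, G) ↦ (ρ
  -- y, G + τ y)`, and its Jacobian is `‖det ρ‖`.
  let ρ : (Fin (Module.finrank F E) → F) →ₗ[F] (Fin (Module.finrank F E) → F) :=
    LinearMap.fst F _ _ ∘ₗ M.symm.toLinearMap ∘ₗ L.toLinearMap ∘ₗ LinearMap.inl F _ _
  let τ : (Fin (Module.finrank F E) → F) →ₗ[F] (Fin k → F) :=
    LinearMap.snd F _ _ ∘ₗ M.symm.toLinearMap ∘ₗ L.toLinearMap ∘ₗ LinearMap.inl F _ _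
  have hLρ : ∀ q, L q = mulAdd (charPoly F x) (Module.finrank F E) k m (ρ q.1, q.2 + τ q.1) := by
    rintro ⟨y, G⟩
    have h1 : L (y, G) = L (y, 0) + L (0, G) := by rw [← map_add]; simp
    have h2 : L (y, 0) = M (ρ y, τ y) := (M.apply_symm_apply (L (y, 0))).symm
    rw [h1, h2, hL0, hM, ← map_add]
    simp [add_comm]
  have hρx : ∀ y, evalVec x (Module.finrank F E) (ρ y) = u * b.equivFun.symm y := by
    intro y
    rw [← hLx, hLρ, evalVec_apply, evalVec_apply, vecPoly_mulAdd (degree_charPoly_le x) hm, map_add,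
      map_mul, aeval_charPoly, zero_mul, add_zero]
  have hρinj : Function.Injective ρ := by
    intro y y' h
    have h1 := hρx y
    rw [h, hρx] at h1
    exact b.equivFun.symm.injective (hunit.mul_left_cancel h1).symm
  have hdet0 : LinearMap.det ρ ≠ 0 := fun h =>
    (LinearMap.bot_lt_ker_of_det_eq_zero h).ne' (LinearMap.ker_eq_bot.2 hρinj)
  -- Evaluation at `x`, which scales volumes by `latVol F x`, turns `ρ` into multiplication by `u`.
  -- Comparing the volumes of the image of the cube gives `latVol F x * ‖det ρ‖ = ‖N(u)‖`, so one of
  -- the two factors `latVol F x` in `hNu` cancels.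
  have hdet : ‖LinearMap.det ρ‖ = ‖etaleDiscr F E‖ * latVol F x *
      ‖Algebra.norm F (aeval x (vecPoly p.2))‖ := by
    have h1 := hb.etaleHaar_image_evalVec x (ρ '' cube F _) hx
    rw [piHaar_image_linearMap_of_det_ne_zero hdet0, piHaar_cube, mul_one, ← hb.latVol_eq] at h1
    have h2 : evalVec x (Module.finrank F E) '' (ρ '' cube F _) =
        (u * ·) '' (etaleIntegers F E : Set E) := by
      rw [← hb.image_cube, ← Set.image_comp, ← Set.image_comp]
      exact Set.image_congr fun y _ => hρx y
    rw [h2, etaleHaar_image_mul_left u hu0, (etaleHaar_spec (F := F) (E := E)).2, mul_one,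
      ← ENNReal.ofReal_mul hv.le, ENNReal.ofReal_eq_ofReal_iff (norm_nonneg _) (by positivity),
      hNu] at h1
    apply mul_left_cancel₀ hv.ne'
    rw [← h1]
    ring
  have hLinj : Function.Injective L := by
    intro q q' h
    rw [hLρ, hLρ] at h
    have h1 := hx.mulAdd_injective hm h
    simp only [Prod.mk.injEq] at h1
    have h2 := hρinj h1.1
    refine Prod.ext h2 ?_
    have h3 := h1.2
    rw [h2] at h3
    exact add_right_cancel h3
  let A := (LinearEquiv.ofInjectiveOfFinrankEq L.toLinearMap hLinj hrank).toContinuousLinearEquiv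
  have hA : (A : _ →L[F] _) = L :=
    ContinuousLinearMap.ext fun q => rfl
  refine ⟨A, by rw [hA]; exact hL, fun s => ?_⟩
  rw [← hdet]
  set π := piHaar F (Fin (Module.finrank F E))
  set π' := piHaar F (Fin k)
  have hτ : Continuous τ := LinearMap.continuous_on_pi τ
  have hρmp : MeasurePreserving ρ π (ENNReal.ofReal ‖(LinearMap.det ρ)⁻¹‖ • π) :=
    ⟨(LinearMap.continuous_on_pi ρ).measurable, map_linearMap_piHaar hdet0⟩
  have hS := hρmp.skew_product (μc := π') (μd := π') (g := fun y G => G + τ y) (by fun_prop)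
    (Filter.Eventually.of_forall fun y => map_add_right_eq_self _ _)
  rw [Measure.prod_smul_left] at hS
  have hmp := measurePreserving_mulAdd (k := k) (charPoly_monic (F := F) x) (natDegree_charPoly x) hm
  have hmap : (π.prod π').map A = ENNReal.ofReal ‖(LinearMap.det ρ)⁻¹‖ • piHaar F (Fin m) := by
    have h1 : ⇑A = mulAdd (charPoly F x) (Module.finrank F E) k m ∘
        fun q => (ρ q.1, q.2 + τ q.1) := by
      ext1 q; exact hLρ q
    rw [h1, ← Measure.map_map hmp.measurable hS.measurable, hS.map_eq, Measure.map_smul, hmp.map_eq]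
  have h3 := A.toHomeomorph.measurableEmbedding.map_apply (π.prod π') (A '' s)
  have h4 : A.toHomeomorph ⁻¹' (A '' s) = s := Set.preimage_image_eq _ A.injective
  rw [h4] at h3
  rw [← h3]
  change _ = _ * ((π.prod π').map A) (A '' s)
  rw [hmap, Measure.smul_apply, smul_eq_mul, ← mul_assoc, ← ENNReal.ofReal_mul (norm_nonneg _),
    ← norm_mul, mul_inv_cancel₀ hdet0, norm_one, ENNReal.ofReal_one, one_mul]

end Jacobian

/-! ### Polynomials with a degenerate root form a null set -/

section CriticalValues

variable {F : Type*} [NontriviallyNormedField F] [IsUltrametricDist F] {E : Type*} [CommRing E]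
  [Algebra F E] [Module.Finite F E]

theorem continuous_aeval_vecPoly [TopologicalSpace E] [IsModuleTopology F E] (m : ℕ) :
    Continuous fun p : (Fin m → F) × E => aeval p.2 (vecPoly p.1) := by
  have := isTopologicalRing_of_isModuleTopology F E
  have := IsModuleTopology.toContinuousSMul F E
  simp only [aeval_vecPoly]
  fun_prop

theorem derivative_vecPoly (m : ℕ) (a : Fin m → F) (x : E) :
    aeval x (derivative (vecPoly a)) = ∑ i : Fin m, a i • ((i : ℕ) • x ^ ((i : ℕ) - 1)) := by
  rw [vecPoly_apply, derivative_sum, map_sum]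
  refine Finset.sum_congr rfl fun i _ => ?_
  rw [derivative_monomial, aeval_monomial, Algebra.smul_def, map_mul, map_natCast, nsmul_eq_mul]
  ring

/-- The polynomials of degree `< m` with a root `x` such that `P'(x)` is not invertible. -/
def criticalValues (F E : Type*) [Field F] [CommRing E] [Algebra F E] (m : ℕ) : Set (Fin m → F) :=
  {a | ∃ x : E, aeval x (vecPoly a) = 0 ∧ Algebra.norm F (aeval x (derivative (vecPoly a))) = 0}

/-- The set is the projection of a closed subset of `F^m × E`. As `E` is not compact in general the
projection need not be closed, but it is σ-compact. -/
theorem measurableSet_criticalValues [ProperSpace F] [MeasurableSpace F] [BorelSpace F]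
    [TopologicalSpace E] [IsModuleTopology F E] (m : ℕ) :
    MeasurableSet (criticalValues F E m) := by
  have := isTopologicalRing_of_isModuleTopology F E
  have := IsModuleTopology.toContinuousSMul F E
  have := t2Space_of_isModuleTopology F E
  have := secondCountableTopology_of_isModuleTopology F E
  have := locallyCompactSpace_of_isModuleTopology F E
  let C : Set ((Fin m → F) × E) := {p | aeval p.2 (vecPoly p.1) = 0 ∧
    Algebra.norm F (aeval p.2 (derivative (vecPoly p.1))) = 0}
  have hC : IsClosed C := by
    refine (isClosed_eq (continuous_aeval_vecPoly m) continuous_const).inter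
      (isClosed_eq (continuous_algebraNorm.comp ?_) continuous_const)
    simp only [derivative_vecPoly]
    fun_prop
  have h : criticalValues F E m = Prod.fst '' C := by
    ext a
    constructor
    · rintro ⟨x, hx⟩
      exact ⟨(a, x), hx, rfl⟩
    · rintro ⟨⟨a, x⟩, hx, rfl⟩
      exact ⟨x, hx⟩
  rw [h]
  have hσ : IsSigmaCompact (Prod.fst '' C) := (isSigmaCompact_univ.of_isClosed_subset hC (Set.subset_univ _)).image continuous_fst
  obtain ⟨K, hK, hU⟩ := hσ
  rw [← hU]
  exact MeasurableSet.iUnion fun i => (hK i).measurableSet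

/-- Write `P = t + R` with `R` nonconstant without constant term. If `P'(x) = R'(x)` is not
invertible, some component `z` of `x` is a root of `R' ≠ 0`, and then `t = -R(z)`. This leaves
finitely many `z`, hence finitely many `t`. -/
theorem finite_setOf_criticalValues_cons [CharZero F] [IsReduced E] {n : ℕ} {v : Fin n → F}
    (hv : v ≠ 0) : {t : F | Fin.cons t v ∈ criticalValues F E (n + 1)}.Finite := by
  have := finite_maximalSpectrum F E
  have := Fintype.ofFinite (MaximalSpectrum E)
  have hvp : ∀ t : F, vecPoly (Fin.cons t v : Fin (n + 1) → F) = C t + X * vecPoly v := by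
    intro t
    rw [vecPoly_apply, Fin.sum_univ_succ, vecPoly_apply, Finset.mul_sum]
    congr 1
    refine Finset.sum_congr rfl fun i _ => ?_
    rw [Fin.cons_succ, X_mul_monomial, Fin.val_succ]
  set R := X * vecPoly v with hR
  have hR0 : derivative R ≠ 0 := by
    intro h
    have h1 := derivative_eq_zero.1 h
    have h2 : vecPoly v ≠ 0 := fun h => hv (vecPoly_injective (h.trans (map_zero _).symm))
    rw [hR, natDegree_X_mul h2] at h1
    lia
  have hsub : {t : F | Fin.cons t v ∈ criticalValues F E (n + 1)} ⊆
      ⋃ 𝔪 : MaximalSpectrum E, ⋃ z ∈ (derivative R).rootSet (Factor 𝔪),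
        {t | algebraMap F (Factor 𝔪) t = -aeval z R} := by
    rintro t ⟨x, hx, hN⟩
    rw [hvp, map_add, aeval_C] at hx
    rw [hvp, derivative_add, derivative_C, zero_add, norm_eq_prod_norm_toFactor,
      Finset.prod_eq_zero_iff] at hN
    obtain ⟨𝔪, -, h𝔪⟩ := hN
    rw [Algebra.norm_eq_zero_iff, ← aeval_algHom_apply] at h𝔪
    simp only [Set.mem_iUnion]
    refine ⟨𝔪, toFactor F 𝔪 x, mem_rootSet.2 ⟨hR0, h𝔪⟩, ?_⟩
    have := congrArg (toFactor F 𝔪) hx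
    rw [map_add, AlgHom.commutes, ← aeval_algHom_apply, map_zero] at this
    exact eq_neg_of_add_eq_zero_left this
  refine Set.Finite.subset (Set.finite_iUnion fun 𝔪 => ?_) hsub
  refine Set.Finite.biUnion (rootSet_finite _ _) fun z _ => ?_
  refine Set.Subsingleton.finite fun s hs t ht => (algebraMap F (Factor 𝔪)).injective ?_
  exact Eq.trans hs (Eq.symm ht)

/-- Fubini, integrating first over the constant coefficient. Since `n > 0`, the vector of the other
coefficients is almost surely nonzero. -/
theorem piHaar_criticalValues [ProperSpace F] [MeasurableSpace F] [BorelSpace F] [CharZero F]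
    [IsReduced E] [TopologicalSpace E] [IsModuleTopology F E] {n : ℕ} (hn : 0 < n) :
    piHaar F (Fin (n + 1)) (criticalValues F E (n + 1)) = 0 := by
  have : Nonempty (Fin n) := ⟨⟨0, hn⟩⟩
  have h1 := (measurePreserving_piFinSuccAbove (fun _ : Fin (n + 1) => haarF F) 0).symm
  have hm := measurableSet_criticalValues (F := F) (E := E) (n + 1)
  rw [← h1.measure_preimage hm.nullMeasurableSet, Measure.prod_apply_symm (h1.measurable hm)]
  refine (lintegral_eq_zero_iff' ?_).2 ?_
  · exact (measurable_measure_prodMk_right (h1.measurable hm)).aemeasurable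
  · have h0 : ∀ᵐ v : Fin n → F ∂(Measure.pi fun _ => haarF F), v ≠ 0 := by
      rw [ae_iff]
      simp [hn.ne']
    have h0' : ∀ᵐ v : Fin n → F ∂(Measure.pi fun j : Fin n => haarF F), v ≠ 0 := h0
    filter_upwards [h0'] with v hv
    refine (finite_setOf_criticalValues_cons (E := E) hv).subset (fun t ht => ?_) |>.measure_zero _
    have : (MeasurableEquiv.piFinSuccAbove (fun _ : Fin (n + 1) => F) 0).symm (t, v) =
        Fin.cons t v := by
      ext i
      refine Fin.cases ?_ (fun i => ?_) i <;> rfl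
    rw [Set.mem_preimage, Set.mem_preimage, this] at ht
    exact ht

end CriticalValues

theorem isUltrametricDist_prod (X Y : Type*) [PseudoMetricSpace X] [PseudoMetricSpace Y]
    [IsUltrametricDist X] [IsUltrametricDist Y] : IsUltrametricDist (X × Y) := by
  refine ⟨fun x y z => ?_⟩
  simp only [Prod.dist_eq]
  refine max_le ((IsUltrametricDist.dist_triangle_max _ y.1 _).trans ?_)
    ((IsUltrametricDist.dist_triangle_max _ y.2 _).trans ?_)
  · exact max_le_max (le_max_left _ _) (le_max_left _ _)
  · exact max_le_max (le_max_right _ _) (le_max_right _ _)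

/-! ### The expected number of new roots -/

section ExpectedNewRoots

variable {F : Type*} [NontriviallyNormedField F] [IsUltrametricDist F] [ProperSpace F]
  [MeasurableSpace F] [BorelSpace F] [IsNormalized F] [CharZero F]
  {E : Type*} [CommRing E] [Algebra F E] [Module.Finite F E]
  [IsReduced E] [TopologicalSpace E] [IsModuleTopology F E] [MeasurableSpace E] [BorelSpace E]

theorem lintegral_norm_coeffMeasure (k : ℕ) (x : E) :
    ∫⁻ Q in cube F (Fin k), ENNReal.ofReal ‖Algebra.norm F (aeval x (vecPoly Q))‖
      ∂(piHaar F (Fin k)) = ENNReal.ofReal (meanNorm F k x) := by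
  have hc : Continuous fun Q : Fin k → F => ‖Algebra.norm F (aeval x (vecPoly Q))‖ :=
    (continuous_algebraNorm.comp ((continuous_aeval_vecPoly k).comp
      (continuous_id.prodMk continuous_const))).norm
  have hi := (isOpenEmbedding_coe_pi (F := F) k).continuous
  rw [← map_coe_coeffMeasure, lintegral_map hc.measurable.ennreal_ofReal hi.measurable, meanNorm,
    ofReal_integral_eq_lintegral_ofReal]
  · rfl
  · exact (hc.comp hi).integrable_of_hasCompactSupport (HasCompactSupport.of_compactSpace _)
  · exact Filter.Eventually.of_forall fun _ => norm_nonneg _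

/-- By Gauss's lemma the domain is the cube rescaled by a coefficient `h` of `χ_x` with `‖h‖ =
H(x)`. Substituting `h Q` for `Q` costs `H(x)^{-k}` for the volume and `H(x)^{-r}` for the norm. -/
theorem lintegral_norm_setOf_mulAdd_mem (k : ℕ) (x : E) :
    ∫⁻ Q in {Q | mulAdd (charPoly F x) (Module.finrank F E) k (Module.finrank F E + k) (0, Q) ∈
        cube F _}, ENNReal.ofReal ‖Algebra.norm F (aeval x (vecPoly Q))‖ ∂(piHaar F (Fin k)) =
      ENNReal.ofReal (meanNorm F k x / height F x ^ (Module.finrank F E + k)) := by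
  obtain ⟨i, hi⟩ := (charPoly F x).exists_eq_supNorm
  set h := (charPoly F x).coeff i
  rw [supNorm_charPoly] at hi
  have hH : 0 < height F x := zero_lt_one.trans_le (one_le_height x)
  have h0 : h ≠ 0 := by rw [← norm_ne_zero_iff, ← hi]; exact hH.ne'
  let f : (Fin k → F) →ₗ[F] (Fin k → F) := h • LinearMap.id
  have hf : LinearMap.det f = h ^ k := by simp [f]
  have hset : {Q | mulAdd (charPoly F x) (Module.finrank F E) k (Module.finrank F E + k) (0, Q) ∈
        cube F _} = f ⁻¹' cube F (Fin k) := by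
    ext Q
    change mulAdd _ _ _ _ (0, Q) ∈ cube F _ ↔ h • Q ∈ cube F _
    rw [vecPoly_mem_cube_iff, vecPoly_mulAdd (degree_charPoly_le x) rfl, map_zero, zero_add,
      supNorm_mul, supNorm_charPoly, vecPoly_mem_cube_iff, map_smul, smul_eq_C_mul, supNorm_mul,
      supNorm_C, hi]
  have hfm : Measurable f := (LinearMap.continuous_on_pi f).measurable
  have hc : Continuous fun Q : Fin k → F => ‖Algebra.norm F (aeval x (vecPoly Q))‖ :=
    (continuous_algebraNorm.comp ((continuous_aeval_vecPoly k).comp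
      (continuous_id.prodMk continuous_const))).norm
  have hg : ∀ Q : Fin k → F, ENNReal.ofReal ‖Algebra.norm F (aeval x (vecPoly Q))‖ =
      ENNReal.ofReal (‖h‖⁻¹ ^ Module.finrank F E) *
        ENNReal.ofReal ‖Algebra.norm F (aeval x (vecPoly (f Q)))‖ := by
    intro Q
    have : f Q = h • Q := rfl
    rw [← ENNReal.ofReal_mul (by positivity), this, map_smul, map_smul, Algebra.smul_def, map_mul,
      Algebra.norm_algebraMap, norm_mul, norm_pow, ← mul_assoc, ← mul_pow,
      inv_mul_cancel₀ (norm_ne_zero_iff.2 h0), one_pow, one_mul]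
  have hm := map_linearMap_piHaar (f := f) (by rw [hf]; exact pow_ne_zero _ h0)
  have h1 := setLIntegral_map (μ := piHaar F (Fin k)) (isOpen_cube (F := F)).measurableSet
    hc.measurable.ennreal_ofReal hfm
  rw [hset, lintegral_congr hg, lintegral_const_mul' _ _ ENNReal.ofReal_ne_top, ← h1, hm,
    Measure.restrict_smul, lintegral_smul_measure, lintegral_norm_coeffMeasure, smul_eq_mul, hf,
    ← ENNReal.ofReal_mul (by positivity), ← ENNReal.ofReal_mul (by positivity), norm_inv, norm_pow,
    hi, pow_add]
  congr 1
  have : ‖h‖ ≠ 0 := norm_ne_zero_iff.2 h0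
  rw [inv_pow]
  field_simp

omit [ProperSpace F] [MeasurableSpace F] [BorelSpace F] [IsNormalized F] [CharZero F]
  [IsReduced E] [TopologicalSpace E] [IsModuleTopology F E] [MeasurableSpace E] [BorelSpace E] in
/-- Away from the critical values, the new roots of `P` correspond to the factorizations
`P = χ_x Q` with `Q(x)` invertible. -/
theorem numNewRoots_eq_encard (b : Module.Basis (Fin (Module.finrank F E)) F E) {k n : ℕ}
    (hm : Module.finrank F E + k = n + 1) (U : Set E) {a : Fin (n + 1) → OF F}
    (ha : (fun i => (a i : F)) ∉ criticalValues F E (n + 1)) :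
    numNewRoots F U n a = ({p | p ∈ {p : (Fin (Module.finrank F E) → F) × (Fin k → F) |
      b.equivFun.symm p.1 ∈ U ∧ rootMap b k (n + 1) p ∈ cube F (Fin (n + 1)) ∧
      IsNew F (b.equivFun.symm p.1) ∧
      Algebra.norm F (aeval (b.equivFun.symm p.1) (vecPoly p.2)) ≠ 0} ∧
      rootMap b k (n + 1) p = fun i => (a i : F)}.encard : ℝ≥0∞) := by
  set S := {p | p ∈ {p : (Fin (Module.finrank F E) → F) × (Fin k → F) |
      b.equivFun.symm p.1 ∈ U ∧ rootMap b k (n + 1) p ∈ cube F (Fin (n + 1)) ∧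
      IsNew F (b.equivFun.symm p.1) ∧
      Algebra.norm F (aeval (b.equivFun.symm p.1) (vecPoly p.2)) ≠ 0} ∧
      rootMap b k (n + 1) p = fun i => (a i : F)} with hS
  have hinj : Set.InjOn (fun p : (Fin (Module.finrank F E) → F) × (Fin k → F) =>
      b.equivFun.symm p.1) S := by
    rintro p hp p' hp' h
    have h1 : p.1 = p'.1 := b.equivFun.symm.injective h
    have h2 := vecPoly_rootMap b hm p
    have h3 := vecPoly_rootMap b hm p'
    rw [hp.2, ← hp'.2, h3, h1] at h2
    exact Prod.ext h1 (vecPoly_injective (mul_left_cancel₀ (charPoly_monic _).ne_zero h2).symm)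
  have himage : (fun p : (Fin (Module.finrank F E) → F) × (Fin k → F) => b.equivFun.symm p.1) '' S =
      {x : E | x ∈ U ∧ aeval x (toPoly a) = 0 ∧ IsNew F x} := by
    ext x
    constructor
    · rintro ⟨p, ⟨⟨hU, -, hnew, -⟩, hp⟩, rfl⟩
      refine ⟨hU, ?_, hnew⟩
      rw [toPoly_eq_vecPoly, ← hp, vecPoly_rootMap b hm, map_mul, aeval_charPoly, zero_mul]
    · rintro ⟨hU, hx, hnew⟩
      obtain ⟨Q, hQ⟩ := hnew.charPoly_dvd hx
      have hQd : Q.degree < k := by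
        have hlt : (toPoly a).degree < (Module.finrank F E + k : ℕ) := by
          rw [hm]; exact degree_vecPoly_lt _
        rw [hQ, mul_comm, (charPoly_monic x).degree_mul, add_comm,
          degree_eq_natDegree (charPoly_monic x).ne_zero, natDegree_charPoly, Nat.cast_add] at hlt
        exact lt_of_add_lt_add_left hlt
      have hQv : vecPoly (fun i : Fin k => Q.coeff i) = Q := vecPoly_coeff hQd
      have hroot : rootMap b k (n + 1) (b.equivFun x, fun i => Q.coeff i) = fun i => (a i : F) := by
        apply vecPoly_injective
        rw [vecPoly_rootMap b hm, hQv, LinearEquiv.symm_apply_apply, ← hQ, toPoly_eq_vecPoly]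
      refine ⟨(b.equivFun x, fun i => Q.coeff i), ⟨⟨?_, ?_, ?_, ?_⟩, hroot⟩, ?_⟩
      · rwa [LinearEquiv.symm_apply_apply]
      · rw [hroot, mem_cube]
        exact fun i => (a i).2
      · rwa [LinearEquiv.symm_apply_apply]
      · simp only [LinearEquiv.symm_apply_apply, hQv]
        intro hN
        -- `P'(x) = χ_x'(x) Q(x)`, so a noninvertible `Q(x)` would make `P` a critical value.
        refine ha ⟨x, hx, ?_⟩
        rw [← toPoly_eq_vecPoly, hQ, derivative_mul, map_add, map_mul, map_mul, aeval_charPoly,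
          zero_mul, add_zero, map_mul, hN, mul_zero]
      · exact LinearEquiv.symm_apply_apply _ _
  rw [numNewRoots, ← himage, hinj.encard_image]

/-- The area formula for `rootMap` on the open set `W` of pairs where it is nondegenerate and
integral, followed by integration over `Q` for fixed `x`. -/
theorem lintegral_numNewRoots_of_le {n : ℕ} (hn : 0 < n) (hr : Module.finrank F E ≤ n)
    {U : Set E} (hU : IsOpen U) :
    AEMeasurable (numNewRoots F U n) (coeffMeasure F (n + 1)) ∧
      ∫⁻ a, numNewRoots F U n a ∂(coeffMeasure F (n + 1)) =
        ∫⁻ x in U, ENNReal.ofReal (density F E n x) ∂(etaleHaar F E) := by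
  obtain ⟨k, hm⟩ : ∃ k, Module.finrank F E + k = n + 1 := ⟨n + 1 - Module.finrank F E, by lia⟩
  obtain ⟨b, hb⟩ := exists_isIntegralBasis F E
  set W := {p : (Fin (Module.finrank F E) → F) × (Fin k → F) |
      b.equivFun.symm p.1 ∈ U ∧ rootMap b k (n + 1) p ∈ cube F (Fin (n + 1)) ∧
      IsNew F (b.equivFun.symm p.1) ∧
      Algebra.norm F (aeval (b.equivFun.symm p.1) (vecPoly p.2)) ≠ 0} with hW
  have hφ : Continuous fun p : (Fin (Module.finrank F E) → F) × (Fin k → F) =>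
      b.equivFun.symm p.1 := (coordHomeo b).continuous.comp continuous_fst
  have hrm : Continuous (rootMap b k (n + 1)) := continuous_iff_continuousAt.2 fun p =>
    (exists_hasStrictFDerivAt_rootMap b hm p).choose_spec.1.continuousAt
  have hNc : Continuous fun p : (Fin (Module.finrank F E) → F) × (Fin k → F) =>
      Algebra.norm F (aeval (b.equivFun.symm p.1) (vecPoly p.2)) :=
    continuous_algebraNorm.comp ((continuous_aeval_vecPoly k).comp (continuous_snd.prodMk hφ))
  have hnew : ∀ x : E, IsNew F x ↔ latVol F x ≠ 0 := fun x =>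
    ⟨fun h => (latVol_pos h).ne', fun h => by_contra fun h' => h (latVol_eq_zero h')⟩
  have hWo : IsOpen W := by
    refine (hU.preimage hφ).inter ((isOpen_cube.preimage hrm).inter (IsOpen.inter ?_ ?_))
    · have h := isOpen_ne_fun ((continuous_latVol (F := F) (E := E)).comp hφ) (continuous_const (y := (0 : ℝ)))
      have heq : (fun p : (Fin (Module.finrank F E) → F) × (Fin k → F) =>
          IsNew F (b.equivFun.symm p.1)) =
          {p | latVol F (b.equivFun.symm p.1) ≠ 0} := funext fun p => propext (hnew _)
      exact heq ▸ h
    · exact isOpen_ne_fun hNc continuous_const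
  have := Measure.prod.instIsAddHaarMeasure (piHaar F (Fin (Module.finrank F E)))
    (piHaar F (Fin k))
  have hult := isUltrametricDist_prod (Fin (Module.finrank F E) → F) (Fin k → F)
  obtain ⟨hGm, hGi⟩ := area_formula (F := F) (Φ := rootMap b k (n + 1))
    ((piHaar F (Fin (Module.finrank F E))).prod (piHaar F (Fin k))) (piHaar F (Fin (n + 1))) hWo
    (J := fun p => ENNReal.ofReal (‖etaleDiscr F E‖ * latVol F (b.equivFun.symm p.1) *
          ‖Algebra.norm F (aeval (b.equivFun.symm p.1) (vecPoly p.2))‖))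
    fun p hp => hb.exists_jacobian_rootMap hm p hp.2.2.1 hp.2.2.2
  set G : (Fin (n + 1) → F) → ℝ≥0∞ := fun y =>
    ({p | p ∈ W ∧ rootMap b k (n + 1) p = y}.encard : ℝ≥0∞) with hG
  have hi := (isOpenEmbedding_coe_pi (F := F) (n + 1)).continuous
  have hae : (fun a : Fin (n + 1) → OF F => G fun i => (a i : F)) =ᵐ[coeffMeasure F (n + 1)]
      numNewRoots F U n := by
    have h0 : ∀ᵐ y ∂((coeffMeasure F (n + 1)).map fun a i => (a i : F)),
        y ∉ criticalValues F E (n + 1) := by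
      rw [map_coe_coeffMeasure]
      refine ae_restrict_of_ae ?_
      rw [ae_iff]
      simpa using piHaar_criticalValues (F := F) (E := E) hn
    filter_upwards [ae_of_ae_map hi.measurable.aemeasurable h0] with a ha
    exact (numNewRoots_eq_encard b hm U ha).symm
  refine ⟨(hGm.comp hi.measurable).aemeasurable.congr hae, ?_⟩
  have hcube := (isOpen_cube (F := F) (ι := Fin (n + 1))).measurableSet
  rw [← lintegral_congr_ae hae, ← lintegral_map hGm hi.measurable, map_coe_coeffMeasure,
    ← lintegral_indicator hcube]
  -- Integrality of the product is built into `W`, so the restriction to the cube can be dropped.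
  have hGc : (cube F (Fin (n + 1))).indicator G = G := by
    refine Set.indicator_eq_self.2 fun y hy => ?_
    by_contra hcon
    refine hy ?_
    have : {p | p ∈ W ∧ rootMap b k (n + 1) p = y} = ∅ := by
      refine Set.eq_empty_of_forall_notMem ?_
      rintro p ⟨hp, rfl⟩
      exact hcon hp.2.1
    simp only [hG, this, Set.encard_empty, ENat.toENNReal_zero]
  rw [hGc, hGi, ← lintegral_indicator hWo.measurableSet, lintegral_prod]
  swap
  · refine (Measurable.indicator ?_ hWo.measurableSet).aemeasurable
    exact ((continuous_const.mul (continuous_latVol.comp hφ)).mul hNc.norm).measurable.ennreal_ofReal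
  have hinner : ∀ c : Fin (Module.finrank F E) → F,
      ∫⁻ Q, W.indicator (fun p => ENNReal.ofReal (‖etaleDiscr F E‖ *
        latVol F (b.equivFun.symm p.1) *
          ‖Algebra.norm F (aeval (b.equivFun.symm p.1) (vecPoly p.2))‖)) (c, Q)
        ∂(piHaar F (Fin k)) =
      U.indicator (fun x => ENNReal.ofReal (density F E n x)) (coordHomeo b c) := by
    intro c
    rw [coordHomeo_apply]
    set x := b.equivFun.symm c with hx
    by_cases hxU : x ∈ U
    · rw [Set.indicator_of_mem hxU]
      set C := {Q : Fin k → F | mulAdd (charPoly F x) (Module.finrank F E) k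
          (Module.finrank F E + k) (0, Q) ∈ cube F _} with hC
      have hms : MeasurableSet C := by
        have h1 : Continuous fun Q : Fin k → F => rootMap b k (n + 1) (c, Q) :=
          hrm.comp (continuous_const.prodMk continuous_id)
        have h2 := (isOpen_cube.preimage h1).measurableSet
        rw [hC, hm]
        simpa only [rootMap_eq_mulAdd] using! h2
      have h1 : ∀ Q : Fin k → F, W.indicator (fun p => ENNReal.ofReal (‖etaleDiscr F E‖ *
          latVol F (b.equivFun.symm p.1) *
            ‖Algebra.norm F (aeval (b.equivFun.symm p.1) (vecPoly p.2))‖)) (c, Q) =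
          ENNReal.ofReal (‖etaleDiscr F E‖ * latVol F x) *
          C.indicator
          (fun Q => ENNReal.ofReal ‖Algebra.norm F (aeval x (vecPoly Q))‖) Q := by
        intro Q
        have hlv : 0 ≤ latVol F x := ENNReal.toReal_nonneg
        by_cases hcube' : Q ∈ C
        · rw [Set.indicator_of_mem hcube', ← ENNReal.ofReal_mul (by positivity)]
          by_cases hp : (c, Q) ∈ W
          · rw [Set.indicator_of_mem hp]
          · rw [Set.indicator_of_notMem hp]
            -- The degenerate points left out of `W` do not affect the integral: the Jacobian
            -- expression vanishes there.
            have : ¬ (IsNew F x ∧ Algebra.norm F (aeval x (vecPoly Q)) ≠ 0) := fun h =>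
              hp ⟨hxU, by rw [rootMap_eq_mulAdd, ← hm]; exact hcube', h⟩
            rw [not_and_or, hnew, not_not, not_not] at this
            rcases this with h | h <;> simp [h]
        · rw [Set.indicator_of_notMem hcube', mul_zero, Set.indicator_of_notMem]
          intro hp
          have := hp.2.1
          rw [rootMap_eq_mulAdd, ← hm] at this
          exact hcube' this
      simp only [h1]
      have hlv : 0 ≤ latVol F x := ENNReal.toReal_nonneg
      rw [lintegral_const_mul' _ _ ENNReal.ofReal_ne_top, lintegral_indicator hms,
        lintegral_norm_setOf_mulAdd_mem, ← ENNReal.ofReal_mul (by positivity), density_eq, hm,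
        ← hm, Nat.add_sub_cancel_left]
      congr 1
      ring
    · rw [Set.indicator_of_notMem hxU]
      refine (lintegral_congr fun Q => ?_).trans lintegral_zero
      exact Set.indicator_of_notMem (fun hp => hxU hp.1) _
  simp only [hinner]
  have hdm : Measurable fun x => ENNReal.ofReal (density F E n x) :=
    (continuous_density n).measurable.ennreal_ofReal
  rw [hb.measurePreserving.lintegral_comp (hdm.indicator hU.measurableSet),
    lintegral_indicator hU.measurableSet]

end ExpectedNewRoots

/-! ### Boundedness of the number of roots and integrability -/

section IntegrableDensity

variable {F : Type*} [NontriviallyNormedField F] [IsUltrametricDist F]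
  {E : Type*} [CommRing E] [Algebra F E] [Module.Finite F E] [IsReduced E]

omit [IsUltrametricDist F] in
/-- In a finite product of fields a polynomial has a bounded number of roots. -/
theorem encard_roots_le {P : F[X]} (hP : P ≠ 0) {n : ℕ} (hn : P.natDegree ≤ n) :
    {x : E | aeval x P = 0}.encard ≤ (n ^ Nat.card (MaximalSpectrum E) : ℕ) := by
  classical
  have := finite_maximalSpectrum F E
  have := Fintype.ofFinite (MaximalSpectrum E)
  let T : Finset (∀ 𝔪 : MaximalSpectrum E, Factor 𝔪) :=
    Fintype.piFinset fun 𝔪 => (P.map (algebraMap F (Factor 𝔪))).roots.toFinset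
  have hsub : factorEquiv F '' {x : E | aeval x P = 0} ⊆ (T : Set _) := by
    rintro _ ⟨x, hx, rfl⟩
    rw [Finset.mem_coe, Fintype.mem_piFinset]
    intro 𝔪
    have h0 : P.map (algebraMap F (Factor 𝔪)) ≠ 0 := (Polynomial.map_ne_zero_iff
      (algebraMap F (Factor 𝔪)).injective).2 hP
    rw [Multiset.mem_toFinset, mem_roots h0, IsRoot.def, eval_map_algebraMap, factorEquiv_apply,
      aeval_algHom_apply]
    rw [Set.mem_ofPred_eq] at hx
    rw [hx, map_zero]
  rw [← (factorEquiv (F := F) (E := E)).injective.encard_image]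
  refine (Set.encard_le_encard hsub).trans ?_
  rw [Set.encard_coe_eq_coe_finsetCard, Nat.cast_le, Fintype.card_piFinset, Nat.card_eq_fintype_card]
  refine (Finset.prod_le_pow_card _ _ n fun 𝔪 _ => ?_)
  exact (Multiset.toFinset_card_le _).trans ((card_roots' _).trans (natDegree_map_le.trans hn))

omit [Module.Finite F E] [IsReduced E] in
theorem natDegree_toPoly_le {n : ℕ} (a : Fin (n + 1) → OF F) : (toPoly a).natDegree ≤ n := by
  rw [toPoly_eq_vecPoly]
  refine natDegree_le_iff_degree_le.2 (degree_le_iff_coeff_zero _ _ |>.2 fun m hm => ?_)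
  refine coeff_eq_zero_of_degree_lt ((degree_vecPoly_lt _).trans_le ?_)
  exact Nat.cast_le.2 (Nat.succ_le_of_lt (WithBot.coe_lt_coe.1 hm))

variable [ProperSpace F] [MeasurableSpace F] [BorelSpace F]

theorem ae_toPoly_ne_zero (n : ℕ) : ∀ᵐ a ∂(coeffMeasure F (n + 1)), toPoly a ≠ 0 := by
  have hi := (isOpenEmbedding_coe_pi (F := F) (n + 1)).continuous
  have h0 : ∀ᵐ y ∂((coeffMeasure F (n + 1)).map fun a i => (a i : F)), y ≠ 0 := by
    rw [map_coe_coeffMeasure]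
    refine ae_restrict_of_ae ?_
    rw [ae_iff]
    simp
  filter_upwards [ae_of_ae_map hi.measurable.aemeasurable h0] with a ha h
  refine ha (vecPoly_injective ?_)
  rw [map_zero, ← toPoly_eq_vecPoly, h]

theorem numNewRoots_le (U : Set E) {n : ℕ} {a : Fin (n + 1) → OF F} (ha : toPoly a ≠ 0) :
    numNewRoots F U n a ≤ (n ^ Nat.card (MaximalSpectrum E) : ℕ) := by
  have h := (Set.encard_le_encard fun x (hx : x ∈ {x : E | x ∈ U ∧ aeval x (toPoly a) = 0 ∧
    IsNew F x}) => hx.2.1).trans (encard_roots_le (E := E) ha (natDegree_toPoly_le a))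
  have h' := ENat.toENNReal_mono h
  rwa [ENat.toENNReal_coe] at h'

variable [IsNormalized F] [CharZero F]
  [TopologicalSpace E] [IsModuleTopology F E] [MeasurableSpace E] [BorelSpace E]

/-- If `n < r`, a nonzero `P` has no new root, since `χ_x` of degree `r` would divide it; the
density vanishes as well. -/
theorem lintegral_numNewRoots {n : ℕ} (hn : 0 < n) {U : Set E} (hU : IsOpen U) :
    AEMeasurable (numNewRoots F U n) (coeffMeasure F (n + 1)) ∧
      ∫⁻ a, numNewRoots F U n a ∂(coeffMeasure F (n + 1)) =
        ∫⁻ x in U, ENNReal.ofReal (density F E n x) ∂(etaleHaar F E) := by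
  rcases Nat.lt_or_ge n (Module.finrank F E) with h | h
  swap
  · exact lintegral_numNewRoots_of_le hn h hU
  have hae : numNewRoots F U n =ᵐ[coeffMeasure F (n + 1)] fun _ => 0 := by
    filter_upwards [ae_toPoly_ne_zero (F := F) n] with a ha
    have : {x : E | x ∈ U ∧ aeval x (toPoly a) = 0 ∧ IsNew F x} = ∅ := by
      refine Set.eq_empty_of_forall_notMem ?_
      rintro x ⟨-, hx, hnew⟩
      have h1 := natDegree_le_of_dvd (hnew.charPoly_dvd hx) ha
      rw [natDegree_charPoly] at h1
      exact absurd (h1.trans (natDegree_toPoly_le a)) h.not_ge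
    rw [numNewRoots, this, Set.encard_empty, ENat.toENNReal_zero]
  refine ⟨(aemeasurable_const).congr hae.symm, ?_⟩
  rw [lintegral_congr_ae hae]
  simp [density_eq_zero n _ (Or.inr h)]

theorem density_nonneg (n : ℕ) (x : E) : 0 ≤ density F E n x := by
  have hH : 0 < height F x := zero_lt_one.trans_le (one_le_height x)
  refine mul_nonneg ?_ (integral_nonneg fun _ => norm_nonneg _)
  positivity

/-- The total integral is the expected number of new roots in `E`, and that number is bounded for `P
≠ 0`. -/
theorem integrable_density {n : ℕ} (hn : 0 < n) :
    Integrable (density F E n) (etaleHaar F E) := by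
  refine ⟨(continuous_density n).measurable.aestronglyMeasurable, ?_⟩
  rw [hasFiniteIntegral_iff_ofReal (Filter.Eventually.of_forall (density_nonneg n)),
    ← setLIntegral_univ, ← (lintegral_numNewRoots hn isOpen_univ).2]
  refine (lintegral_mono_ae (g := fun _ => ((n ^ Nat.card (MaximalSpectrum E) : ℕ) : ℝ≥0∞))
    ?_).trans_lt ?_
  · filter_upwards [ae_toPoly_ne_zero (F := F) n] with a ha
    exact numNewRoots_le _ ha
  · rw [lintegral_const, measure_univ, mul_one]
    exact ENNReal.natCast_lt_top _

theorem lintegral_numNewRoots_eq_integral {n : ℕ} (hn : 0 < n) {U : Set E} (hU : IsOpen U) :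
    ∫⁻ a, numNewRoots F U n a ∂(coeffMeasure F (n + 1)) =
      ENNReal.ofReal (∫ x in U, density F E n x ∂(etaleHaar F E)) := by
  rw [(lintegral_numNewRoots hn hU).2, ofReal_integral_eq_lintegral_ofReal
    (integrable_density hn).integrableOn (Filter.Eventually.of_forall (density_nonneg n))]

end IntegrableDensity

/-! ### An étale algebra has finitely many subalgebras -/

section FiniteSubalgebra

variable {Ω : Type*} [Field Ω] {ι : Type*} [Finite ι]

/-- A subalgebra of a finite power of a field consists of the functions that are constant on the
classes of an equivalence relation. -/
theorem mem_subalgebra_pi_iff (S : Subalgebra Ω (ι → Ω)) (x : ι → Ω) :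
    x ∈ S ↔ ∀ i j, (∀ s ∈ S, s i = s j) → x i = x j := by
  classical
  have := Fintype.ofFinite ι
  refine ⟨fun h i j hij => hij x h, fun hx => ?_⟩
  let R : Setoid ι := ⟨fun i j => ∀ s ∈ S, s i = s j, fun _ _ _ => rfl,
    fun h s hs => (h s hs).symm, fun h h' s hs => (h s hs).trans (h' s hs)⟩
  -- An element of `S` separating `i` from `j` is normalized to the values `1` and `0`. The products
  -- over `j` are then the indicators of the classes, and `x` is a combination of them.
  have hsep : ∀ i j, ∃ s ∈ S, s i = 1 ∧ (¬ (∀ t ∈ S, t i = t j) → s j = 0) := by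
    intro i j
    by_cases h : ∀ t ∈ S, t i = t j
    · exact ⟨1, one_mem S, rfl, fun h' => absurd h h'⟩
    · push Not at h
      obtain ⟨t, ht, hij⟩ := h
      refine ⟨(t i - t j)⁻¹ • (t - algebraMap Ω _ (t j)),
        S.smul_mem (sub_mem ht (S.algebraMap_mem _)) _, ?_, fun _ => ?_⟩
      · simp [inv_mul_cancel₀ (sub_ne_zero.2 hij)]
      · simp
  choose s hs hs1 hs0 using hsep
  let e : ι → ι → Ω := fun i => ∏ j, s i j
  have he : ∀ i, e i ∈ S := fun i => prod_mem fun j _ => hs i j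
  have he1 : ∀ i, e i i = 1 := fun i => by
    simp only [e, Finset.prod_apply, hs1, Finset.prod_const_one]
  have he0 : ∀ i j, ¬ R i j → e i j = 0 := fun i j hij => by
    simp only [e, Finset.prod_apply]
    exact Finset.prod_eq_zero (Finset.mem_univ j) (hs0 i j hij)
  have hxe : x = ∑ c : Quotient R, x c.out • e c.out := by
    ext j
    rw [Finset.sum_apply, Finset.sum_eq_single ⟦j⟧]
    · have hj : R (Quotient.out ⟦j⟧) j := Quotient.exact (Quotient.out_eq _)
      rw [Pi.smul_apply, ← hj _ (he _), he1, smul_eq_mul, mul_one]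
      exact (hx _ _ hj).symm
    · intro c _ hc
      rw [Pi.smul_apply, he0, smul_zero]
      exact fun h => hc (by rw [← Quotient.out_eq c]; exact Quotient.sound h)
    · exact fun h => absurd (Finset.mem_univ _) h
  rw [hxe]
  exact sum_mem fun c _ => S.smul_mem (he _) _

theorem finite_subalgebra_pi : Finite (Subalgebra Ω (ι → Ω)) := by
  refine Finite.of_injective (β := ι → ι → Prop) (fun S i j => ∀ s ∈ S, s i = s j) ?_
  intro S T h
  ext x
  have h' : ∀ i j, (∀ s ∈ S, s i = s j) ↔ (∀ s ∈ T, s i = s j) := fun i j =>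
    (congrFun (congrFun h i) j).to_iff
  rw [mem_subalgebra_pi_iff, mem_subalgebra_pi_iff]
  simp only [h']

open scoped TensorProduct in
-- Over the algebraic closure `E` becomes a finite power of the field, whose subalgebras correspond
-- to certain equivalence relations on a finite set. Base change is injective on subspaces.
theorem finite_subalgebra_of_etale (F E : Type*) [Field F] [CommRing E] [Algebra F E]
    [Algebra.Etale F E] : Finite (Subalgebra F E) := by
  let Ω := AlgebraicClosure F
  let e := Algebra.FormallyEtale.equivPiOfIsSepClosed Ω (Ω ⊗[F] E)
  have := Algebra.FormallyUnramified.finite_of_free Ω (Ω ⊗[F] E)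
  have : IsArtinianRing (Ω ⊗[F] E) := IsArtinianRing.of_finite Ω _
  have : Finite (PrimeSpectrum (Ω ⊗[F] E)) := inferInstance
  have := finite_subalgebra_pi (Ω := Ω) (ι := PrimeSpectrum (Ω ⊗[F] E))
  refine Finite.of_injective (β := Subalgebra Ω (PrimeSpectrum (Ω ⊗[F] E) → Ω))
    (fun S => (S.baseChange Ω).map e.toAlgHom) fun S T h => ?_
  have h1 : S.baseChange Ω = T.baseChange Ω := Subalgebra.map_injective e.injective h
  have hb : ∀ S : Subalgebra F E, Subalgebra.toSubmodule (S.baseChange Ω) =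
      (Subalgebra.toSubmodule S).baseChange Ω := by
    intro S
    ext x
    rfl
  refine Subalgebra.toSubmodule_injective (Submodule.baseChange_injective (A := Ω) ?_)
  rw [← hb, ← hb, h1]

end FiniteSubalgebra

/-! ### Sorting the roots by the subalgebra they generate -/

section Subalgebras

variable {F : Type*} [NontriviallyNormedField F] [IsUltrametricDist F]
  {E : Type*} [CommRing E] [Algebra F E]

/-- A finite-dimensional space over a complete field has only one Hausdorff vector space topology,
so the subspace topology is the module topology and the results on new roots apply to `E'`. -/
theorem isModuleTopology_subalgebra [CompleteSpace F] [Module.Finite F E] [TopologicalSpace E]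
    [IsModuleTopology F E] (E' : Subalgebra F E) : IsModuleTopology F E' := by
  have := isTopologicalRing_of_isModuleTopology F E
  have := IsModuleTopology.toContinuousSMul F E
  have := t2Space_of_isModuleTopology F E
  have : IsTopologicalAddGroup E' := inferInstanceAs (IsTopologicalAddGroup
    (Subalgebra.toSubmodule E').toAddSubgroup)
  exact isModuleTopologyOfFiniteDimensional

theorem isNew_subalgebra_iff {E' : Subalgebra F E} (x : E') :
    IsNew F x ↔ Algebra.adjoin F {(x : E)} = E' := by
  have h : (Algebra.adjoin F {x}).map E'.val = Algebra.adjoin F {(x : E)} := by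
    rw [AlgHom.map_adjoin, Set.image_singleton]
    rfl
  rw [IsNew, ← h]
  constructor
  · intro h'
    rw [h', Algebra.map_top, Subalgebra.range_val]
  · intro h'
    refine Subalgebra.map_injective (f := E'.val) Subtype.val_injective ?_
    rw [h', Algebra.map_top, Subalgebra.range_val]

/-- Every root is new in exactly one subalgebra. -/
theorem numRoots_eq_sum [Fintype (Subalgebra F E)] (U : Set E) (n : ℕ)
    (a : Fin (n + 1) → OF F) :
    numRoots F U n a = ∑ E' : Subalgebra F E,
      numNewRoots F (Subtype.val ⁻¹' U : Set E') n a := by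
  let _ : MeasurableSpace E := ⊤
  -- The roots generating exactly `E'`. These sets are disjoint, and the counting measure turns
  -- their union into a sum.
  let N : Subalgebra F E → Set E := fun E' =>
    {x | x ∈ U ∧ aeval x (toPoly a) = 0 ∧ Algebra.adjoin F {x} = E'}
  have h1 : ∀ E' : Subalgebra F E, numNewRoots F (Subtype.val ⁻¹' U : Set E') n a =
      Measure.count (N E') := by
    intro E'
    have h2 : N E' = Subtype.val '' {x : E' | x ∈ (Subtype.val ⁻¹' U : Set E') ∧
        aeval x (toPoly a) = 0 ∧ IsNew F x} := by
      ext x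
      constructor
      · rintro ⟨hU, hx, rfl⟩
        refine ⟨⟨x, Algebra.self_mem_adjoin_singleton F x⟩, ⟨hU, ?_, ?_⟩, rfl⟩
        · apply Subtype.val_injective
          rw [← Subalgebra.coe_val, ← aeval_algHom_apply]
          simpa using! hx
        · rw [isNew_subalgebra_iff]
      · rintro ⟨y, ⟨hU, hy, hnew⟩, rfl⟩
        refine ⟨hU, ?_, (isNew_subalgebra_iff y).1 hnew⟩
        rw [← Subalgebra.coe_val, aeval_algHom_apply, hy, map_zero]
    rw [Measure.count_apply MeasurableSpace.measurableSet_top, h2,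
      Subtype.val_injective.encard_image, numNewRoots]
  have h3 : {x : E | x ∈ U ∧ aeval x (toPoly a) = 0} = ⋃ E', N E' := by
    ext x
    simp only [N, Set.mem_iUnion, Set.mem_ofPred_eq]
    exact ⟨fun h => ⟨_, h.1, h.2, rfl⟩, fun ⟨_, h⟩ => ⟨h.1, h.2.1⟩⟩
  simp only [h1]
  rw [numRoots, h3, ← Measure.count_apply MeasurableSpace.measurableSet_top, measure_iUnion
    (fun E' E'' h => Set.disjoint_left.2 fun x hx hx' => h (hx.2.2.symm.trans hx'.2.2))
    (fun _ => MeasurableSpace.measurableSet_top), tsum_fintype]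

end Subalgebras

end PadicRoots

/-! ### The theorem -/

theorem theorem4p8 (p : ℕ) [Fact p.Prime]
    {F : Type*} [NontriviallyNormedField F] [IsUltrametricDist F]
    [Algebra ℚ_[p] F] [FiniteDimensional ℚ_[p] F]
    (hF : ∀ a : ℚ_[p], ‖algebraMap ℚ_[p] F a‖ = ‖a‖ ^ Module.finrank ℚ_[p] F)
    [MeasurableSpace F] [BorelSpace F]
    {E : Type*} [CommRing E] [Algebra F E] [Module.Finite F E] [Algebra.Etale F E]
    [TopologicalSpace E] [IsModuleTopology F E] [MeasurableSpace E] [BorelSpace E]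
    (n : ℕ) (hn : 0 < n) :
    -- expected number of new roots
    (∀ U : Set E, IsOpen U →
      AEMeasurable (numNewRoots F U n) (coeffMeasure F (n + 1)) ∧
      IntegrableOn (density F E n) U (etaleHaar F E) ∧
      ∫⁻ a, numNewRoots F U n a ∂(coeffMeasure F (n + 1)) =
        ENNReal.ofReal (∫ x in U, density F E n x ∂(etaleHaar F E))) ∧
    -- expected number of roots
    (Finite (Subalgebra F E) ∧ ∀ U : Set E, IsOpen U →
      AEMeasurable (numRoots F U n) (coeffMeasure F (n + 1)) ∧
      (∀ E' : Subalgebra F E,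
        IntegrableOn (density F E' n) (Subtype.val ⁻¹' U) (etaleHaar F E')) ∧
      ∫⁻ a, numRoots F U n a ∂(coeffMeasure F (n + 1)) =
        ENNReal.ofReal (∑ᶠ E' : Subalgebra F E,
          ∫ x in (Subtype.val ⁻¹' U : Set E'), density F E' n x ∂(etaleHaar F E'))) ∧
    -- vanishing
    (∀ x : E, ¬ IsNew F x ∨ n < Module.finrank F E → density F E n x = 0) ∧
    -- continuity
    Continuous (density F E n) ∧
    -- transformation under homography
    (∀ (γ : Matrix.GeneralLinearGroup (Fin 2) (OF F)) (x : E) (u : Eˣ),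
      (u : E) = γ 1 0 • x + algebraMap (OF F) E (γ 1 1) →
      density F E n ((γ 0 0 • x + algebraMap (OF F) E (γ 0 1)) * (↑u⁻¹ : E)) =
        ‖Algebra.norm F (u : E)‖ ^ 2 * density F E n x) ∧
    -- ultimate constancy
    (2 * Module.finrank F E - 1 ≤ n →
      density F E n = density F E (2 * Module.finrank F E - 1)) ∧
    -- formulas for extremal degrees
    (∀ x : E, IsNew F x → x ∈ etaleIntegers F E →
      density F E (Module.finrank F E) x =
        ‖etaleDiscr F E‖ * (1 / (intIndex F x : ℝ)) *
          (((resCard F : ℝ) ^ (Module.finrank F E + 1) - (resCard F : ℝ) ^ Module.finrank F E) /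
            ((resCard F : ℝ) ^ (Module.finrank F E + 1) - 1)) ∧
      (2 * Module.finrank F E - 1 ≤ n →
        density F E n x = ‖etaleDiscr F E‖ *
          ∫ t in (intAdjoin F x : Set E), ‖Algebra.norm F t‖ ∂(etaleHaar F E))) := by
  have := properSpace_of_norm_algebraMap p hF
  have := isNormalized_of_norm_algebraMap p hF
  have : CharZero F := charZero_of_injective_algebraMap (algebraMap ℚ_[p] F).injective
  have : IsReduced E := Algebra.FormallyUnramified.isReduced_of_field F E
  have hfin : Finite (Subalgebra F E) := finite_subalgebra_of_etale F E
  have := Fintype.ofFinite (Subalgebra F E)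
  -- Reducedness passes to subalgebras at once, so the formula for new roots applies to each `E'` in
  -- place of `E`.
  have hred : ∀ E' : Subalgebra F E, IsReduced E' := fun E' =>
    isReduced_of_injective E'.val Subtype.val_injective
  have htop : ∀ E' : Subalgebra F E, IsModuleTopology F E' := isModuleTopology_subalgebra
  refine ⟨fun U hU => ⟨(lintegral_numNewRoots hn hU).1, (integrable_density hn).integrableOn,
    lintegral_numNewRoots_eq_integral hn hU⟩, ⟨hfin, fun U hU => ?_⟩, fun x => density_eq_zero n x,
    continuous_density n, density_homography n, density_eq_of_le, fun x hx hxi =>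
    ⟨density_finrank hx hxi, density_eq_setIntegral hx hxi⟩⟩
  have hU' : ∀ E' : Subalgebra F E, IsOpen (Subtype.val ⁻¹' U : Set E') := fun E' =>
    hU.preimage continuous_subtype_val
  have hsum : numRoots F U n = fun a => ∑ E' : Subalgebra F E,
      numNewRoots F (Subtype.val ⁻¹' U : Set E') n a := funext (numRoots_eq_sum U n)
  have hm : ∀ E' : Subalgebra F E, AEMeasurable (numNewRoots F (Subtype.val ⁻¹' U : Set E') n)
      (coeffMeasure F (n + 1)) := fun E' => (lintegral_numNewRoots hn (hU' E')).1
  refine ⟨?_, fun E' => (integrable_density hn).integrableOn, ?_⟩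
  · rw [hsum]
    exact Finset.aemeasurable_fun_sum _ fun E' _ => hm E'
  · rw [hsum, lintegral_finsetSum' _ fun E' _ => hm E', finsum_eq_sum_of_fintype,
      ENNReal.ofReal_sum_of_nonneg fun E' _ => integral_nonneg (density_nonneg n)]
    exact Finset.sum_congr rfl fun E' _ => lintegral_numNewRoots_eq_integral hn (hU' E')
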